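/- **Setting.** Let $g$ be the metric of an oriented Riemannian 3-manifold near a point $q$, written in oriented geodesic normal coordinates on $B_R(0)\subset\mathbb R^3$, $R>0$: $g$ is smooth, $g(0)=\mathrm{Id}$, and straight lines through $0$ are geodesics. Put $r=|x|$, $n=x/r$. Let $\tau_a=\sigma_a/2$ be the basis of $\mathfrak{su}(2)$ with $\sigma_1=\begin{pmatrix}0&i\\ i&0\end{pmatrix}$, $\sigma_2=\begin{pmatrix}0&1\\-1&0\end{pmatrix}$, $\sigma_3=\begin{pmatrix}i&0\\0&-i\end{pmatrix}$, normed by $|\tau_a|=1$; we use $F_A=dA+A\wedge A$ and $d_A\Phi=d\Phi+[A,\Phi]$. On Euclidean $\mathbb R^3$ let $$A_{BPS}=\Big(\tfrac1{\sinh r}-\tfrac1r\Big)(n\times\tau)\cdot dx,\qquad \Phi_{BPS}=\Big(\tfrac1{\tanh r}-\tfrac1r\Big)n\cdot\tau ,$$ $$A_{S}=-\tfrac1r\,(n\times\tau)\cdot dx,\qquad \Phi_{S}=\Big(1-\tfrac1r\Big)n\cdot\tau$$ be the BPS-monopole and the lifted Dirac monopole of charge $1$ and mass $1$, and let $A^\lambda$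 be the pull-back of $A$ under $x\mapsto\lambda x$ and $\Phi^\lambda(x)=\lambda\Phi(\lambda x)$. Let $(A_D,\varphi)$ be a smooth $U(1)$ Dirac monopole for $g$ on $B_R(0)\setminus\{0\}$ with signed charge $1$ and mass $m$ at $0$, so $\varphi=-\frac1{2r}+m+O(r)$, lifted to $SU(2)$: $\Phi_D=2\varphi\,n\cdot\tau$, $A_D$ is an $\mathfrak{su}(2)$-valued 1-form with $d_{A_D}(n\cdot\tau)=0$, and $*_gF_{A_D}=d_{A_D}\Phi_D$. The framing is chosen so that $A_D-A_S$ is bounded near $0$. For $\lambda>0$ let $\Phi_D^{(\lambda)}=\Phi_D+(\lambda-2m)\,n\cdot\tau$, the Higgs field of the same Dirac monopole shifted so that its lift has mass $\lambda$ at $0$. Fix a constant $K$. For $\lambda>0$ put $\epsilon=\lambda^{-1/2}$ (so $\lambda=\epsilon^{-2}$; assume $4\epsilon<R$) and consider any choice of: * a smooth Riemannian metric $h$ on $\mathbb R^3$ with $h=g$ for $r\le3\epsilon$, $h$ Euclidean for $r\ge4\epsilon$, and $|h_{ij}-\delta_{ij}|\le K\epsilon^2$ for $3\epsilon\le r\le4\epsilon$;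 write $\mathfrak R^3=(\mathbb R^3,h)$; * smooth cut-off functions $\xi,\zeta:\mathbb R^3\to[0,1]$ with $\xi=1$ for $r\le\epsilon$, $\xi=0$ for $r\ge2\epsilon$, $\zeta=1$ for $r\le3\epsilon$, $\zeta=0$ for $r\ge4\epsilon$, and $|\nabla\xi|,|\nabla\zeta|\le K\epsilon^{-1}$; * a measurable weight $w$ on $\mathfrak R^3$ with $w=\sqrt{\lambda^{-2}+\rho^2}$ where $\rho\le\frac12$ and $w=1$ where $\rho\ge1$, $\rho$ being the geodesic distance to $0$ in $\mathfrak R^3$. The approximate monopole on $\mathfrak R^3$ is $$(A_0,\Phi_0)=\zeta\big(\xi\,(A_{BPS}^\lambda,\Phi_{BPS}^\lambda)+(1-\xi)(A_D,\Phi_D^{(\lambda)})\big)+(1-\zeta)(A_S^\lambda,\Phi_S^\lambda),$$ and its error is $e_0=*_hF_{A_0}-d_{A_0}\Phi_0$. **Theorem.** For every such $(g,A_D,\varphi)$, every $K$ and every $\delta>0$ there is $\lambda_0>0$ such that for all $\lambda\ge\lambda_0$ and all $h,\xi,\zeta,w$ as above, $$w\,e_0\in L^3(\mathfrak R^3)\quad\text{and}\quad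 \|w\,e_0\|_{L^3(\mathfrak R^3)}<\delta ,$$ where norms and volume are those of $h$. -/

import Mathlib

open scoped ContDiff Topology

noncomputable section

namespace ApproxMonopole

/-- Coordinate space. -/
abbrev R3 := EuclideanSpace ℝ (Fin 3)

/-! ### The Lie algebra `su(2)` -/

/-- `su(2)`, in coordinates `u = u₁ τ₁ + u₂ τ₂ + u₃ τ₃` with respect to the basis `τₐ = σₐ / 2`,
where the matrices `σₐ` are listed in `sigma`. The Euclidean norm on coordinates is the
`Ad`-invariant norm with `|τₐ| = 1`. -/
abbrev Su2 := EuclideanSpace ℝ (Fin 3)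

/-- The matrices `σ₁, σ₂, σ₃`. -/
def sigma : Fin 3 → Matrix (Fin 2) (Fin 2) ℂ :=
  ![!![0, Complex.I; Complex.I, 0], !![0, 1; -1, 0], !![Complex.I, 0; 0, -Complex.I]]

/-- The traceless skew-Hermitian matrix with coordinates `u`. -/
def Su2.toMatrix (u : Su2) : Matrix (Fin 2) (Fin 2) ℂ :=
  ∑ a, ((u a / 2 : ℝ) : ℂ) • sigma a

/-- The Lie bracket of `su(2)`: `[τ₁, τ₂] = -τ₃` and cyclically. -/
def bracket (u v : Su2) : Su2 :=
  !₂[u 2 * v 1 - u 1 * v 2, u 0 * v 2 - u 2 * v 0, u 1 * v 0 - u 0 * v 1]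

/-- `bracket` is the commutator of matrices. -/
theorem toMatrix_bracket (u v : Su2) :
    Su2.toMatrix (bracket u v) =
      Su2.toMatrix u * Su2.toMatrix v - Su2.toMatrix v * Su2.toMatrix u := by
  ext i j
  fin_cases i <;> fin_cases j <;>
    simp [Su2.toMatrix, bracket, sigma, Fin.sum_univ_three] <;>
    ring_nf <;> simp only [Complex.I_sq] <;> ring

/-! ### Gauge fields on open subsets of `ℝ³` -/

/-- A connection on the trivial `SU(2)`-bundle: an `su(2)`-valued 1-form `∑ᵢ Aᵢ dxᵢ`. -/
abbrev Conn := R3 → Fin 3 → Su2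

/-- A Higgs field on the trivial `SU(2)`-bundle. -/
abbrev Higgs := R3 → Su2

/-- The `i`-th partial derivative. -/
def partialD {V : Type*} [NormedAddCommGroup V] [NormedSpace ℝ V] (i : Fin 3) (f : R3 → V)
    (x : R3) : V :=
  fderiv ℝ f x (EuclideanSpace.single i 1)

/-- The curvature `F_A = dA + A ∧ A`, with components `Fᵢⱼ = ∂ᵢAⱼ - ∂ⱼAᵢ + [Aᵢ, Aⱼ]`. -/
def curvature (A : Conn) (x : R3) (i j : Fin 3) : Su2 :=
  partialD i (fun y => A y j) x - partialD j (fun y => A y i) x + bracket (A x i) (A x j)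

/-- The covariant derivative `d_A Φ = dΦ + [A, Φ]`. -/
def covDeriv (A : Conn) (Φ : Higgs) (x : R3) (i : Fin 3) : Su2 :=
  partialD i Φ x + bracket (A x i) (Φ x)

/-- The Hodge star at a point, of the metric with matrix `G` and the standard orientation, on the
2-form `½ ∑ᵢⱼ Fᵢⱼ dxᵢ ∧ dxⱼ`. With `vol = √(det G) dx₁ ∧ dx₂ ∧ dx₃` this form is `ι_X vol` for
`X = (det G)^(-1/2) (F₂₃, F₃₁, F₁₂)`, and its Hodge star is the 1-form `G(X, ·)`. Indices are
read modulo 3. -/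
def hodgeStar (G : Matrix (Fin 3) (Fin 3) ℝ) (F : Fin 3 → Fin 3 → Su2) (k : Fin 3) : Su2 :=
  (√G.det)⁻¹ • ∑ l, G k l • F (l + 1) (l + 2)

/-- The Bogomolny error `e = *F_A - d_A Φ` with respect to the metric `g`. -/
def bogomolnyError (g : R3 → Matrix (Fin 3) (Fin 3) ℝ) (A : Conn) (Φ : Higgs) (x : R3)
    (k : Fin 3) : Su2 :=
  hodgeStar (g x) (curvature A x) k - covDeriv A Φ x k

/-! ### Riemannian metrics in coordinates -/

/-- `g` is a smooth Riemannian metric on `U`. -/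
structure IsMetricOn (g : R3 → Matrix (Fin 3) (Fin 3) ℝ) (U : Set R3) : Prop where
  smooth : ∀ i j, ContDiffOn ℝ ∞ (fun x => g x i j) U
  posDef : ∀ x ∈ U, (g x).PosDef

/-- The Christoffel symbol `Γᵏᵢⱼ` of `g`. -/
def christoffel (g : R3 → Matrix (Fin 3) (Fin 3) ℝ) (x : R3) (k i j : Fin 3) : ℝ :=
  1 / 2 * ∑ l, (g x)⁻¹ k l *
    (partialD i (fun y => g y j l) x + partialD j (fun y => g y i l) x
      - partialD l (fun y => g y i j) x)

/-- The curve `γ` satisfies the geodesic equation of `g` at time `t`. -/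
def GeodesicEqAt (g : R3 → Matrix (Fin 3) (Fin 3) ℝ) (γ : ℝ → R3) (t : ℝ) : Prop :=
  ∀ k, deriv (deriv (fun s => γ s k)) t +
    ∑ i, ∑ j, christoffel g (γ t) k i j *
      deriv (fun s => γ s i) t * deriv (fun s => γ s j) t = 0

/-- The coordinates on the ball of radius `R` are geodesic normal coordinates for `g`: they are
orthonormal at the origin and straight lines through the origin are geodesics. -/
structure IsNormalCoord (g : R3 → Matrix (Fin 3) (Fin 3) ℝ) (R : ℝ) : Prop where
  orthonormal : g 0 = 1
  radial : ∀ (v : R3) (t : ℝ), t • v ∈ Metric.ball (0 : R3) R →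
    GeodesicEqAt g (fun s => s • v) t

/-- The length of a curve `γ : [0, 1] → ℝ³` in the metric `g`. -/
def curveLength (g : R3 → Matrix (Fin 3) (Fin 3) ℝ) (γ : ℝ → R3) : ℝ :=
  ∫ t in (0 : ℝ)..1, √(∑ i, ∑ j, g (γ t) i j * deriv γ t i * deriv γ t j)

/-- The geodesic distance from the origin in the metric `g` on `ℝ³`. -/
def geodesicDist (g : R3 → Matrix (Fin 3) (Fin 3) ℝ) (x : R3) : ℝ :=
  sInf {L | ∃ γ : ℝ → R3, ContDiff ℝ 1 γ ∧ γ 0 = 0 ∧ γ 1 = x ∧ curveLength g γ = L}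

/-- The pointwise norm of an `su(2)`-valued 1-form in the metric `g`. -/
def formNorm (g : R3 → Matrix (Fin 3) (Fin 3) ℝ) (e : R3 → Fin 3 → Su2) (x : R3) : ℝ :=
  √(∑ i, ∑ j, (g x)⁻¹ i j * inner ℝ (e x i) (e x j))

/-- The Riemannian volume measure of `g`. -/
def volumeMeasure (g : R3 → Matrix (Fin 3) (Fin 3) ℝ) : MeasureTheory.Measure R3 :=
  MeasureTheory.volume.withDensity fun x => ENNReal.ofReal √(g x).det

/-! ### The model monopoles on Euclidean `ℝ³` -/

/-- `n = x / |x|`, also read as the section `n · τ` of `su(2)`. -/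
def unitRadial (x : R3) : R3 := ‖x‖⁻¹ • x

/-- The `su(2)`-valued 1-form `(n × τ) · dx`; its component along `dxᵢ` is `∑ εᵢₐᵦ nₐ τᵦ`. -/
def hedgehogForm : Conn := fun x =>
  ![!₂[0, -unitRadial x 2, unitRadial x 1],
    !₂[unitRadial x 2, 0, -unitRadial x 0],
    !₂[-unitRadial x 1, unitRadial x 0, 0]]

/-- The connection `(1 / sinh r - 1 / r) (n × τ) · dx` of the BPS-monopole. -/
def bpsConn : Conn := fun x i => (1 / Real.sinh ‖x‖ - 1 / ‖x‖) • hedgehogForm x i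

/-- The Higgs field `(1 / tanh r - 1 / r) n · τ` of the BPS-monopole. -/
def bpsHiggs : Higgs := fun x => (1 / Real.tanh ‖x‖ - 1 / ‖x‖) • unitRadial x

/-- The connection of the Euclidean Dirac monopole of charge `1`, lifted to `SU(2)`, in the
trivialisation over `ℝ³ ∖ {0}` in which the Higgs field points along `n`. -/
def diracConn : Conn := fun x i => (-(1 / ‖x‖)) • hedgehogForm x i

/-- The Higgs field of the Euclidean Dirac monopole of charge `1`, lifted to `SU(2)`, with
mass `1`. -/
def diracHiggs : Higgs := fun x => (1 - 1 / ‖x‖) • unitRadial x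

/-- The pull-back of a connection under `x ↦ lam x`. -/
def scaleConn (lam : ℝ) (A : Conn) : Conn := fun x i => lam • A (lam • x) i

/-- The scaled Higgs field `lam Φ(lam x)`. -/
def scaleHiggs (lam : ℝ) (Φ : Higgs) : Higgs := fun x => lam • Φ (lam • x)

/-! ### The Dirac monopole of a Riemannian metric near a singular point of charge one -/

/-- The lift to `su(2)` of a `U(1)` Higgs field `φ`: `φ σ₃`, where the framing takes
`σ₃ = 2 τ₃` to `2 n · τ`. -/
def liftHiggs (φ : R3 → ℝ) : Higgs := fun x => (2 * φ x) • unitRadial x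

/-- `(A, φ)` is a `U(1)` Dirac monopole on the punctured ball of radius `R`, for the metric `g`
in normal coordinates, with signed charge `1` and mass `m` at the origin. Its `U(1)`-connection
is given by its `SU(2)`-lift `A` in a framing that takes the trivial summand of the adjoint bundle
to the line spanned by `n`; so `n` is `A`-parallel. -/
structure IsDiracMonopole (g : R3 → Matrix (Fin 3) (Fin 3) ℝ) (R m : ℝ) (A : Conn)
    (φ : R3 → ℝ) : Prop where
  smooth_conn : ∀ i, ContDiffOn ℝ ∞ (fun x => A x i) (Metric.ball 0 R \ {0})
  smooth_higgs : ContDiffOn ℝ ∞ φ (Metric.ball 0 R \ {0})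
  /-- The connection is reducible to `U(1)`. -/
  parallel : ∀ x ∈ Metric.ball (0 : R3) R \ {0}, ∀ i, covDeriv A unitRadial x i = 0
  /-- The Bogomolny equation. -/
  bogomolny : ∀ x ∈ Metric.ball (0 : R3) R \ {0}, ∀ i,
    bogomolnyError g A (liftHiggs φ) x i = 0
  /-- `φ = -1 / (2 r) + m + O(r)`. -/
  singularity : (fun x => φ x - (-(1 / (2 * ‖x‖)) + m)) =O[𝓝[≠] (0 : R3)] fun x => ‖x‖
  /-- The framing identifies `A` with the Euclidean Dirac connection up to a bounded term. -/
  framing : ∀ i, (fun x => A x i - diracConn x i) =O[𝓝[≠] (0 : R3)] fun _ => (1 : ℝ)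

/-! ### The approximate monopole -/

/-- The gluing scale `ε = lam^(-1/2)`. -/
def glueScale (lam : ℝ) : ℝ := (√lam)⁻¹

/-- `ξ` is a smooth cut-off function, `1` on the ball of radius `a` and `0` outside the ball of
radius `b`, with gradient bounded by `c`. -/
structure IsCutoff (ξ : R3 → ℝ) (a b c : ℝ) : Prop where
  smooth : ContDiff ℝ ∞ ξ
  nonneg : ∀ x, 0 ≤ ξ x
  le_one : ∀ x, ξ x ≤ 1
  eq_one : ∀ x, ‖x‖ ≤ a → ξ x = 1
  eq_zero : ∀ x, b ≤ ‖x‖ → ξ x = 0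
  grad : ∀ x, ‖fderiv ℝ ξ x‖ ≤ c

/-- `h` is a Riemannian metric on all of `ℝ³` that extends `g` from the ball of radius `3 ε`, is
Euclidean outside the ball of radius `4 ε`, and in between is `K ε²`-close to the Euclidean
metric. -/
structure IsExtendedMetric (g h : R3 → Matrix (Fin 3) (Fin 3) ℝ) (ε K : ℝ) : Prop where
  metric : IsMetricOn h Set.univ
  inner : ∀ x, ‖x‖ ≤ 3 * ε → h x = g x
  outer : ∀ x, 4 * ε ≤ ‖x‖ → h x = 1
  shell : ∀ x, 3 * ε ≤ ‖x‖ → ‖x‖ ≤ 4 * ε → ∀ i j,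
    |h x i j - (1 : Matrix (Fin 3) (Fin 3) ℝ) i j| ≤ K * ε ^ 2

/-- The connection `A₀`: the scaled BPS-monopole for `|x| ≤ ε`, the Dirac monopole of `g` for
`2 ε ≤ |x| ≤ 3 ε`, and the scaled Euclidean Dirac monopole for `4 ε ≤ |x|`, where `ξ` is the
cut-off function between `ε` and `2 ε` and `ζ` the one between `3 ε` and `4 ε`. -/
def approxConn (lam : ℝ) (ξ ζ : R3 → ℝ) (A : Conn) : Conn := fun x i =>
  ζ x • (ξ x • scaleConn lam bpsConn x i + (1 - ξ x) • A x i)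
    + (1 - ζ x) • scaleConn lam diracConn x i

/-- The Higgs field `Φ₀`, glued in the same way. The Higgs field of the Dirac monopole of `g` is
shifted by a constant so that its lift to `SU(2)` has mass `lam` at the origin. -/
def approxHiggs (lam m : ℝ) (ξ ζ : R3 → ℝ) (φ : R3 → ℝ) : Higgs := fun x =>
  ζ x • (ξ x • scaleHiggs lam bpsHiggs x
      + (1 - ξ x) • liftHiggs (fun y => φ y + (lam / 2 - m)) x)
    + (1 - ζ x) • scaleHiggs lam diracHiggs x

/-- `w` is a weight function: `w = √(lam⁻² + r²)` for `r ≤ 1/2` and `w = 1` for `r ≥ 1`, where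
`r` is the geodesic distance from the origin in the metric `h`. -/
structure IsWeight (h : R3 → Matrix (Fin 3) (Fin 3) ℝ) (lam : ℝ) (w : R3 → ℝ) : Prop where
  measurable : Measurable w
  near : ∀ x, geodesicDist h x ≤ 1 / 2 → w x = √((lam ^ 2)⁻¹ + geodesicDist h x ^ 2)
  far : ∀ x, 1 ≤ geodesicDist h x → w x = 1

end ApproxMonopole

end

noncomputable section

namespace ApproxMonopole

/-! ### Calculus of partial derivatives -/

section PartialDerivatives

variable {V : Type*} [NormedAddCommGroup V] [NormedSpace ℝ V]

/-! The error lives in the ball r ≤ 4ε: beyond it h is Euclidean and the configuration is the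
Euclidean Dirac monopole, an exact solution. Inside, off the origin, each component of e₀ is at most
E/ε with E independent of λ (`norm_bogomolnyError_approx_le`), while the weight is at most 9ε
(`IsWeight.abs_le`), because λ⁻¹ = ε² and the geodesic distance is at most 2r. So |w e₀| is bounded
on a set of volume O(ε³), and its L³ norm is O(ε).

The pointwise bound has two sources. First, a monopole for one metric is tested with another, which
costs (∗_h - ∗_g)F or (∗_h - ∗)F. Normal coordinates make the Christoffel symbols vanish at 0, so g
= Id + O(r²) (`exists_nearId`); the curvatures involved are O(r⁻²), so this part is bounded. Second,
the cut-offs: interpolating between two configurations adds dχ times their difference and terms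
quadratic in the difference (`norm_bogomolnyError_glue_le`). For ε ≤ r ≤ 4ε the differences are
bounded: between the two Dirac monopoles by the framing and the expansion of φ, between the BPS and
the Euclidean Dirac monopole because λ/sinh(λr) ≤ 4 once λr² ≥ 1. With |dχ| ≤ K/ε this gives the
order 1/ε.

What is not given is that the curvature of the Dirac monopole of g is O(r⁻²): the hypotheses control
the size of φ at 0, not its derivatives. But the Bianchi identity makes φ harmonic, so an interior
gradient estimate on the ball of radius r/2 about a point at distance r from 0 turns φ = O(r⁻¹) into
∇φ = O(r⁻²), and the Bogomolny equation passes this on to the curvature. The gradient estimate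
(`gradient_estimate`) is proved by Bernstein's maximum principle argument. -/

theorem partialD_congr {f g : R3 → V} {x : R3} (h : f =ᶠ[𝓝 x] g) (i : Fin 3) :
    partialD i f x = partialD i g x := by
  simp only [partialD, h.fderiv_eq]

theorem partialD_const (c : V) (i : Fin 3) (x : R3) : partialD i (fun _ => c) x = 0 := by
  simp [partialD]

theorem partialD_add {f g : R3 → V} {x : R3} (hf : DifferentiableAt ℝ f x)
    (hg : DifferentiableAt ℝ g x) (i : Fin 3) :
    partialD i (fun y => f y + g y) x = partialD i f x + partialD i g x := by
  simp only [partialD, fderiv_fun_add hf hg]; rfl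

theorem partialD_sub {f g : R3 → V} {x : R3} (hf : DifferentiableAt ℝ f x)
    (hg : DifferentiableAt ℝ g x) (i : Fin 3) :
    partialD i (fun y => f y - g y) x = partialD i f x - partialD i g x := by
  simp only [partialD, fderiv_fun_sub hf hg]; rfl

theorem partialD_smul {c : R3 → ℝ} {f : R3 → V} {x : R3} (hc : DifferentiableAt ℝ c x)
    (hf : DifferentiableAt ℝ f x) (i : Fin 3) :
    partialD i (fun y => c y • f y) x = c x • partialD i f x + partialD i c x • f x := by
  simp only [partialD, fderiv_fun_smul hc hf]
  simp

theorem partialD_mul {f g : R3 → ℝ} {x : R3} (hf : DifferentiableAt ℝ f x)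
    (hg : DifferentiableAt ℝ g x) (i : Fin 3) :
    partialD i (fun y => f y * g y) x = f x * partialD i g x + g x * partialD i f x := by
  simp only [partialD, fderiv_fun_mul hf hg]
  simp

theorem partialD_const_mul {f : R3 → ℝ} {x : R3} (c : ℝ) (hf : DifferentiableAt ℝ f x)
    (i : Fin 3) : partialD i (fun y => c * f y) x = c * partialD i f x := by
  rw [partialD_mul (differentiableAt_const c) hf, partialD_const]; ring

theorem partialD_sum {ι : Type*} (s : Finset ι) {f : ι → R3 → V} {x : R3}
    (hf : ∀ k ∈ s, DifferentiableAt ℝ (f k) x) (i : Fin 3) :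
    partialD i (fun y => ∑ k ∈ s, f k y) x = ∑ k ∈ s, partialD i (f k) x := by
  simp only [partialD, fderiv_fun_sum hf, sum_apply]

theorem partialD_coord {f : R3 → Su2} {x : R3} (hf : DifferentiableAt ℝ f x) (i a : Fin 3) :
    partialD i (fun y => f y a) x = partialD i f x a := by
  have h := (EuclideanSpace.proj (𝕜 := ℝ) (ι := Fin 3) a).hasFDerivAt.comp x hf.hasFDerivAt
  have h2 : HasFDerivAt (fun y => f y a) _ x := h
  simp only [partialD, h2.fderiv]
  rfl

theorem partialD_comp {f : R3 → ℝ} {k : ℝ → ℝ} {k' : ℝ} {x : R3} (hk : HasDerivAt k k' (f x))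
    (hf : DifferentiableAt ℝ f x) (i : Fin 3) :
    partialD i (fun y => k (f y)) x = k' * partialD i f x := by
  have h := hk.comp_hasFDerivAt x hf.hasFDerivAt
  have h2 : HasFDerivAt (fun y => k (f y)) _ x := h
  simp only [partialD, h2.fderiv]
  simp

theorem contDiffAt_partialD {f : R3 → V} {x : R3} (hf : ContDiffAt ℝ ∞ f x) (i : Fin 3) :
    ContDiffAt ℝ ∞ (partialD i f) x :=
  (hf.fderiv_right (m := ∞) (by simp)).clm_apply contDiffAt_const

theorem ContDiffAt.smoothDifferentiableAt {f : R3 → V} {x : R3} (hf : ContDiffAt ℝ ∞ f x) :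
    DifferentiableAt ℝ f x :=
  hf.differentiableAt (by simp)

theorem partialD_partialD {f : R3 → V} {x : R3} (hf : ContDiffAt ℝ 2 f x) (i j : Fin 3) :
    partialD i (partialD j f) x =
      fderiv ℝ (fderiv ℝ f) x (EuclideanSpace.single i 1) (EuclideanSpace.single j 1) := by
  have h1 : DifferentiableAt ℝ (fderiv ℝ f) x :=
    ContDiffAt.differentiableAt (hf.fderiv_right (m := 1) (by norm_num)) (by simp)
  have := fderiv_clm_apply h1
    (differentiableAt_const (EuclideanSpace.single j 1 : R3) (x := x))
  have h2 : fderiv ℝ (partialD j f) x = _ := this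
  simp only [partialD] at h2 ⊢
  rw [h2]
  simp

theorem partialD_comm {f : R3 → V} {x : R3} (hf : ContDiffAt ℝ 2 f x) (i j : Fin 3) :
    partialD i (partialD j f) x = partialD j (partialD i f) x := by
  rw [partialD_partialD hf, partialD_partialD hf]
  exact (hf.isSymmSndFDerivAt (by simp)) _ _

theorem eventually_differentiableAt {f : R3 → V} {x : R3} (hf : ContDiffAt ℝ ∞ f x) :
    ∀ᶠ y in 𝓝 x, DifferentiableAt ℝ f y := by
  have h1 : ContDiffAt ℝ 1 f x := hf.of_le (by simp)
  filter_upwards [h1.eventually (by simp)] with y hy using hy.differentiableAt (by simp)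

theorem partialD_partialD_mul {f g : R3 → ℝ} {x : R3} (hf : ContDiffAt ℝ ∞ f x)
    (hg : ContDiffAt ℝ ∞ g x) (i j : Fin 3) :
    partialD i (partialD j (fun y => f y * g y)) x =
      f x * partialD i (partialD j g) x + partialD i f x * partialD j g x
        + partialD j f x * partialD i g x + g x * partialD i (partialD j f) x := by
  have h : partialD j (fun y => f y * g y) =ᶠ[𝓝 x]
      fun y => f y * partialD j g y + g y * partialD j f y := by
    filter_upwards [eventually_differentiableAt hf, eventually_differentiableAt hg] with y h1 h2
      using partialD_mul h1 h2 j
  have df := ContDiffAt.smoothDifferentiableAt hf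
  have dg := ContDiffAt.smoothDifferentiableAt hg
  have df' := ContDiffAt.smoothDifferentiableAt (contDiffAt_partialD hf j)
  have dg' := ContDiffAt.smoothDifferentiableAt (contDiffAt_partialD hg j)
  rw [partialD_congr h, partialD_add (df.fun_mul dg') (dg.fun_mul df'), partialD_mul df dg',
    partialD_mul dg df']
  ring

theorem partialD_partialD_add {f g : R3 → ℝ} {x : R3} (hf : ContDiffAt ℝ ∞ f x)
    (hg : ContDiffAt ℝ ∞ g x) (i j : Fin 3) :
    partialD i (partialD j (fun y => f y + g y)) x =
      partialD i (partialD j f) x + partialD i (partialD j g) x := by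
  have h : partialD j (fun y => f y + g y) =ᶠ[𝓝 x]
      fun y => partialD j f y + partialD j g y := by
    filter_upwards [eventually_differentiableAt hf, eventually_differentiableAt hg] with y h1 h2
      using partialD_add h1 h2 j
  rw [partialD_congr h, partialD_add
    (ContDiffAt.smoothDifferentiableAt (contDiffAt_partialD hf j))
    (ContDiffAt.smoothDifferentiableAt (contDiffAt_partialD hg j))]

theorem partialD_coordinate (i a : Fin 3) (x : R3) :
    partialD i (fun y : R3 => y a) x = if a = i then 1 else 0 := by
  rw [partialD_coord (f := fun y => y) differentiableAt_fun_id]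
  simp [partialD]

theorem contDiff_coordinate (a : Fin 3) : ContDiff ℝ ∞ (fun y : R3 => y a) :=
  (EuclideanSpace.proj (𝕜 := ℝ) (ι := Fin 3) a).contDiff

end PartialDerivatives

/-! ### The second derivative test -/

/-- If the second derivative were positive, the point would also be a local minimum; then f is
locally constant and its second derivative is zero. -/
theorem deriv_deriv_nonpos_of_isLocalMax {f : ℝ → ℝ} {t : ℝ} (hf : ContinuousAt f t)
    (hmax : IsLocalMax f t) : deriv (deriv f) t ≤ 0 := by
  by_contra! hpos
  have hmin := isLocalMin_of_deriv_deriv_pos hpos hmax.deriv_eq_zero hf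
  have hconst : f =ᶠ[𝓝 t] fun _ => f t := by
    filter_upwards [hmax, hmin] with s h1 h2 using le_antisymm h1 h2
  have : deriv (deriv f) t = 0 := by
    rw [(hconst.deriv).deriv_eq]; simp
  linarith

/-- Restriction to the line s ↦ x + s v reduces this to one variable. -/
theorem sndFDeriv_nonpos_of_isLocalMax {W : R3 → ℝ} {x : R3} (hW : ContDiffAt ℝ ∞ W x)
    (hmax : IsLocalMax W x) (v : R3) : fderiv ℝ (fderiv ℝ W) x v v ≤ 0 := by
  have hline : ∀ t : ℝ, HasDerivAt (fun s : ℝ => x + s • v) v t := fun t => by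
    simpa using ((hasDerivAt_id t).smul_const v).const_add x
  have hlim : Filter.Tendsto (fun s : ℝ => x + s • v) (𝓝 0) (𝓝 x) := by
    have := (hline 0).continuousAt.tendsto
    simpa using this
  have h1 : deriv (fun s : ℝ => W (x + s • v)) =ᶠ[𝓝 0]
      fun s => fderiv ℝ W (x + s • v) v := by
    filter_upwards [hlim.eventually (eventually_differentiableAt hW)] with s hs
    exact (hs.hasFDerivAt.comp_hasDerivAt s (hline s)).deriv
  have hd : DifferentiableAt ℝ (fderiv ℝ W) (x + (0 : ℝ) • v) := by
    simpa using ContDiffAt.differentiableAt (hW.fderiv_right (m := ∞) (by simp)) (by simp)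
  have h2 : HasDerivAt (fun s : ℝ => fderiv ℝ W (x + s • v) v)
      (fderiv ℝ (fderiv ℝ W) x v v) 0 := by
    have := hd.hasFDerivAt.comp_hasDerivAt (0 : ℝ) (hline 0)
    have := this.clm_apply (hasDerivAt_const (0 : ℝ) v)
    simpa using this
  rw [← h2.deriv, ← h1.deriv_eq]
  refine deriv_deriv_nonpos_of_isLocalMax ?_ ?_
  · have : ContinuousAt W (x + (0 : ℝ) • v) := by simpa using hW.continuousAt
    exact ContinuousAt.comp (f := fun s : ℝ => x + s • v) this (hline 0).continuousAt
  · have := hlim.eventually hmax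
    simpa [IsLocalMax, IsMaxFilter] using this

/-- Writing a = BᵀB turns the contraction into a sum of second derivatives along the rows of B. -/
theorem sum_hessian_nonpos_of_isLocalMax {W : R3 → ℝ} {x : R3} (hW : ContDiffAt ℝ ∞ W x)
    (hmax : IsLocalMax W x) {a : Matrix (Fin 3) (Fin 3) ℝ} (ha : a.PosSemidef) :
    ∑ i, ∑ j, a i j * partialD i (partialD j W) x ≤ 0 := by
  obtain ⟨B, hB⟩ : ∃ B : Matrix (Fin 3) (Fin 3) ℝ, a = B.conjTranspose * B := by
    open scoped MatrixOrder in exact CStarAlgebra.nonneg_iff_eq_star_mul_self.mp ha.nonneg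
  have h : ∑ i, ∑ j, a i j * partialD i (partialD j W) x =
      ∑ m, fderiv ℝ (fderiv ℝ W) x (∑ i, B m i • EuclideanSpace.single i 1)
        (∑ i, B m i • EuclideanSpace.single i 1) := by
    simp only [partialD_partialD (hW.of_le ENat.LEInfty.out), hB, Matrix.mul_apply, Matrix.conjTranspose_apply,
      star_trivial, Fin.sum_univ_three, map_add, map_smul, add_apply, smul_apply, smul_eq_mul]
    ring
  rw [h]
  exact Finset.sum_nonpos fun m _ => sndFDeriv_nonpos_of_isLocalMax hW hmax _

/-! ### Bernstein's interior gradient estimate -/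

theorem abs_sum_three_le {f : Fin 3 → ℝ} {B : ℝ} (h : ∀ i, |f i| ≤ B) : |∑ i, f i| ≤ 3 * B := by
  refine (Finset.abs_sum_le_sum_abs _ _).trans ((Finset.sum_le_sum fun i _ => h i).trans ?_)
  simp

theorem abs_mul_le_mul {a b c d : ℝ} (h1 : |a| ≤ c) (h2 : |b| ≤ d) : |a * b| ≤ c * d := by
  rw [abs_mul]
  exact mul_le_mul h1 h2 (abs_nonneg _) ((abs_nonneg _).trans h1)

theorem abs_le_of_sum_sq {P : Fin 3 → ℝ} {p : ℝ} (hp : 0 ≤ p) (h : p ^ 2 = ∑ k, P k ^ 2)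
    (k : Fin 3) : |P k| ≤ p := by
  refine abs_le_of_sq_le_sq ?_ hp
  rw [h]
  exact Finset.single_le_sum (f := fun k => P k ^ 2) (fun i _ => sq_nonneg _) (Finset.mem_univ k)

/-- The constant in front of `s²` in the auxiliary function of Bernstein's method. -/
def bernsteinConst (ν M : ℝ) : ℝ := ((504 * M) ^ 2 / (8 * ν) + 126 * M + 1) / ν

-- The algebra of Bernstein's method at an interior maximum: P, Q, T stand for the first, second and
-- third derivatives of u, and η, e for the cut-off function and its gradient. `hE` is the equation,
-- `hE'` its derivative, and `hmax` the second derivative test for η²|∇u|² + s²L u².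
set_option maxHeartbeats 1000000 in
theorem bernstein_inequality {ν M N s η u p q : ℝ} (hν : 0 < ν) (hM : 0 ≤ M) (hN : |u| ≤ N)
    (hs : 0 < s) (hs1 : s ≤ 1) (hη : 0 ≤ η) (hηs : η ≤ s ^ 2)
    {a : Fin 3 → Fin 3 → ℝ} {b : Fin 3 → ℝ} {da : Fin 3 → Fin 3 → Fin 3 → ℝ}
    {db : Fin 3 → Fin 3 → ℝ} {e P : Fin 3 → ℝ} {Q : Fin 3 → Fin 3 → ℝ}
    {T : Fin 3 → Fin 3 → Fin 3 → ℝ}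
    (ha : ∀ i j, |a i j| ≤ M) (hb : ∀ i, |b i| ≤ M) (hda : ∀ k i j, |da k i j| ≤ M)
    (hdb : ∀ k j, |db k j| ≤ M)
    (hell : ∀ v : Fin 3 → ℝ, ν * ∑ i, v i ^ 2 ≤ ∑ i, ∑ j, a i j * v i * v j)
    (he : ∀ i, |e i| ≤ 2 * s)
    (hp : 0 ≤ p) (hpP : p ^ 2 = ∑ k, P k ^ 2)
    (hq : 0 ≤ q) (hqQ : q ^ 2 = ∑ k, ∑ i, Q i k ^ 2)
    (hE : ∑ i, ∑ j, a i j * Q i j + ∑ j, b j * P j = 0)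
    (hE' : ∀ k, ∑ i, ∑ j, (da k i j * Q i j + a i j * T k i j)
      + ∑ j, (db k j * P j + b j * Q k j) = 0)
    (hmax : ∑ i, ∑ j, a i j * (η ^ 2 * (∑ k, (2 * Q i k * Q j k + 2 * P k * T k i j))
        + 2 * η * e i * (∑ k, 2 * P k * Q j k) + 2 * η * e j * (∑ k, 2 * P k * Q i k)
        + (∑ k, P k ^ 2) * (2 * e i * e j + 2 * η * (if i = j then -2 else 0))
        + s ^ 2 * bernsteinConst ν M * (2 * u * Q i j + 2 * P i * P j)) ≤ 0) :
    ν * p ≤ 6 * M * N := by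
  have hP := abs_le_of_sum_sq hp hpP
  have hQ : ∀ i k, |Q i k| ≤ q := fun i k => by
    refine abs_le_of_sq_le_sq ?_ hq
    rw [hqQ]
    exact (Finset.single_le_sum (f := fun i => Q i k ^ 2) (fun i _ => sq_nonneg _)
      (Finset.mem_univ i)).trans (Finset.single_le_sum (f := fun k => ∑ i, Q i k ^ 2)
      (fun i _ => Finset.sum_nonneg fun _ _ => sq_nonneg _) (Finset.mem_univ k))
  have hN0 : 0 ≤ N := (abs_nonneg _).trans hN
  set L := bernsteinConst ν M with hL
  have hLν : L * ν = (504 * M) ^ 2 / (8 * ν) + 126 * M + 1 := by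
    rw [hL, bernsteinConst]; field_simp
  have hLpos : 0 < L := by
    have : 0 < L * ν := by rw [hLν]; positivity
    exact pos_of_mul_pos_left this hν.le
  have hS1 : ν * q ^ 2 ≤ ∑ k, ∑ i, ∑ j, a i j * Q i k * Q j k := by
    rw [hqQ, Finset.mul_sum]
    exact Finset.sum_le_sum fun k _ => hell fun i => Q i k
  -- The differentiated equation trades third derivatives for lower ones; 12 = 9 + 3 counts the
  -- second derivatives that come with `da` and with `b`.
  have hT : ∀ k, |∑ i, ∑ j, a i j * T k i j| ≤ 12 * M * q + 3 * M * p := fun k => by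
    have h1 : |∑ i, ∑ j, da k i j * Q i j| ≤ 3 * (3 * (M * q)) :=
      abs_sum_three_le fun i => abs_sum_three_le fun j => abs_mul_le_mul (hda k i j) (hQ i j)
    have h2 : |∑ j, db k j * P j| ≤ 3 * (M * p) :=
      abs_sum_three_le fun j => abs_mul_le_mul (hdb k j) (hP j)
    have h3 : |∑ j, b j * Q k j| ≤ 3 * (M * q) :=
      abs_sum_three_le fun j => abs_mul_le_mul (hb j) (hQ k j)
    have h4 := hE' k
    simp only [Finset.sum_add_distrib] at h4
    rw [abs_le] at *
    constructor <;> linarith [h1.1, h1.2, h2.1, h2.2, h3.1, h3.2]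
  have hS2 : |∑ k, P k * ∑ i, ∑ j, a i j * T k i j| ≤ 3 * (p * (12 * M * q + 3 * M * p)) :=
    abs_sum_three_le fun k => abs_mul_le_mul (hP k) (hT k)
  have hS3 : |∑ i, ∑ j, a i j * (e i * ∑ k, P k * Q j k)| ≤
      3 * (3 * (M * (2 * s * (3 * (p * q))))) :=
    abs_sum_three_le fun i => abs_sum_three_le fun j => abs_mul_le_mul (ha i j)
      (abs_mul_le_mul (he i) (abs_sum_three_le fun k => abs_mul_le_mul (hP k) (hQ j k)))
  have hS3' : |∑ i, ∑ j, a i j * (e j * ∑ k, P k * Q i k)| ≤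
      3 * (3 * (M * (2 * s * (3 * (p * q))))) :=
    abs_sum_three_le fun i => abs_sum_three_le fun j => abs_mul_le_mul (ha i j)
      (abs_mul_le_mul (he j) (abs_sum_three_le fun k => abs_mul_le_mul (hP k) (hQ i k)))
  have hS4 : |∑ i, ∑ j, a i j * (2 * e i * e j + 2 * η * (if i = j then -2 else 0))| ≤
      3 * (3 * (M * (12 * s ^ 2))) := by
    refine abs_sum_three_le fun i => abs_sum_three_le fun j => abs_mul_le_mul (ha i j) ?_
    have h1 : |e i * e j| ≤ 2 * s * (2 * s) := abs_mul_le_mul (he i) (he j)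
    rw [abs_le] at *
    split_ifs <;> constructor <;> nlinarith [h1.1, h1.2]
  have hS6 : ν * p ^ 2 ≤ ∑ i, ∑ j, a i j * P i * P j := by
    rw [hpP]; exact hell P
  have hS5 : |u * ∑ j, b j * P j| ≤ N * (3 * (M * p)) :=
    abs_mul_le_mul hN (abs_sum_three_le fun j => abs_mul_le_mul (hb j) (hP j))
  -- The first sum and the last one are the good terms: ellipticity makes them at least 2νη²q² and,
  -- up to the factor in front, νp². They have to absorb all others.
  have hsplit : 2 * η ^ 2 * (∑ k, ∑ i, ∑ j, a i j * Q i k * Q j k)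
      + 2 * η ^ 2 * (∑ k, P k * ∑ i, ∑ j, a i j * T k i j)
      + 4 * η * ((∑ i, ∑ j, a i j * (e i * ∑ k, P k * Q j k))
        + (∑ i, ∑ j, a i j * (e j * ∑ k, P k * Q i k)))
      + p ^ 2 * (∑ i, ∑ j, a i j * (2 * e i * e j + 2 * η * (if i = j then -2 else 0)))
      + 2 * s ^ 2 * L * (u * (∑ i, ∑ j, a i j * Q i j) + ∑ i, ∑ j, a i j * P i * P j) ≤ 0 := by
    refine le_trans (le_of_eq ?_) hmax
    rw [hpP]
    simp only [Fin.sum_univ_three]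
    ring
  have hE2 : ∑ i, ∑ j, a i j * Q i j = -∑ j, b j * P j := by linarith
  rw [hE2] at hsplit
  generalize (∑ k, ∑ i, ∑ j, a i j * Q i k * Q j k) = S1 at *
  generalize (∑ k, P k * ∑ i, ∑ j, a i j * T k i j) = S2 at *
  generalize (∑ i, ∑ j, a i j * (e i * ∑ k, P k * Q j k)) = S3 at *
  generalize (∑ i, ∑ j, a i j * (e j * ∑ k, P k * Q i k)) = S3' at *
  generalize (∑ i, ∑ j, a i j * (2 * e i * e j + 2 * η * (if i = j then -2 else 0))) = S4 at *
  generalize (∑ i, ∑ j, a i j * P i * P j) = S6 at *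
  generalize (∑ j, b j * P j) = S5 at *
  have hηs' : η ≤ s := hηs.trans (by nlinarith)
  have hη2 : η ^ 2 ≤ s ^ 2 := by gcongr
  have t1 : 2 * η ^ 2 * (ν * q ^ 2) ≤ 2 * η ^ 2 * S1 := by gcongr
  have t2 : -(72 * M * ((η * q) * (s * p)) + 18 * M * (s ^ 2 * p ^ 2)) ≤ 2 * η ^ 2 * S2 := by
    have h1 : 2 * η ^ 2 * -(3 * (p * (12 * M * q + 3 * M * p))) ≤ 2 * η ^ 2 * S2 :=
      mul_le_mul_of_nonneg_left (abs_le.mp hS2).1 (by positivity)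
    have h2 : 72 * M * (η * q * p) * η ≤ 72 * M * (η * q * p) * s := by gcongr
    have h3 : 18 * M * p ^ 2 * η ^ 2 ≤ 18 * M * p ^ 2 * s ^ 2 := by gcongr
    linarith
  have t3 : -(432 * M * ((η * q) * (s * p))) ≤ 4 * η * (S3 + S3') := by
    have h1 : 4 * η * -(108 * M * s * p * q) ≤ 4 * η * (S3 + S3') :=
      mul_le_mul_of_nonneg_left (by linarith [(abs_le.mp hS3).1, (abs_le.mp hS3').1])
        (by positivity)
    linarith
  have t4 : -(108 * M * (s ^ 2 * p ^ 2)) ≤ p ^ 2 * S4 := by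
    have h1 : p ^ 2 * -(3 * (3 * (M * (12 * s ^ 2)))) ≤ p ^ 2 * S4 :=
      mul_le_mul_of_nonneg_left (abs_le.mp hS4).1 (by positivity)
    linarith
  have t5 : 2 * s ^ 2 * L * (ν * p ^ 2 - N * (3 * (M * p))) ≤ 2 * s ^ 2 * L * (u * -S5 + S6) :=
    mul_le_mul_of_nonneg_left (by linarith [(abs_le.mp hS5).2]) (by positivity)
  -- 504 = 72 + 432 collects the mixed products of `t2` and `t3`; the term 2ν(ηq)² spent here is the
  -- one that `t1` provides.
  have young : 504 * M * ((η * q) * (s * p)) ≤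
      2 * ν * (η * q) ^ 2 + (504 * M) ^ 2 / (8 * ν) * (s * p) ^ 2 := by
    have h1 : 2 * ν * (η * q) ^ 2 + (504 * M) ^ 2 / (8 * ν) * (s * p) ^ 2
        - 504 * M * ((η * q) * (s * p)) =
        2 * ν * (η * q - 504 * M / (4 * ν) * (s * p)) ^ 2 := by
      field_simp; ring
    have h2 : 0 ≤ 2 * ν * (η * q - 504 * M / (4 * ν) * (s * p)) ^ 2 := by positivity
    linarith
  -- The (sp)² terms total 126 = 18 + 108 times M, plus the Young term. Lν exceeds their coefficient
  -- by 1, so one of the two copies of s²Lνp² absorbs them and the other one stays.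
  have hfin : s ^ 2 * L * (ν * p ^ 2 - 6 * M * N * p) ≤ 0 := by
    have h1 : (s * p) ^ 2 * (L * ν) =
        (s * p) ^ 2 * ((504 * M) ^ 2 / (8 * ν) + 126 * M + 1) := by rw [hLν]
    linarith [sq_nonneg (s * p)]
  have hfin2 : ν * p ^ 2 - 6 * M * N * p ≤ 0 := by
    by_contra! h
    have : 0 < s ^ 2 * L * (ν * p ^ 2 - 6 * M * N * p) := by positivity
    linarith
  by_cases hp0 : p = 0
  · rw [hp0]; simp; positivity
  · have hp1 : 0 < p := lt_of_le_of_ne hp (Ne.symm hp0)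
    have : p * (ν * p - 6 * M * N) ≤ 0 := by linarith
    linarith [nonpos_of_mul_nonpos_right this hp1]

/-! ### Bernstein's auxiliary function and its Hessian -/

theorem partialD_partialD_sum {ι : Type*} (s : Finset ι) {f : ι → R3 → ℝ} {x : R3}
    (hf : ∀ k ∈ s, ContDiffAt ℝ ∞ (f k) x) (i j : Fin 3) :
    partialD i (partialD j (fun y => ∑ k ∈ s, f k y)) x =
      ∑ k ∈ s, partialD i (partialD j (f k)) x := by
  have h : partialD j (fun y => ∑ k ∈ s, f k y) =ᶠ[𝓝 x]
      fun y => ∑ k ∈ s, partialD j (f k) y := by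
    have h1 : ∀ᶠ y in 𝓝 x, ∀ k ∈ s, DifferentiableAt ℝ (f k) y :=
      (Filter.eventually_all_finset s).mpr fun k hk => eventually_differentiableAt (hf k hk)
    filter_upwards [h1] with y hy using partialD_sum s hy j
  rw [partialD_congr h, partialD_sum s
    fun k hk => ContDiffAt.smoothDifferentiableAt (contDiffAt_partialD (hf k hk) j)]

/-- The cut-off function `s² - |x - x₀|²`. -/
def bumpPoly (x₀ : R3) (s : ℝ) (y : R3) : ℝ := s ^ 2 - ∑ k, (y k - x₀ k) * (y k - x₀ k)

theorem bumpPoly_eq (x₀ : R3) (s : ℝ) (y : R3) : bumpPoly x₀ s y = s ^ 2 - dist y x₀ ^ 2 := by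
  rw [bumpPoly, EuclideanSpace.dist_eq, Real.sq_sqrt (Finset.sum_nonneg fun _ _ => sq_nonneg _)]
  simp only [Real.dist_eq, sq_abs]
  simp only [sq]

theorem contDiff_coordinate_sub (x₀ : R3) (k : Fin 3) :
    ContDiff ℝ ∞ (fun y : R3 => y k - x₀ k) := (contDiff_coordinate k).sub contDiff_const

theorem contDiff_bumpPoly (x₀ : R3) (s : ℝ) : ContDiff ℝ ∞ (bumpPoly x₀ s) :=
  contDiff_const.sub (ContDiff.sum fun k _ =>
    (contDiff_coordinate_sub x₀ k).mul (contDiff_coordinate_sub x₀ k))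

theorem partialD_bumpPoly (x₀ : R3) (s : ℝ) (i : Fin 3) :
    partialD i (bumpPoly x₀ s) = fun y => -2 * (y i - x₀ i) := by
  funext y
  have hd : ∀ k, DifferentiableAt ℝ (fun y : R3 => y k - x₀ k) y := fun k =>
    (contDiff_coordinate_sub x₀ k).contDiffAt.differentiableAt (by simp)
  have h1 : ∀ k, partialD i (fun y : R3 => y k - x₀ k) y = if k = i then 1 else 0 := fun k => by
    rw [partialD_sub ((contDiff_coordinate k).contDiffAt.differentiableAt (by simp))
      (differentiableAt_const _), partialD_coordinate, partialD_const, sub_zero]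
  have h2 := partialD_sub (i := i) (x := y) (f := fun _ => s ^ 2)
    (g := fun y => ∑ k, (y k - x₀ k) * (y k - x₀ k)) (differentiableAt_const _)
    (DifferentiableAt.fun_sum fun k _ => (hd k).fun_mul (hd k))
  rw [partialD_const, partialD_sum _ fun k _ => (hd k).fun_mul (hd k)] at h2
  simp only [partialD_mul (hd _) (hd _), h1] at h2
  refine Eq.trans h2 ?_
  simp only [mul_ite, mul_one, mul_zero, Finset.sum_add_distrib, Finset.sum_ite_eq',
    Finset.mem_univ, if_true]
  ring

theorem partialD_partialD_bumpPoly (x₀ : R3) (s : ℝ) (i j : Fin 3) (y : R3) :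
    partialD i (partialD j (bumpPoly x₀ s)) y = if i = j then -2 else 0 := by
  have hd : DifferentiableAt ℝ (fun y : R3 => y j - x₀ j) y :=
    (contDiff_coordinate_sub x₀ j).contDiffAt.differentiableAt (by simp)
  rw [partialD_bumpPoly, partialD_const_mul _ hd,
    partialD_sub ((contDiff_coordinate j).contDiffAt.differentiableAt (by simp))
      (differentiableAt_const _), partialD_coordinate, partialD_const, sub_zero]
  simp [eq_comm]

/-- Bernstein's auxiliary function `η² |∇u|² + κ u²`. -/
def bernsteinFun (x₀ : R3) (s κ : ℝ) (u : R3 → ℝ) (y : R3) : ℝ :=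
  bumpPoly x₀ s y * bumpPoly x₀ s y * (∑ k, partialD k u y * partialD k u y)
    + κ * (u y * u y)

theorem contDiffAt_bernsteinFun (x₀ : R3) (s κ : ℝ) {u : R3 → ℝ} {x : R3}
    (hu : ContDiffAt ℝ ∞ u x) : ContDiffAt ℝ ∞ (bernsteinFun x₀ s κ u) x :=
  (((contDiff_bumpPoly x₀ s).contDiffAt.mul (contDiff_bumpPoly x₀ s).contDiffAt).mul
    (ContDiffAt.sum fun k _ => (contDiffAt_partialD hu k).mul (contDiffAt_partialD hu k))).add
    (contDiffAt_const.mul (hu.mul hu))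

/-- Third derivatives are ordered with ∂ₖ outermost, so that contraction with the coefficients gives
the quantity controlled by the equation differentiated along ∂ₖ. -/
theorem hessian_bernsteinFun (x₀ : R3) (s κ : ℝ) {u : R3 → ℝ} {x : R3}
    (hu : ContDiffAt ℝ ∞ u x) (i j : Fin 3) :
    partialD i (partialD j (bernsteinFun x₀ s κ u)) x =
      bumpPoly x₀ s x ^ 2 * (∑ k, (2 * partialD i (partialD k u) x * partialD j (partialD k u) x
          + 2 * partialD k u x * partialD k (partialD i (partialD j u)) x))
        + 2 * bumpPoly x₀ s x * partialD i (bumpPoly x₀ s) x *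
          (∑ k, 2 * partialD k u x * partialD j (partialD k u) x)
        + 2 * bumpPoly x₀ s x * partialD j (bumpPoly x₀ s) x *
          (∑ k, 2 * partialD k u x * partialD i (partialD k u) x)
        + (∑ k, partialD k u x ^ 2) * (2 * partialD i (bumpPoly x₀ s) x *
            partialD j (bumpPoly x₀ s) x + 2 * bumpPoly x₀ s x * (if i = j then -2 else 0))
        + κ * (2 * u x * partialD i (partialD j u) x + 2 * partialD i u x * partialD j u x) := by
  have hη := (contDiff_bumpPoly x₀ s).contDiffAt (x := x)
  have hq := contDiffAt_partialD hu
  have hS : ContDiffAt ℝ ∞ (fun y => ∑ k, partialD k u y * partialD k u y) x :=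
    ContDiffAt.sum fun k _ => (hq k).mul (hq k)
  have hd : DifferentiableAt ℝ (bumpPoly x₀ s) x := ContDiffAt.smoothDifferentiableAt hη
  have hqd : ∀ k, DifferentiableAt ℝ (partialD k u) x :=
    fun k => ContDiffAt.smoothDifferentiableAt (hq k)
  have hthird : ∀ k, partialD i (partialD j (partialD k u)) x =
      partialD k (partialD i (partialD j u)) x := fun k => by
    have h1 : partialD j (partialD k u) =ᶠ[𝓝 x] partialD k (partialD j u) := by
      filter_upwards [(hu.of_le ENat.LEInfty.out).eventually (n := 2) (by simp)] with y hy using partialD_comm hy j k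
    rw [partialD_congr h1, partialD_comm ((hq j).of_le ENat.LEInfty.out)]
  have hconst : partialD i (partialD j fun y => κ * (u y * u y)) x =
      κ * partialD i (partialD j fun y => u y * u y) x := by
    have h0 : partialD j (fun _ : R3 => κ) = fun _ => 0 := by
      funext y; exact partialD_const κ j y
    rw [partialD_partialD_mul contDiffAt_const (hu.mul hu), h0, partialD_const, partialD_const]
    ring
  have e1 := partialD_partialD_add (f := fun y => bumpPoly x₀ s y * bumpPoly x₀ s y *
    (∑ k, partialD k u y * partialD k u y)) (g := fun y => κ * (u y * u y))
    ((hη.mul hη).mul hS) (contDiffAt_const.mul (hu.mul hu)) i j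
  rw [partialD_partialD_mul (f := fun y => bumpPoly x₀ s y * bumpPoly x₀ s y) (hη.mul hη) hS,
    hconst, partialD_partialD_mul hu hu, partialD_partialD_mul hη hη,
    partialD_mul hd hd, partialD_mul hd hd,
    partialD_sum _ fun k _ => (hqd k).fun_mul (hqd k),
    partialD_sum _ fun k _ => (hqd k).fun_mul (hqd k),
    partialD_partialD_sum _ fun k _ => (hq k).mul (hq k)] at e1
  simp only [partialD_mul (hqd _) (hqd _), partialD_partialD_mul (hq _) (hq _), hthird,
    partialD_partialD_bumpPoly] at e1
  refine Eq.trans e1 ?_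
  simp only [Fin.sum_univ_three]
  ring

/-- Bernstein's interior gradient estimate for a second order elliptic equation. -/
theorem gradient_estimate {ν M N s : ℝ} (hν : 0 < ν) (hM : 0 ≤ M) (hs : 0 < s) (hs1 : s ≤ 1)
    {x₀ : R3} {u : R3 → ℝ} {a : R3 → Fin 3 → Fin 3 → ℝ} {b : R3 → Fin 3 → ℝ}
    (hu : ∀ x ∈ Metric.closedBall x₀ s, ContDiffAt ℝ ∞ u x)
    (hN : ∀ x ∈ Metric.closedBall x₀ s, |u x| ≤ N)
    (ha : ∀ x ∈ Metric.closedBall x₀ s, ∀ i j, DifferentiableAt ℝ (fun y => a y i j) x)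
    (hb : ∀ x ∈ Metric.closedBall x₀ s, ∀ i, DifferentiableAt ℝ (fun y => b y i) x)
    (haM : ∀ x ∈ Metric.closedBall x₀ s, ∀ i j, |a x i j| ≤ M)
    (hbM : ∀ x ∈ Metric.closedBall x₀ s, ∀ i, |b x i| ≤ M)
    (hdaM : ∀ x ∈ Metric.closedBall x₀ s, ∀ k i j, |partialD k (fun y => a y i j) x| ≤ M)
    (hdbM : ∀ x ∈ Metric.closedBall x₀ s, ∀ k i, |partialD k (fun y => b y i) x| ≤ M)
    (hsymm : ∀ x ∈ Metric.closedBall x₀ s, ∀ i j, a x i j = a x j i)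
    (hell : ∀ x ∈ Metric.closedBall x₀ s, ∀ v : Fin 3 → ℝ,
      ν * ∑ i, v i ^ 2 ≤ ∑ i, ∑ j, a x i j * v i * v j)
    (heq : ∀ x ∈ Metric.ball x₀ s, ∑ i, ∑ j, a x i j * partialD i (partialD j u) x
      + ∑ j, b x j * partialD j u x = 0) :
    s ^ 2 * ∑ k, partialD k u x₀ ^ 2 ≤ ((6 * M / ν) ^ 2 + bernsteinConst ν M) * N ^ 2 := by
  set L := bernsteinConst ν M with hL
  have hLpos : 0 < L := by rw [hL, bernsteinConst]; positivity
  set W := bernsteinFun x₀ s (s ^ 2 * L) u with hW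
  have hx₀ : x₀ ∈ Metric.closedBall x₀ s := Metric.mem_closedBall_self hs.le
  have hN0 : 0 ≤ N := (abs_nonneg _).trans (hN x₀ hx₀)
  -- A maximum of W over the closed ball: on the sphere the cut-off vanishes and only s²L u²
  -- survives; in the interior the second derivative test bounds the gradient at the maximum.
  obtain ⟨x, hx, hxmax⟩ := (isCompact_closedBall x₀ s).exists_isMaxOn ⟨x₀, hx₀⟩
    (fun y hy => (contDiffAt_bernsteinFun x₀ s (s ^ 2 * L)
      (hu y hy)).continuousAt.continuousWithinAt)
  have hWx : ∀ y, W y = bumpPoly x₀ s y ^ 2 * (∑ k, partialD k u y ^ 2)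
      + s ^ 2 * L * u y ^ 2 := fun y => by
    simp only [hW, bernsteinFun, Fin.sum_univ_three]; ring
  have hux : s ^ 2 * L * u x ^ 2 ≤ s ^ 2 * L * N ^ 2 := by
    have : u x ^ 2 ≤ N ^ 2 := sq_le_sq' (abs_le.mp (hN x hx)).1 (abs_le.mp (hN x hx)).2
    gcongr
  have hdist : 0 ≤ s ^ 2 - dist x x₀ ^ 2 := by
    have h1 : dist x x₀ ≤ s := hx
    have : dist x x₀ ^ 2 ≤ s ^ 2 := by gcongr
    linarith
  have hmain : W x ≤ s ^ 2 * (((6 * M / ν) ^ 2 + L) * N ^ 2) := by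
    rcases (show dist x x₀ ≤ s from hx).lt_or_eq with hlt | heq'
    · have hloc : IsLocalMax W x := by
        filter_upwards [Metric.isOpen_ball.mem_nhds (Metric.mem_ball.mpr hlt)] with y hy
        exact hxmax (Metric.ball_subset_closedBall hy)
      have hball : Metric.ball x₀ s ∈ 𝓝 x := Metric.isOpen_ball.mem_nhds hlt
      have hsmooth := hu x hx
      have hpsd : (Matrix.of (a x)).PosSemidef := by
        refine Matrix.PosSemidef.of_dotProduct_mulVec_nonneg ?_ fun v => ?_
        · ext i j; simp [hsymm x hx i j]
        · have h1 := hell x hx v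
          have h2 : 0 ≤ ν * ∑ i, v i ^ 2 := by positivity
          have h3 : star v ⬝ᵥ (Matrix.of (a x)).mulVec v = ∑ i, ∑ j, a x i j * v i * v j := by
            simp only [dotProduct, Matrix.mulVec, Matrix.of_apply, Fin.sum_univ_three,
              Pi.star_apply, star_trivial]
            ring
          rw [h3]; linarith
      have htest := sum_hessian_nonpos_of_isLocalMax
        (contDiffAt_bernsteinFun x₀ s (s ^ 2 * L) hsmooth) hloc hpsd
      simp only [hessian_bernsteinFun _ _ _ hsmooth, Matrix.of_apply] at htest
      have hqd : ∀ k, DifferentiableAt ℝ (partialD k u) x :=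
        fun k => ContDiffAt.smoothDifferentiableAt (contDiffAt_partialD hsmooth k)
      have hqqd : ∀ i j, DifferentiableAt ℝ (partialD i (partialD j u)) x := fun i j =>
        ContDiffAt.smoothDifferentiableAt (contDiffAt_partialD (contDiffAt_partialD hsmooth j) i)
      have hdiff : ∀ k, ∑ i, ∑ j, (partialD k (fun y => a y i j) x * partialD i (partialD j u) x
          + a x i j * partialD k (partialD i (partialD j u)) x)
          + ∑ j, (partialD k (fun y => b y j) x * partialD j u x
            + b x j * partialD k (partialD j u) x) = 0 := fun k => by
        have hzero : (fun y => ∑ i, ∑ j, a y i j * partialD i (partialD j u) y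
            + ∑ j, b y j * partialD j u y) =ᶠ[𝓝 x] fun _ => 0 := by
          filter_upwards [hball] with y hy using heq y hy
        have h1 := partialD_congr hzero k
        have d1 : ∀ i j, DifferentiableAt ℝ (fun y => a y i j * partialD i (partialD j u) y) x :=
          fun i j => (ha x hx i j).fun_mul (hqqd i j)
        have d2 : ∀ j, DifferentiableAt ℝ (fun y => b y j * partialD j u y) x :=
          fun j => (hb x hx j).fun_mul (hqd j)
        rw [partialD_const, partialD_add
          (DifferentiableAt.fun_sum fun i _ => DifferentiableAt.fun_sum fun j _ => d1 i j)
          (DifferentiableAt.fun_sum fun j _ => d2 j),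
          partialD_sum _ fun i _ => DifferentiableAt.fun_sum fun j _ => d1 i j,
          partialD_sum _ fun j _ => d2 j] at h1
        simp only [partialD_sum _ fun j _ => d1 _ j, partialD_mul (ha x hx _ _) (hqqd _ _),
          partialD_mul (hb x hx _) (hqd _)] at h1
        rw [← h1]
        congr 1
        · refine Finset.sum_congr rfl fun i _ => Finset.sum_congr rfl fun j _ => ?_
          ring
        · refine Finset.sum_congr rfl fun j _ => ?_
          ring
      have hgrad : ν * √(∑ k, partialD k u x ^ 2) ≤ 6 * M * N :=
        bernstein_inequality (η := bumpPoly x₀ s x) (a := a x) (b := b x)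
          (da := fun k i j => partialD k (fun y => a y i j) x)
          (db := fun k j => partialD k (fun y => b y j) x)
          (e := fun i => partialD i (bumpPoly x₀ s) x) (P := fun k => partialD k u x)
          (Q := fun i j => partialD i (partialD j u) x)
          (T := fun k i j => partialD k (partialD i (partialD j u)) x)
          (q := √(∑ k, ∑ i, partialD i (partialD k u) x ^ 2))
          hν hM (hN x hx) hs hs1 (by rw [bumpPoly_eq]; exact hdist)
          (by rw [bumpPoly_eq]; linarith [sq_nonneg (dist x x₀)])
          (haM x hx) (hbM x hx) (hdaM x hx) (hdbM x hx) (hell x hx)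
          (fun i => by
            have h1 : |(x - x₀) i| ≤ ‖x - x₀‖ := PiLp.norm_apply_le (x - x₀) i
            rw [← dist_eq_norm] at h1
            have h2 : |x i - x₀ i| ≤ s := h1.trans hlt.le
            simp only [partialD_bumpPoly, abs_mul, abs_neg, abs_two]
            linarith)
          (Real.sqrt_nonneg _)
          (Real.sq_sqrt (Finset.sum_nonneg fun _ _ => sq_nonneg _))
          (Real.sqrt_nonneg _)
          (Real.sq_sqrt (Finset.sum_nonneg fun _ _ => Finset.sum_nonneg fun _ _ => sq_nonneg _))
          (heq x hlt) hdiff htest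
      have hgrad2 : ∑ k, partialD k u x ^ 2 ≤ (6 * M * N / ν) ^ 2 := by
        rw [← Real.sq_sqrt (Finset.sum_nonneg fun k _ => sq_nonneg (partialD k u x))]
        have : √(∑ k, partialD k u x ^ 2) ≤ 6 * M * N / ν := by
          rw [le_div_iff₀ hν]; linarith
        gcongr
      -- This uses s ≤ 1: the cut-off is at most s² ≤ s.
      have hb4 : bumpPoly x₀ s x ^ 2 ≤ s ^ 2 := by
        rw [bumpPoly_eq]
        refine pow_le_pow_left₀ hdist ?_ 2
        nlinarith [sq_nonneg (dist x x₀)]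
      have h5 : bumpPoly x₀ s x ^ 2 * (∑ k, partialD k u x ^ 2) ≤
          s ^ 2 * (6 * M * N / ν) ^ 2 := by gcongr
      rw [hWx]
      calc _ ≤ s ^ 2 * (6 * M * N / ν) ^ 2 + s ^ 2 * L * N ^ 2 := add_le_add h5 hux
        _ = _ := by ring
    · rw [hWx, bumpPoly_eq, heq', sub_self]
      have : 0 ≤ s ^ 2 * ((6 * M / ν) ^ 2 * N ^ 2) := by positivity
      nlinarith
  -- At the centre the cut-off equals s². The bound for W carries a factor s², which cancels against
  -- half of this s⁴.
  have h0 : s ^ 4 * ∑ k, partialD k u x₀ ^ 2 ≤ W x₀ := by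
    rw [hWx, bumpPoly_eq, dist_self]
    have : 0 ≤ s ^ 2 * L * u x₀ ^ 2 := by positivity
    nlinarith
  have h1 : W x₀ ≤ W x := hxmax hx₀
  have h2 : s ^ 2 * (s ^ 2 * ∑ k, partialD k u x₀ ^ 2) ≤
      s ^ 2 * (((6 * M / ν) ^ 2 + L) * N ^ 2) := by
    calc _ = s ^ 4 * ∑ k, partialD k u x₀ ^ 2 := by ring
      _ ≤ _ := h0.trans (h1.trans hmain)
  exact le_of_mul_le_mul_left h2 (by positivity)

/-! ### Metrics close to the Euclidean metric -/

/-- The entries of `G` differ from those of the identity matrix by at most `t`. -/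
def NearId (G : Matrix (Fin 3) (Fin 3) ℝ) (t : ℝ) : Prop :=
  ∀ i j, |G i j - (1 : Matrix (Fin 3) (Fin 3) ℝ) i j| ≤ t

namespace NearId

variable {G H : Matrix (Fin 3) (Fin 3) ℝ} {t : ℝ}

theorem nonneg (h : NearId G t) : 0 ≤ t := (abs_nonneg _).trans (h 0 0)

/-- Expanding det(1 + E) - 1 gives 3 linear, 6 quadratic and 6 cubic terms, and 3t + 6t² + 6t³ ≤ 4t
for t ≤ 1/10. -/
theorem abs_det_sub_one_le (h : NearId G t) (ht : t ≤ 1 / 10) : |G.det - 1| ≤ 4 * t := by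
  have ht0 := h.nonneg
  obtain ⟨E, hE⟩ : ∃ E : Matrix (Fin 3) (Fin 3) ℝ, E = G - 1 := ⟨_, rfl⟩
  have hb : ∀ i j, |E i j| ≤ t := fun i j => by rw [hE]; exact h i j
  have hdet : G.det - 1 = E 0 0 + E 1 1 + E 2 2 + (E 0 0 * E 1 1 - E 0 1 * E 1 0)
      + (E 0 0 * E 2 2 - E 0 2 * E 2 0) + (E 1 1 * E 2 2 - E 1 2 * E 2 1)
      + (E 0 0 * (E 1 1 * E 2 2) - E 0 0 * (E 1 2 * E 2 1) - E 0 1 * (E 1 0 * E 2 2)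
        + E 0 1 * (E 1 2 * E 2 0) + E 0 2 * (E 1 0 * E 2 1) - E 0 2 * (E 1 1 * E 2 0)) := by
    have : G = 1 + E := by rw [hE]; abel
    rw [this, Matrix.det_fin_three]
    simp only [Matrix.add_apply, Matrix.one_apply]
    simp only [Fin.isValue, if_true, show (0 : Fin 3) ≠ 1 by decide, show (0 : Fin 3) ≠ 2 by decide,
      show (1 : Fin 3) ≠ 0 by decide, show (1 : Fin 3) ≠ 2 by decide,
      show (2 : Fin 3) ≠ 0 by decide, show (2 : Fin 3) ≠ 1 by decide, if_false]
    ring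
  have h2 : ∀ i j k l, |E i j * E k l| ≤ t * t := fun i j k l => abs_mul_le_mul (hb i j) (hb k l)
  have h3 : ∀ i j k l m n, |E i j * (E k l * E m n)| ≤ t * (t * t) :=
    fun i j k l m n => abs_mul_le_mul (hb i j) (h2 k l m n)
  have q2 : t * t ≤ 1 / 10 * t := by gcongr
  have q3 : t * (t * t) ≤ 1 / 100 * t := by nlinarith
  rw [hdet, abs_le]
  simp only [abs_le] at hb h2 h3
  constructor <;>
  linarith [hb 0 0, hb 1 1, hb 2 2, h2 0 0 1 1, h2 0 1 1 0, h2 0 0 2 2, h2 0 2 2 0, h2 1 1 2 2,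
    h2 1 2 2 1, h3 0 0 1 1 2 2, h3 0 0 1 2 2 1, h3 0 1 1 0 2 2, h3 0 1 1 2 2 0, h3 0 2 1 0 2 1,
    h3 0 2 1 1 2 0]

theorem det_bounds (h : NearId G t) (ht : t ≤ 1 / 10) : 1 / 2 ≤ G.det ∧ G.det ≤ 2 := by
  have := abs_le.mp (h.abs_det_sub_one_le ht)
  constructor <;> linarith [this.1, this.2]

theorem sqrt_det_bounds (h : NearId G t) (ht : t ≤ 1 / 10) :
    1 / 2 ≤ √G.det ∧ √G.det ≤ 2 := by
  obtain ⟨h1, h2⟩ := h.det_bounds ht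
  constructor
  · exact Real.le_sqrt_of_sq_le (by linarith)
  · rw [Real.sqrt_le_left (by norm_num)]; linarith

/-- With d = √det, |d - 1| ≤ |d - 1|(d + 1) = |det - 1|, and d⁻¹ ≤ 2. -/
theorem abs_inv_sqrt_det_sub_one_le (h : NearId G t) (ht : t ≤ 1 / 10) :
    |(√G.det)⁻¹ - 1| ≤ 8 * t := by
  obtain ⟨h1, h2⟩ := h.sqrt_det_bounds ht
  have h3 := h.abs_det_sub_one_le ht
  have hsq : √G.det ^ 2 = G.det := Real.sq_sqrt (by linarith [(h.det_bounds ht).1])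
  set d := √G.det
  have hd : (0 : ℝ) < d := by linarith
  have e1 : |d - 1| ≤ 4 * t := by
    have : |d - 1| * |d + 1| ≤ 4 * t := by
      have e : G.det - 1 = (d - 1) * (d + 1) := by rw [← hsq]; ring
      rwa [← abs_mul, ← e]
    rw [abs_of_pos (by linarith : 0 < d + 1)] at this
    nlinarith [abs_nonneg (d - 1)]
  have e2 : d⁻¹ - 1 = -(d - 1) * d⁻¹ := by field_simp; ring
  have e3 : d⁻¹ ≤ 2 := by
    rw [inv_le_comm₀ hd (by norm_num)]; linarith
  rw [e2, abs_mul, abs_neg, abs_of_pos (inv_pos.mpr hd)]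
  have := h.nonneg
  calc |d - 1| * d⁻¹ ≤ 4 * t * 2 := by gcongr
    _ = 8 * t := by ring

theorem abs_le_two (h : NearId G t) (ht : t ≤ 1 / 10) (i j : Fin 3) : |G i j| ≤ 2 := by
  have h1 : |(1 : Matrix (Fin 3) (Fin 3) ℝ) i j| ≤ 1 := by
    rw [Matrix.one_apply]; split_ifs <;> simp
  have := abs_sub_abs_le_abs_sub (G i j) ((1 : Matrix (Fin 3) (Fin 3) ℝ) i j)
  linarith [h i j]

theorem abs_inv_apply_le (h : NearId G t) (ht : t ≤ 1 / 10) (i j : Fin 3) :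
    |G⁻¹ i j| ≤ 16 := by
  have hb := h.abs_le_two ht
  obtain ⟨h1, h2⟩ := h.det_bounds ht
  have hq : ∀ i j k l, |G i j * G k l| ≤ 4 := fun i j k l =>
    (abs_mul_le_mul (hb i j) (hb k l)).trans (by norm_num)
  have hadj : |G.adjugate i j| ≤ 8 := by
    rw [Matrix.adjugate_fin_three]
    fin_cases i <;> fin_cases j <;> simp <;> rw [abs_le] <;> constructor <;>
    linarith [abs_le.mp (hq 1 1 2 2), abs_le.mp (hq 1 2 2 1), abs_le.mp (hq 0 1 2 2),
      abs_le.mp (hq 0 2 2 1), abs_le.mp (hq 0 1 1 2), abs_le.mp (hq 0 2 1 1),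
      abs_le.mp (hq 1 0 2 2), abs_le.mp (hq 1 2 2 0), abs_le.mp (hq 0 0 2 2),
      abs_le.mp (hq 0 2 2 0), abs_le.mp (hq 0 0 1 2), abs_le.mp (hq 0 2 1 0),
      abs_le.mp (hq 1 0 2 1), abs_le.mp (hq 1 1 2 0), abs_le.mp (hq 0 0 2 1),
      abs_le.mp (hq 0 1 2 0), abs_le.mp (hq 0 0 1 1), abs_le.mp (hq 0 1 1 0)]
  have hdet : |(G.det)⁻¹| ≤ 2 := by
    rw [abs_of_pos (inv_pos.mpr (by linarith)), inv_le_comm₀ (by linarith) (by norm_num)]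
    linarith
  rw [Matrix.inv_def, Ring.inverse_eq_inv', Matrix.smul_apply, smul_eq_mul]
  exact (abs_mul_le_mul hdet hadj).trans (by norm_num)

theorem abs_hodge_coeff_le (h : NearId G t) (ht : t ≤ 1 / 10) (k l : Fin 3) :
    |(√G.det)⁻¹ * G k l - (1 : Matrix (Fin 3) (Fin 3) ℝ) k l| ≤ 18 * t := by
  have h1 : |((√G.det)⁻¹ - 1) * G k l| ≤ 8 * t * 2 :=
    abs_mul_le_mul (h.abs_inv_sqrt_det_sub_one_le ht) (h.abs_le_two ht k l)
  have h2 := h k l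
  have e : (√G.det)⁻¹ * G k l - (1 : Matrix (Fin 3) (Fin 3) ℝ) k l =
    ((√G.det)⁻¹ - 1) * G k l + (G k l - (1 : Matrix (Fin 3) (Fin 3) ℝ) k l) := by ring
  rw [e]
  have := h.nonneg
  exact (abs_add_le _ _).trans (by linarith)

/-- The source of all metric errors: the Hodge star depends on the metric in a Lipschitz way near
the identity. The constant is 54 = 3 · 18. -/
theorem norm_hodgeStar_sub_le (h : NearId G t) (ht : t ≤ 1 / 10) {F : Fin 3 → Fin 3 → Su2}
    {B : ℝ} (hF : ∀ l, ‖F (l + 1) (l + 2)‖ ≤ B) (k : Fin 3) :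
    ‖hodgeStar G F k - hodgeStar 1 F k‖ ≤ 54 * t * B := by
  have e : hodgeStar G F k - hodgeStar 1 F k =
      ∑ l, ((√G.det)⁻¹ * G k l - (1 : Matrix (Fin 3) (Fin 3) ℝ) k l) • F (l + 1) (l + 2) := by
    simp only [hodgeStar, Matrix.det_one, Real.sqrt_one, inv_one, one_mul, Finset.smul_sum,
      ← Finset.sum_sub_distrib, sub_smul, smul_smul]
  rw [e]
  have ht0 := h.nonneg
  refine (norm_sum_le _ _).trans ((Finset.sum_le_sum (g := fun _ => 18 * t * B)
    fun l _ => ?_).trans ?_)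
  · rw [norm_smul, Real.norm_eq_abs]
    exact mul_le_mul (h.abs_hodge_coeff_le ht k l) (hF _) (norm_nonneg _) (by linarith)
  · simp; linarith

theorem norm_hodgeStar_le (h : NearId G t) (ht : t ≤ 1 / 10) {F : Fin 3 → Fin 3 → Su2}
    {B : ℝ} (hF : ∀ l, ‖F (l + 1) (l + 2)‖ ≤ B) (k : Fin 3) :
    ‖hodgeStar G F k‖ ≤ 12 * B := by
  obtain ⟨h1, h2⟩ := h.sqrt_det_bounds ht
  have e3 : (√G.det)⁻¹ ≤ 2 := by
    rw [inv_le_comm₀ (by linarith) (by norm_num)]; linarith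
  have hB : 0 ≤ B := (norm_nonneg _).trans (hF 0)
  have e4 : ‖∑ l, G k l • F (l + 1) (l + 2)‖ ≤ 6 * B := by
    refine (norm_sum_le _ _).trans ((Finset.sum_le_sum (g := fun _ => 2 * B)
      fun l _ => ?_).trans ?_)
    · rw [norm_smul, Real.norm_eq_abs]
      exact mul_le_mul (h.abs_le_two ht k l) (hF _) (norm_nonneg _) (by norm_num)
    · simp; linarith
  rw [hodgeStar, norm_smul, Real.norm_eq_abs, abs_of_pos (inv_pos.mpr (by linarith))]
  calc _ ≤ 2 * (6 * B) := by gcongr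
    _ = _ := by ring

/-- Nine terms, each with an entry of the inverse metric of size at most 16: the sum is at most
(12B)². -/
theorem formNorm_le {h : R3 → Matrix (Fin 3) (Fin 3) ℝ} {x : R3} (hn : NearId (h x) t)
    (ht : t ≤ 1 / 10) {e : R3 → Fin 3 → Su2} {B : ℝ} (he : ∀ i, ‖e x i‖ ≤ B) :
    formNorm h e x ≤ 12 * B := by
  have hB : 0 ≤ B := (norm_nonneg _).trans (he 0)
  rw [formNorm, Real.sqrt_le_left (by positivity)]
  refine (le_abs_self _).trans ((abs_sum_three_le (B := 3 * (16 * (B * B))) fun i =>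
    abs_sum_three_le fun j => abs_mul_le_mul (hn.abs_inv_apply_le ht i j)
      ((abs_real_inner_le_norm _ _).trans ?_)).trans ?_)
  · exact mul_le_mul (he i) (he j) (norm_nonneg _) hB
  · nlinarith

/-- Cauchy–Schwarz, in the form (∑|vᵢ|)² ≤ 3 ∑ vᵢ². It serves both for ellipticity and for lengths
of curves. -/
theorem quadratic_bounds (h : NearId G t) (v : Fin 3 → ℝ) :
    |∑ i, ∑ j, G i j * v i * v j - ∑ i, v i ^ 2| ≤ 3 * t * ∑ i, v i ^ 2 := by
  have ht0 := h.nonneg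
  have e : ∑ i, ∑ j, G i j * v i * v j - ∑ i, v i ^ 2 =
      ∑ i, ∑ j, (G i j - (1 : Matrix (Fin 3) (Fin 3) ℝ) i j) * (v i * v j) := by
    have : ∑ i, v i ^ 2 = ∑ i, ∑ j, (1 : Matrix (Fin 3) (Fin 3) ℝ) i j * (v i * v j) := by
      simp [Matrix.one_apply, sq]
    rw [this]
    simp only [← Finset.sum_sub_distrib]
    refine Finset.sum_congr rfl fun i _ => Finset.sum_congr rfl fun j _ => ?_
    ring
  rw [e]
  calc _ ≤ ∑ i, ∑ j, |(G i j - (1 : Matrix (Fin 3) (Fin 3) ℝ) i j) * (v i * v j)| :=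
        (Finset.abs_sum_le_sum_abs _ _).trans
          (Finset.sum_le_sum fun i _ => Finset.abs_sum_le_sum_abs _ _)
    _ ≤ ∑ i, ∑ j, t * (|v i| * |v j|) := by
        refine Finset.sum_le_sum fun i _ => Finset.sum_le_sum fun j _ => ?_
        rw [abs_mul, abs_mul]
        exact mul_le_mul_of_nonneg_right (h i j) (by positivity)
    _ = t * (∑ i, |v i|) ^ 2 := by
        simp only [Fin.sum_univ_three]; ring
    _ ≤ t * (3 * ∑ i, |v i| ^ 2) := by
        gcongr
        have := sq_sum_le_card_mul_sum_sq (s := (Finset.univ : Finset (Fin 3))) (f := fun i => |v i|)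
        simpa using this
    _ = _ := by simp only [sq_abs]; ring

end NearId

/-- The Hodge star is inverted by `√det G G⁻¹`. -/
theorem eq_inv_hodgeStar {G : Matrix (Fin 3) (Fin 3) ℝ} (hG : 0 < G.det)
    (F : Fin 3 → Fin 3 → Su2) (l : Fin 3) :
    F (l + 1) (l + 2) = ∑ k, (√G.det * G⁻¹ l k) • hodgeStar G F k := by
  have hd : √G.det ≠ 0 := (Real.sqrt_pos.mpr hG).ne'
  have hinv : G⁻¹ * G = 1 := Matrix.nonsing_inv_mul G (isUnit_iff_ne_zero.mpr hG.ne')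
  have h1 : ∀ k, (√G.det * G⁻¹ l k) • hodgeStar G F k =
      ∑ m, (G⁻¹ l k * G k m) • F (m + 1) (m + 2) := fun k => by
    rw [hodgeStar, smul_smul, Finset.smul_sum]
    refine Finset.sum_congr rfl fun m _ => ?_
    rw [smul_smul]
    congr 1
    field_simp
  simp only [h1]
  rw [Finset.sum_comm]
  simp only [← Finset.sum_smul]
  have h2 : ∀ m, ∑ k, G⁻¹ l k * G k m = if l = m then 1 else 0 := fun m => by
    rw [← Matrix.mul_apply, hinv, Matrix.one_apply]
  simp [h2]

/-! ### Geodesic normal coordinates -/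

theorem sum_smul_single (v : R3) : ∑ i, v i • EuclideanSpace.single i (1 : ℝ) = v := by
  ext j
  fin_cases j <;> simp [Fin.sum_univ_three]

theorem fderiv_apply_eq_sum {V : Type*} [NormedAddCommGroup V] [NormedSpace ℝ V] (f : R3 → V)
    (x v : R3) : fderiv ℝ f x v = ∑ i, v i • partialD i f x := by
  conv_lhs => rw [← sum_smul_single v]
  simp only [Fin.sum_univ_three, map_add, map_smul, partialD]

/-- Near 0 the derivative of f is O(|y|), since it vanishes at 0 and is differentiable there; the
mean value inequality on the closed ball of radius |x| gives a second factor |x|. -/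
theorem exists_quadratic_bound {f : R3 → ℝ} (hf : ContDiffAt ℝ ∞ f 0)
    (h0 : ∀ i, partialD i f 0 = 0) :
    ∃ C, ∀ᶠ x in 𝓝 (0 : R3), |f x - f 0| ≤ C * ‖x‖ ^ 2 := by
  have hz : fderiv ℝ f 0 = 0 := by
    ext v; rw [fderiv_apply_eq_sum]; simp [h0]
  have hd : DifferentiableAt ℝ (fderiv ℝ f) 0 :=
    ContDiffAt.differentiableAt (hf.fderiv_right (m := ∞) (by simp)) (by simp)
  obtain ⟨C, hC⟩ := hd.isBigO_sub.bound
  obtain ⟨r, hr, hball⟩ := Metric.eventually_nhds_iff_ball.mp (hC.and (eventually_differentiableAt hf))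
  refine ⟨C, Metric.eventually_nhds_iff_ball.mpr ⟨r, hr, fun x hx => ?_⟩⟩
  have hsub : Metric.closedBall (0 : R3) ‖x‖ ⊆ Metric.ball 0 r :=
    Metric.closedBall_subset_ball (by simpa using hx)
  have hC0 : ∀ y ∈ Metric.closedBall (0 : R3) ‖x‖, ‖fderiv ℝ f y‖ ≤ |C| * ‖x‖ := fun y hy => by
    have := (hball y (hsub hy)).1
    simp only [hz, sub_zero] at this
    refine this.trans (mul_le_mul (le_abs_self C) (by simpa using hy) (norm_nonneg _)
      (abs_nonneg _))
  by_cases hC' : 0 ≤ C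
  · have := (convex_closedBall (0 : R3) ‖x‖).norm_image_sub_le_of_norm_fderiv_le
      (fun y hy => (hball y (hsub hy)).2) hC0 (Metric.mem_closedBall_self (norm_nonneg x))
      (show x ∈ Metric.closedBall 0 ‖x‖ by simp)
    rw [abs_of_nonneg hC', sub_zero] at this
    calc _ ≤ C * ‖x‖ * ‖x‖ := this
      _ = _ := by ring
  -- A negative C is impossible unless x = 0, as it would bound a norm by a negative number.
  · by_cases hx0 : x = 0
    · simp [hx0]
    · have := (hball x hx).1
      simp only [sub_zero] at this
      have h2 : 0 < ‖x‖ := norm_pos_iff.mpr hx0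
      nlinarith [norm_nonneg (fderiv ℝ f x - fderiv ℝ f 0)]

/-- Polarisation, with test vectors eᵢ and eᵢ + eⱼ. -/
theorem eq_zero_of_quadratic_form_eq_zero {C : Fin 3 → Fin 3 → ℝ} (hC : ∀ i j, C i j = C j i)
    (h : ∀ v : R3, ∑ i, ∑ j, C i j * v i * v j = 0) (i j : Fin 3) : C i j = 0 := by
  have h0 := h !₂[1, 0, 0]
  have h1 := h !₂[0, 1, 0]
  have h2 := h !₂[0, 0, 1]
  have h01 := h !₂[1, 1, 0]
  have h02 := h !₂[1, 0, 1]
  have h12 := h !₂[0, 1, 1]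
  simp [Fin.sum_univ_three] at h0 h1 h2 h01 h02 h12
  have s01 := hC 0 1
  have s02 := hC 0 2
  have s12 := hC 1 2
  fin_cases i <;> fin_cases j <;> simp <;> linarith

section NormalCoordinates

variable {g : R3 → Matrix (Fin 3) (Fin 3) ℝ} {R : ℝ}

theorem IsMetricOn.contDiffAt {U : Set R3} (hg : IsMetricOn g U) (hU : IsOpen U) {x : R3}
    (hx : x ∈ U) (i j : Fin 3) : ContDiffAt ℝ ∞ (fun y => g y i j) x :=
  (hg.smooth i j).contDiffAt (hU.mem_nhds hx)

theorem IsMetricOn.symm {U : Set R3} (hg : IsMetricOn g U) {x : R3}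
    (hx : x ∈ U) (i j : Fin 3) : g x i j = g x j i := by
  have := (hg.posDef x hx).isHermitian.apply i j
  simpa using this.symm

/-- At time 0 the geodesic equation of the line through v reads Γᵏ(v, v) = 0. As v is arbitrary and
Γ symmetric, Γ vanishes at the origin, and Γ determines the first derivatives of g. -/
theorem partialD_metric_zero (hR : 0 < R) (hg : IsMetricOn g (Metric.ball 0 R))
    (hn : IsNormalCoord g R) (k i j : Fin 3) : partialD k (fun y => g y i j) 0 = 0 := by
  have h0 : (0 : R3) ∈ Metric.ball (0 : R3) R := Metric.mem_ball_self hR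
  have hsymm : ∀ k i j, partialD k (fun y => g y i j) 0 = partialD k (fun y => g y j i) 0 :=
    fun k i j => partialD_congr (by
      filter_upwards [Metric.isOpen_ball.mem_nhds h0] with y hy using hg.symm hy i j) k
  have hΓ : ∀ k i j, christoffel g 0 k i j = 1 / 2 * (partialD i (fun y => g y j k) 0
      + partialD j (fun y => g y i k) 0 - partialD k (fun y => g y i j) 0) := fun k i j => by
    simp [christoffel, hn.orthonormal, Matrix.one_apply]
  have hquad : ∀ k, ∀ v : R3, ∑ i, ∑ j, christoffel g 0 k i j * v i * v j = 0 := fun k v => by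
    have h1 := hn.radial v 0 (by simpa using hR) k
    have hd : ∀ a : Fin 3, deriv (fun s : ℝ => (s • v) a) = fun _ => v a := fun a => by
      funext t
      have : (fun s : ℝ => (s • v) a) = fun s => s * v a := by funext s; simp
      rw [this]; simp
    simpa [hd] using h1
  have hz : ∀ k i j, christoffel g 0 k i j = 0 := fun k =>
    eq_zero_of_quadratic_form_eq_zero (fun i j => by
      rw [hΓ, hΓ, hsymm k i j]; ring) (hquad k)
  -- Metric compatibility: ∂ₖgᵢⱼ = Γʲₖᵢ + Γⁱₖⱼ at the origin, where g is the identity.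
  have h1 := hz j k i
  have h2 := hz i k j
  rw [hΓ] at h1 h2
  have s1 := hsymm k i j
  have s2 := hsymm i k j
  have s3 := hsymm j k i
  linarith

/-- In geodesic normal coordinates the metric is Euclidean up to a quadratic error. -/
theorem exists_nearId (hR : 0 < R) (hg : IsMetricOn g (Metric.ball 0 R))
    (hn : IsNormalCoord g R) :
    ∃ C, 0 < C ∧ ∀ᶠ x in 𝓝 (0 : R3), NearId (g x) (C * ‖x‖ ^ 2) := by
  have h0 : (0 : R3) ∈ Metric.ball (0 : R3) R := Metric.mem_ball_self hR
  choose c hc using fun i j => exists_quadratic_bound (hg.contDiffAt Metric.isOpen_ball h0 i j)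
    fun k => partialD_metric_zero hR hg hn k i j
  refine ⟨∑ i, ∑ j, |c i j| + 1, by positivity, ?_⟩
  filter_upwards [Filter.eventually_all.mpr fun i => Filter.eventually_all.mpr (hc i)] with x hx
  intro i j
  rw [← hn.orthonormal]
  refine (hx i j).trans ?_
  have h1 : c i j ≤ ∑ i, ∑ j, |c i j| + 1 := by
    have h2 : |c i j| ≤ ∑ j, |c i j| :=
      Finset.single_le_sum (f := fun j => |c i j|) (fun _ _ => abs_nonneg _) (Finset.mem_univ j)
    have h3 : ∑ j, |c i j| ≤ ∑ i, ∑ j, |c i j| :=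
      Finset.single_le_sum (f := fun i => ∑ j, |c i j|)
        (fun _ _ => Finset.sum_nonneg fun _ _ => abs_nonneg _) (Finset.mem_univ i)
    linarith [le_abs_self (c i j)]
  gcongr

end NormalCoordinates

/-! ### The bracket and covariant derivatives -/

/-- The bracket is minus the cross product, so this is Lagrange's identity |u × v|² = |u|²|v|² -
(u·v)². -/
theorem norm_bracket_le (u v : Su2) : ‖bracket u v‖ ≤ ‖u‖ * ‖v‖ := by
  refine abs_le_of_sq_le_sq' ?_ (by positivity) |>.2
  rw [mul_pow]
  simp only [EuclideanSpace.norm_sq_eq, Fin.sum_univ_three, Real.norm_eq_abs, sq_abs]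
  simp only [bracket, PiLp.toLp_apply, Matrix.cons_val_zero, Matrix.cons_val_one, Matrix.cons_val]
  nlinarith [sq_nonneg (u 0 * v 0 + u 1 * v 1 + u 2 * v 2)]

theorem isBoundedBilinearMap_bracket :
    IsBoundedBilinearMap ℝ (fun p : Su2 × Su2 => bracket p.1 p.2) where
  add_left u v w := by ext a; fin_cases a <;> simp [bracket] <;> ring
  smul_left c u v := by ext a; fin_cases a <;> simp [bracket] <;> ring
  add_right u v w := by ext a; fin_cases a <;> simp [bracket] <;> ring
  smul_right c u v := by ext a; fin_cases a <;> simp [bracket] <;> ring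
  bound := ⟨1, one_pos, fun u v => by simpa using norm_bracket_le u v⟩

theorem bracket_smul_right (c : ℝ) (u v : Su2) : bracket u (c • v) = c • bracket u v :=
  isBoundedBilinearMap_bracket.smul_right c u v

theorem contDiffAt_bracket {f g : R3 → Su2} {x : R3} (hf : ContDiffAt ℝ ∞ f x)
    (hg : ContDiffAt ℝ ∞ g x) : ContDiffAt ℝ ∞ (fun y => bracket (f y) (g y)) x :=
  (isBoundedBilinearMap_bracket.contDiff (n := ∞)).contDiffAt.comp x (hf.prodMk hg)

theorem partialD_bracket {f g : R3 → Su2} {x : R3} (hf : DifferentiableAt ℝ f x)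
    (hg : DifferentiableAt ℝ g x) (i : Fin 3) :
    partialD i (fun y => bracket (f y) (g y)) x =
      bracket (partialD i f x) (g x) + bracket (f x) (partialD i g x) := by
  have h1 := (isBoundedBilinearMap_bracket.hasFDerivAt (f x, g x)).comp x
    (hf.hasFDerivAt.prodMk hg.hasFDerivAt)
  have h2 : HasFDerivAt (fun y => bracket (f y) (g y)) _ x := h1
  simp only [partialD, h2.fderiv]
  simp only [ContinuousLinearMap.comp_apply, ContinuousLinearMap.prod_apply,
    IsBoundedBilinearMap.deriv_apply]
  exact add_comm _ _

theorem covDeriv_smul {A : Conn} {f : R3 → ℝ} {Φ : Higgs} {x : R3} (hf : DifferentiableAt ℝ f x)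
    (hΦ : DifferentiableAt ℝ Φ x) (i : Fin 3) :
    covDeriv A (fun y => f y • Φ y) x i = partialD i f x • Φ x + f x • covDeriv A Φ x i := by
  rw [covDeriv, covDeriv, partialD_smul hf hΦ, bracket_smul_right, smul_add]
  abel

/-- The Bianchi identity. -/
theorem bianchi {A : Conn} {x : R3} (hA : ∀ i, ContDiffAt ℝ ∞ (fun y => A y i) x) :
    ∑ l, (partialD l (fun y => curvature A y (l + 1) (l + 2)) x
      + bracket (A x l) (curvature A x (l + 1) (l + 2))) = 0 := by
  have hd : ∀ i, DifferentiableAt ℝ (fun y => A y i) x :=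
    fun i => ContDiffAt.smoothDifferentiableAt (hA i)
  have hdd : ∀ i j, DifferentiableAt ℝ (partialD i (fun y => A y j)) x :=
    fun i j => ContDiffAt.smoothDifferentiableAt (contDiffAt_partialD (hA j) i)
  have hb : ∀ i j, DifferentiableAt ℝ (fun y => bracket (A y i) (A y j)) x :=
    fun i j => ContDiffAt.smoothDifferentiableAt (contDiffAt_bracket (hA i) (hA j))
  have hF : ∀ l i j, partialD l (fun y => curvature A y i j) x =
      partialD l (partialD i fun y => A y j) x - partialD l (partialD j fun y => A y i) x
      + (bracket (partialD l (fun y => A y i) x) (A x j)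
        + bracket (A x i) (partialD l (fun y => A y j) x)) := fun l i j => by
    simp only [curvature]
    rw [partialD_add ((hdd i j).fun_sub (hdd j i)) (hb i j), partialD_sub (hdd i j) (hdd j i),
      partialD_bracket (hd i) (hd j)]
  simp only [hF]
  simp only [curvature, Fin.sum_univ_three, show (0 : Fin 3) + 1 = 1 from rfl,
    show (0 : Fin 3) + 2 = 2 from rfl, show (1 : Fin 3) + 1 = 2 from rfl,
    show (1 : Fin 3) + 2 = 0 from rfl, show (2 : Fin 3) + 1 = 0 from rfl,
    show (2 : Fin 3) + 2 = 1 from rfl]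
  have hc : ∀ i j k, partialD i (partialD j fun y => A y k) x =
      partialD j (partialD i fun y => A y k) x :=
    fun i j k => partialD_comm ((hA k).of_le ENat.LEInfty.out) i j
  -- Second derivatives cancel in pairs by symmetry; what remains is antisymmetry and the Jacobi
  -- identity, checked in coordinates.
  rw [hc 1 0, hc 2 0, hc 2 1]
  ext a
  fin_cases a <;> simp [bracket] <;> ring

theorem contDiffAt_norm' {x : R3} (hx : x ≠ 0) : ContDiffAt ℝ ∞ (fun y : R3 => ‖y‖) x :=
  contDiffAt_norm ℝ hx

theorem contDiffAt_unitRadial {x : R3} (hx : x ≠ 0) : ContDiffAt ℝ ∞ unitRadial x :=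
  ((contDiffAt_norm' hx).inv (norm_ne_zero_iff.mpr hx)).smul contDiffAt_id

theorem norm_unitRadial {x : R3} (hx : x ≠ 0) : ‖unitRadial x‖ = 1 := by
  rw [unitRadial, norm_smul, norm_inv, norm_norm, inv_mul_cancel₀ (norm_ne_zero_iff.mpr hx)]

/-! ### Harmonicity of the Higgs field of a Dirac monopole -/

/-- The coefficients `√det g gⁱʲ` of the Laplace operator. -/
def laplaceCoeff (g : R3 → Matrix (Fin 3) (Fin 3) ℝ) (x : R3) (i j : Fin 3) : ℝ :=
  √(g x).det * (g x)⁻¹ i j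

theorem contDiffAt_laplaceCoeff {g : R3 → Matrix (Fin 3) (Fin 3) ℝ} {x : R3}
    (hg : ∀ i j, ContDiffAt ℝ ∞ (fun y => g y i j) x) (hdet : 0 < (g x).det) (i j : Fin 3) :
    ContDiffAt ℝ ∞ (fun y => laplaceCoeff g y i j) x := by
  have hd : ContDiffAt ℝ ∞ (fun y => (g y).det) x := by
    simp only [Matrix.det_fin_three]
    fun_prop
  have ha : ContDiffAt ℝ ∞ (fun y => (g y).adjugate i j) x := by
    simp only [Matrix.adjugate_fin_three]
    fin_cases i <;> fin_cases j <;> simp <;> fun_prop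
  have e : (fun y => laplaceCoeff g y i j) =
      fun y => √(g y).det * ((g y).det⁻¹ * (g y).adjugate i j) := by
    funext y
    rw [laplaceCoeff, Matrix.inv_def, Ring.inverse_eq_inv', Matrix.smul_apply, smul_eq_mul]
  rw [e]
  exact (hd.sqrt hdet.ne').mul ((hd.inv hdet.ne').mul ha)

section DiracMonopole

variable {g : R3 → Matrix (Fin 3) (Fin 3) ℝ} {R m : ℝ} {A : Conn} {φ : R3 → ℝ} {x : R3}

theorem isOpen_puncturedBall (R : ℝ) : IsOpen (Metric.ball (0 : R3) R \ {0}) :=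
  Metric.isOpen_ball.sdiff isClosed_singleton

theorem IsDiracMonopole.contDiffAt_conn (hD : IsDiracMonopole g R m A φ)
    (hx : x ∈ Metric.ball (0 : R3) R \ {0}) (i : Fin 3) :
    ContDiffAt ℝ ∞ (fun y => A y i) x :=
  (hD.smooth_conn i).contDiffAt ((isOpen_puncturedBall R).mem_nhds hx)

theorem IsDiracMonopole.contDiffAt_higgs (hD : IsDiracMonopole g R m A φ)
    (hx : x ∈ Metric.ball (0 : R3) R \ {0}) : ContDiffAt ℝ ∞ φ x :=
  hD.smooth_higgs.contDiffAt ((isOpen_puncturedBall R).mem_nhds hx)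

/-- Since n is parallel only the scalar factor is differentiated, so shifting the mass leaves the
covariant derivative, and with it the Bogomolny equation, unchanged. -/
theorem IsDiracMonopole.covDeriv_shift (hD : IsDiracMonopole g R m A φ)
    (hx : x ∈ Metric.ball (0 : R3) R \ {0}) (c : ℝ) (i : Fin 3) :
    covDeriv A (liftHiggs fun y => φ y + c) x i = (2 * partialD i φ x) • unitRadial x := by
  have hφ := ContDiffAt.smoothDifferentiableAt (hD.contDiffAt_higgs hx)
  have hn := ContDiffAt.smoothDifferentiableAt (contDiffAt_unitRadial (x := x) hx.2)
  have h1 : DifferentiableAt ℝ (fun y => φ y + c) x := hφ.fun_add (differentiableAt_const c)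
  have := covDeriv_smul (A := A) (h1.const_mul 2) hn i
  rw [hD.parallel x hx i, smul_zero, add_zero, partialD_const_mul _ h1,
    partialD_add hφ (differentiableAt_const c), partialD_const, add_zero] at this
  exact this

theorem IsDiracMonopole.hodgeStar_curvature (hD : IsDiracMonopole g R m A φ)
    (hx : x ∈ Metric.ball (0 : R3) R \ {0}) (k : Fin 3) :
    hodgeStar (g x) (curvature A x) k = (2 * partialD k φ x) • unitRadial x := by
  have h1 := hD.bogomolny x hx k
  rw [bogomolnyError, sub_eq_zero] at h1
  have h2 := hD.covDeriv_shift hx 0 k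
  simp only [add_zero] at h2
  rw [h1]
  exact h2

theorem IsDiracMonopole.curvature_eq (hg : IsMetricOn g (Metric.ball 0 R))
    (hD : IsDiracMonopole g R m A φ) (hx : x ∈ Metric.ball (0 : R3) R \ {0}) (l : Fin 3) :
    curvature A x (l + 1) (l + 2) =
      (∑ k, laplaceCoeff g x l k * (2 * partialD k φ x)) • unitRadial x := by
  rw [eq_inv_hodgeStar (hg.posDef x hx.1).det_pos (curvature A x) l, Finset.sum_smul]
  simp only [hD.hodgeStar_curvature hx, smul_smul]
  rfl

theorem IsMetricOn.contDiffAt_laplaceCoeff (hg : IsMetricOn g (Metric.ball 0 R))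
    (hx : x ∈ Metric.ball (0 : R3) R) (i j : Fin 3) :
    ContDiffAt ℝ ∞ (fun y => laplaceCoeff g y i j) x :=
  ApproxMonopole.contDiffAt_laplaceCoeff (hg.contDiffAt Metric.isOpen_ball hx)
    (hg.posDef x hx).det_pos i j

/-- The Higgs field of a Dirac monopole is harmonic. -/
theorem IsDiracMonopole.laplace_eq_zero (hg : IsMetricOn g (Metric.ball 0 R))
    (hD : IsDiracMonopole g R m A φ) (hx : x ∈ Metric.ball (0 : R3) R \ {0}) :
    ∑ i, ∑ j, laplaceCoeff g x i j * partialD i (partialD j φ) x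
      + ∑ j, (∑ i, partialD i (fun y => laplaceCoeff g y i j) x) * partialD j φ x = 0 := by
  have hA := hD.contDiffAt_conn hx
  have hφ := hD.contDiffAt_higgs hx
  have hn := ContDiffAt.smoothDifferentiableAt (contDiffAt_unitRadial (x := x) hx.2)
  have hdφ : ∀ k, DifferentiableAt ℝ (partialD k φ) x :=
    fun k => ContDiffAt.smoothDifferentiableAt (contDiffAt_partialD hφ k)
  have ha : ∀ l k, DifferentiableAt ℝ (fun y => laplaceCoeff g y l k) x := fun l k =>
    ContDiffAt.smoothDifferentiableAt (IsMetricOn.contDiffAt_laplaceCoeff hg hx.1 l k)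
  have hterm : ∀ l k, DifferentiableAt ℝ (fun y => laplaceCoeff g y l k * (2 * partialD k φ y)) x :=
    fun l k => (ha l k).fun_mul ((hdφ k).const_mul 2)
  have hY : ∀ l, DifferentiableAt ℝ
      (fun y => ∑ k, laplaceCoeff g y l k * (2 * partialD k φ y)) x :=
    fun l => DifferentiableAt.fun_sum fun k _ => hterm l k
  have hcurv : ∀ l, (fun y => curvature A y (l + 1) (l + 2)) =ᶠ[𝓝 x] fun y =>
      (∑ k, laplaceCoeff g y l k * (2 * partialD k φ y)) • unitRadial y := fun l => by
    filter_upwards [(isOpen_puncturedBall R).mem_nhds hx] with y hy using hD.curvature_eq hg hy l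
  -- The curvature is a scalar 2-form, a multiple of ∗dφ, times the parallel section n; so Bianchi
  -- becomes the scalar equation d∗dφ = 0, expanded below into non-divergence form.
  have hbi := bianchi hA
  have hl : ∀ l, partialD l (fun y => curvature A y (l + 1) (l + 2)) x
      + bracket (A x l) (curvature A x (l + 1) (l + 2)) =
      partialD l (fun y => ∑ k, laplaceCoeff g y l k * (2 * partialD k φ y)) x
        • unitRadial x := fun l => by
    have h1 := covDeriv_smul (A := A) (hY l) hn l
    rw [hD.parallel x hx l, smul_zero, add_zero] at h1
    rw [partialD_congr (hcurv l), hD.curvature_eq hg hx l]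
    exact h1
  simp only [hl, ← Finset.sum_smul] at hbi
  have hn0 : unitRadial x ≠ 0 := norm_ne_zero_iff.mp (by rw [norm_unitRadial hx.2]; simp)
  have h2 := (smul_eq_zero.mp hbi).resolve_right hn0
  simp only [partialD_sum _ fun k _ => hterm _ k, partialD_mul (ha _ _) ((hdφ _).const_mul 2),
    partialD_const_mul 2 (hdφ _)] at h2
  simp only [Fin.sum_univ_three] at h2 ⊢
  linarith

end DiracMonopole

/-! ### Growth of the curvature of a Dirac monopole at the singularity -/

theorem eventually_abs_le {f : R3 → ℝ} {x : R3} (hf : ContinuousAt f x) :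
    ∀ᶠ y in 𝓝 x, |f y| ≤ |f x| + 1 := by
  filter_upwards [hf.abs.eventually (gt_mem_nhds (lt_add_one |f x|))] with y hy using hy.le

/-- Finitely many functions that are continuous at a point have a common local bound. -/
theorem exists_eventually_abs_le {ι : Type*} [Finite ι] {f : ι → R3 → ℝ} {x : R3}
    (hf : ∀ k, ContinuousAt (f k) x) : ∃ M, 0 ≤ M ∧ ∀ᶠ y in 𝓝 x, ∀ k, |f k y| ≤ M := by
  cases nonempty_fintype ι
  refine ⟨∑ k, (|f k x| + 1), by positivity, ?_⟩
  filter_upwards [Filter.eventually_all.mpr fun k => eventually_abs_le (hf k)] with y hy k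
  exact (hy k).trans (Finset.single_le_sum (f := fun k => |f k x| + 1)
    (fun _ _ => by positivity) (Finset.mem_univ k))

section LaplaceCoefficients

variable {g : R3 → Matrix (Fin 3) (Fin 3) ℝ} {R : ℝ}

/-- Distance 1/10 from the identity makes the operator elliptic with constant 1 - 3/10 ≥ 1/2. -/
theorem eventually_nearId_laplaceCoeff (hR : 0 < R) (hg : IsMetricOn g (Metric.ball 0 R))
    (h0 : g 0 = 1) :
    ∀ᶠ x in 𝓝 (0 : R3), NearId (Matrix.of (laplaceCoeff g x)) (1 / 10) := by
  have hmem : (0 : R3) ∈ Metric.ball (0 : R3) R := Metric.mem_ball_self hR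
  refine Filter.eventually_all.mpr fun i => Filter.eventually_all.mpr fun j => ?_
  have hc := (IsMetricOn.contDiffAt_laplaceCoeff hg hmem i j).continuousAt
  have h1 : laplaceCoeff g 0 i j = (1 : Matrix (Fin 3) (Fin 3) ℝ) i j := by
    simp [laplaceCoeff, h0]
  have := Metric.continuousAt_iff'.mp hc (1 / 10) (by norm_num)
  filter_upwards [this] with x hx
  rw [Real.dist_eq, h1] at hx
  exact hx.le

/-- Uniform bounds near the origin for the coefficients of the Laplace equation. -/
theorem exists_laplace_bounds (hR : 0 < R) (hg : IsMetricOn g (Metric.ball 0 R)) :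
    ∃ M, 0 ≤ M ∧ ∀ᶠ x in 𝓝 (0 : R3),
      (∀ i j, |laplaceCoeff g x i j| ≤ M) ∧
      (∀ j, |∑ i, partialD i (fun y => laplaceCoeff g y i j) x| ≤ M) ∧
      (∀ k i j, |partialD k (fun y => laplaceCoeff g y i j) x| ≤ M) ∧
      (∀ k j, |partialD k
        (fun y => ∑ i, partialD i (fun z => laplaceCoeff g z i j) y) x| ≤ M) := by
  have hmem : (0 : R3) ∈ Metric.ball (0 : R3) R := Metric.mem_ball_self hR
  have ha := fun i j => IsMetricOn.contDiffAt_laplaceCoeff hg hmem i j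
  have hb : ∀ j, ContDiffAt ℝ ∞
      (fun y => ∑ i, partialD i (fun z => laplaceCoeff g z i j) y) 0 :=
    fun j => ContDiffAt.sum fun i _ => contDiffAt_partialD (ha i j) i
  obtain ⟨M1, hM1, h1⟩ := exists_eventually_abs_le
    (f := fun (k : Fin 3 × Fin 3) y => laplaceCoeff g y k.1 k.2)
    fun k => (ha k.1 k.2).continuousAt
  obtain ⟨M2, hM2, h2⟩ := exists_eventually_abs_le fun j => (hb j).continuousAt
  obtain ⟨M3, hM3, h3⟩ := exists_eventually_abs_le
    (f := fun (k : Fin 3 × Fin 3 × Fin 3) =>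
      partialD k.1 (fun y => laplaceCoeff g y k.2.1 k.2.2))
    fun k => (contDiffAt_partialD (ha k.2.1 k.2.2) k.1).continuousAt
  obtain ⟨M4, hM4, h4⟩ := exists_eventually_abs_le
    (f := fun (k : Fin 3 × Fin 3) =>
      partialD k.1 (fun y => ∑ i, partialD i (fun z => laplaceCoeff g z i k.2) y))
    fun k => (contDiffAt_partialD (hb k.2) k.1).continuousAt
  refine ⟨M1 + M2 + M3 + M4, by positivity, ?_⟩
  filter_upwards [h1, h2, h3, h4] with x h1 h2 h3 h4
  exact ⟨fun i j => (h1 (i, j)).trans (by linarith), fun j => (h2 j).trans (by linarith),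
    fun k i j => (h3 (k, i, j)).trans (by linarith), fun k j => (h4 (k, j)).trans (by linarith)⟩

end LaplaceCoefficients

section DiracMonopole

variable {g : R3 → Matrix (Fin 3) (Fin 3) ℝ} {R m : ℝ} {A : Conn} {φ : R3 → ℝ}

theorem IsDiracMonopole.exists_higgs_bound (hD : IsDiracMonopole g R m A φ) :
    ∃ C, 0 < C ∧ ∀ᶠ x in 𝓝[≠] (0 : R3), |φ x| ≤ C / ‖x‖ := by
  obtain ⟨c, hc⟩ := hD.singularity.bound
  refine ⟨1 / 2 + |m| + |c|, by positivity, ?_⟩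
  have h1 : ∀ᶠ x in 𝓝[≠] (0 : R3), ‖x‖ < 1 :=
    nhdsWithin_le_nhds (by
      filter_upwards [Metric.ball_mem_nhds (0 : R3) one_pos] with x hx
      simpa using hx)
  filter_upwards [hc, h1, self_mem_nhdsWithin] with x hx hx1 hx0
  have hpos : 0 < ‖x‖ := norm_pos_iff.mpr hx0
  rw [norm_norm, Real.norm_eq_abs] at hx
  rw [le_div_iff₀ hpos]
  have h2 : |φ x| ≤ 1 / (2 * ‖x‖) + |m| + |c| * ‖x‖ := by
    have e : φ x = (φ x - (-(1 / (2 * ‖x‖)) + m)) + (-(1 / (2 * ‖x‖)) + m) := by ring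
    rw [e]
    have h3 : |-(1 / (2 * ‖x‖)) + m| ≤ 1 / (2 * ‖x‖) + |m| := by
      refine (abs_add_le _ _).trans ?_
      rw [abs_neg, abs_of_pos (by positivity)]
    have h4 : c * ‖x‖ ≤ |c| * ‖x‖ := by gcongr; exact le_abs_self c
    exact (abs_add_le _ _).trans (by linarith)
  calc |φ x| * ‖x‖ ≤ (1 / (2 * ‖x‖) + |m| + |c| * ‖x‖) * ‖x‖ := by gcongr
    _ = 1 / 2 + |m| * ‖x‖ + |c| * (‖x‖ * ‖x‖) := by field_simp
    _ ≤ 1 / 2 + |m| * 1 + |c| * (1 * 1) := by gcongr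
    _ = _ := by ring

/-- The ball of radius |x|/2 about x stays at distance |x|/2 from the singularity, so |φ| ≤ 2C/|x|
on it, and the interior gradient estimate costs one more factor 1/|x|. -/
theorem IsDiracMonopole.exists_gradient_bound (hR : 0 < R)
    (hg : IsMetricOn g (Metric.ball 0 R)) (h0 : g 0 = 1) (hD : IsDiracMonopole g R m A φ) :
    ∃ C, 0 < C ∧ ∀ᶠ x in 𝓝[≠] (0 : R3), ∀ k, |partialD k φ x| ≤ C / ‖x‖ ^ 2 := by
  obtain ⟨C, hC, hφ⟩ := hD.exists_higgs_bound
  obtain ⟨M, hM, hbounds⟩ := exists_laplace_bounds hR hg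
  set B := (6 * M / (1 / 2)) ^ 2 + bernsteinConst (1 / 2) M with hB
  have hBpos : 0 < B := by rw [hB, bernsteinConst]; positivity
  -- This is √B · N/s with N = C/(|x|/2) and s = |x|/2.
  refine ⟨√B * (4 * C), by positivity, ?_⟩
  rw [eventually_nhdsWithin_iff] at hφ ⊢
  obtain ⟨r, hr, hball⟩ := Metric.eventually_nhds_iff_ball.mp
    (hφ.and (hbounds.and (eventually_nearId_laplaceCoeff hR hg h0)))
  -- The halves keep the ball of radius |x|/2 about x inside the balls of radius r and R; the 1
  -- ensures s ≤ 1.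
  have hrr : 0 < min (r / 2) (min (R / 2) 1) := by positivity
  filter_upwards [Metric.ball_mem_nhds (0 : R3) hrr] with x hx hx0 k
  have hpos : 0 < ‖x‖ := norm_pos_iff.mpr hx0
  have hx' : ‖x‖ < min (r / 2) (min (R / 2) 1) := by simpa using hx
  rw [lt_min_iff, lt_min_iff] at hx'
  have hy : ∀ y ∈ Metric.closedBall x (‖x‖ / 2), ‖x‖ / 2 ≤ ‖y‖ ∧ ‖y‖ < r ∧ ‖y‖ < R := by
    intro y hy
    have h1 : ‖y - x‖ ≤ ‖x‖ / 2 := by simpa [dist_eq_norm] using hy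
    have h2 : ‖x‖ - ‖y‖ ≤ ‖y - x‖ := by rw [norm_sub_rev]; exact norm_sub_norm_le x y
    have h3 : ‖y‖ - ‖x‖ ≤ ‖y - x‖ := norm_sub_norm_le y x
    refine ⟨by linarith, by linarith [hx'.1], by linarith [hx'.2.1]⟩
  have hne : ∀ y ∈ Metric.closedBall x (‖x‖ / 2), y ∈ Metric.ball (0 : R3) R \ {0} :=
    fun y h => ⟨by simpa using (hy y h).2.2, by
      have := (hy y h).1
      exact norm_pos_iff.mp (by linarith)⟩
  have hr' : ∀ y ∈ Metric.closedBall x (‖x‖ / 2), y ∈ Metric.ball (0 : R3) r :=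
    fun y h => by simpa using (hy y h).2.1
  have key := gradient_estimate (ν := 1 / 2) (M := M) (N := C / (‖x‖ / 2)) (s := ‖x‖ / 2)
    (x₀ := x) (u := φ) (a := laplaceCoeff g)
    (b := fun y j => ∑ i, partialD i (fun z => laplaceCoeff g z i j) y)
    (by norm_num) hM (by positivity) (by linarith [hx'.2.2])
    (fun y h => hD.contDiffAt_higgs (hne y h))
    (fun y h => ((hball y (hr' y h)).1 (hne y h).2).trans
      (div_le_div_of_nonneg_left hC.le (by positivity) (hy y h).1))
    (fun y h i j => ContDiffAt.smoothDifferentiableAt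
      (IsMetricOn.contDiffAt_laplaceCoeff hg (hne y h).1 i j))
    (fun y h j => DifferentiableAt.fun_sum fun i _ => ContDiffAt.smoothDifferentiableAt
      (contDiffAt_partialD (IsMetricOn.contDiffAt_laplaceCoeff hg (hne y h).1 i j) i))
    (fun y h => (hball y (hr' y h)).2.1.1) (fun y h => (hball y (hr' y h)).2.1.2.1)
    (fun y h => (hball y (hr' y h)).2.1.2.2.1) (fun y h => (hball y (hr' y h)).2.1.2.2.2)
    (fun y h i j => by
      have h1 := (hg.posDef y (hne y h).1).inv.isHermitian.apply i j
      simp only [star_trivial] at h1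
      rw [laplaceCoeff, laplaceCoeff, h1])
    (fun y h v => by
      have h1 := abs_le.mp ((hball y (hr' y h)).2.2.quadratic_bounds v)
      have h2 : 0 ≤ ∑ i, v i ^ 2 := Finset.sum_nonneg fun _ _ => sq_nonneg _
      simp only [Matrix.of_apply] at h1
      linarith [h1.1])
    (fun y h => hD.laplace_eq_zero hg (hne y (Metric.ball_subset_closedBall h)))
  have hk : partialD k φ x ^ 2 ≤ ∑ k, partialD k φ x ^ 2 :=
    Finset.single_le_sum (f := fun k => partialD k φ x ^ 2) (fun _ _ => sq_nonneg _)
      (Finset.mem_univ k)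
  refine abs_le_of_sq_le_sq ?_ (by positivity)
  have h2 : (‖x‖ / 2) ^ 2 * partialD k φ x ^ 2 ≤ B * (C / (‖x‖ / 2)) ^ 2 :=
    (mul_le_mul_of_nonneg_left hk (by positivity)).trans key
  rw [← le_div_iff₀' (by positivity)] at h2
  refine h2.trans (le_of_eq ?_)
  simp only [div_pow, mul_pow, Real.sq_sqrt hBpos.le]
  field_simp
  norm_num

theorem IsDiracMonopole.exists_curvature_bound (hR : 0 < R)
    (hg : IsMetricOn g (Metric.ball 0 R)) (h0 : g 0 = 1) (hD : IsDiracMonopole g R m A φ) :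
    ∃ C, 0 < C ∧ ∀ᶠ x in 𝓝[≠] (0 : R3), ∀ l, ‖curvature A x (l + 1) (l + 2)‖ ≤ C / ‖x‖ ^ 2 := by
  obtain ⟨C, hC, hgrad⟩ := hD.exists_gradient_bound hR hg h0
  obtain ⟨M, hM, hbounds⟩ := exists_laplace_bounds hR hg
  refine ⟨6 * M * C + 1, by positivity, ?_⟩
  filter_upwards [hgrad, nhdsWithin_le_nhds hbounds, self_mem_nhdsWithin,
    nhdsWithin_le_nhds (Metric.ball_mem_nhds (0 : R3) hR)] with x h1 h2 h3 h4 l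
  have hpos : 0 < ‖x‖ := norm_pos_iff.mpr h3
  rw [hD.curvature_eq hg ⟨h4, h3⟩ l, norm_smul, norm_unitRadial h3, mul_one, Real.norm_eq_abs]
  refine (abs_sum_three_le (B := M * (2 * (C / ‖x‖ ^ 2))) fun k =>
    abs_mul_le_mul (h2.1 l k) ?_).trans ?_
  · rw [abs_mul, abs_two]; gcongr; exact h1 k
  · rw [le_div_iff₀ (by positivity)]
    field_simp
    linarith

end DiracMonopole

/-! ### Spherically symmetric fields -/

/-- The `su(2)`-valued 1-form `(x × τ) · dx`. -/
def crossForm (x : R3) : Fin 3 → Su2 :=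
  ![!₂[0, -x 2, x 1], !₂[x 2, 0, -x 0], !₂[-x 1, x 0, 0]]

theorem hedgehogForm_eq (x : R3) : hedgehogForm x = crossForm (unitRadial x) := rfl

theorem crossForm_smul (c : ℝ) (x : R3) (i : Fin 3) :
    crossForm (c • x) i = c • crossForm x i := by
  ext a
  fin_cases i <;> fin_cases a <;> simp [crossForm]

theorem norm_crossForm_le (x : R3) (i : Fin 3) : ‖crossForm x i‖ ≤ ‖x‖ := by
  refine abs_le_of_sq_le_sq' ?_ (norm_nonneg x) |>.2
  simp only [EuclideanSpace.norm_sq_eq, Fin.sum_univ_three, Real.norm_eq_abs, sq_abs]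
  fin_cases i <;> simp [crossForm] <;> nlinarith [sq_nonneg (x 0), sq_nonneg (x 1), sq_nonneg (x 2)]

theorem contDiff_crossForm (i : Fin 3) : ContDiff ℝ ∞ fun x => crossForm x i := by
  have h := contDiff_coordinate
  rw [contDiff_euclidean]
  intro a
  fin_cases i <;> fin_cases a <;> simp [crossForm] <;>
    first | exact contDiff_const | exact h _ | exact (h _).neg

theorem partialD_crossForm (i j : Fin 3) (x : R3) :
    partialD j (fun y => crossForm y i) x = crossForm (EuclideanSpace.single j 1) i := by
  have hd : DifferentiableAt ℝ (fun y => crossForm y i) x :=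
    (contDiff_crossForm i).contDiffAt.differentiableAt (by simp)
  have hlin : IsLinearMap ℝ fun y => crossForm y i :=
    ⟨fun u v => by ext a; fin_cases i <;> fin_cases a <;> simp [crossForm] <;> ring,
      fun c u => crossForm_smul c u i⟩
  have : fderiv ℝ (fun y => crossForm y i) x = (hlin.mk' _).toContinuousLinearMap :=
    ((hlin.mk' _).toContinuousLinearMap).fderiv
  rw [partialD, this]
  rfl

theorem partialD_id (j : Fin 3) (x : R3) :
    partialD j (fun y : R3 => y) x = EuclideanSpace.single j 1 := by
  simp [partialD]

/-- The hypothesis `hD` says that f is radial to first order; by rotational equivariance only the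
tensors x ⊗ x and Id then occur. -/
theorem curvature_smul_crossForm {f : R3 → ℝ} {D : ℝ} {x : R3} (hf : DifferentiableAt ℝ f x)
    (hD : ∀ j, partialD j f x = D * x j) (l : Fin 3) :
    curvature (fun y i => f y • crossForm y i) x (l + 1) (l + 2) =
      ((D - f x ^ 2) * x l) • x - (D * ‖x‖ ^ 2 + 2 * f x) • EuclideanSpace.single l 1 := by
  have hd : ∀ i, DifferentiableAt ℝ (fun y => crossForm y i) x := fun i =>
    (contDiff_crossForm i).contDiffAt.differentiableAt (by simp)
  simp only [curvature, partialD_smul hf (hd _), hD, partialD_crossForm]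
  ext a
  simp only [EuclideanSpace.norm_sq_eq, Fin.sum_univ_three, Real.norm_eq_abs, sq_abs]
  fin_cases l <;> fin_cases a <;>
    simp [bracket, crossForm, show (2 : Fin 3) + 1 = 0 from rfl,
      show (1 : Fin 3) + 1 = 2 from rfl, show (1 : Fin 3) + 2 = 0 from rfl,
      show (2 : Fin 3) + 2 = 1 from rfl] <;>
    ring

theorem covDeriv_smul_crossForm {f h : R3 → ℝ} {H : ℝ} {x : R3} (hh : DifferentiableAt ℝ h x)
    (hH : ∀ j, partialD j h x = H * x j) (l : Fin 3) :
    covDeriv (fun y i => f y • crossForm y i) (fun y => h y • y) x l =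
      ((H - f x * h x) * x l) • x + (h x + f x * h x * ‖x‖ ^ 2) • EuclideanSpace.single l 1 := by
  simp only [covDeriv, partialD_smul hh differentiableAt_fun_id, hH, partialD_id]
  ext a
  simp only [EuclideanSpace.norm_sq_eq, Fin.sum_univ_three, Real.norm_eq_abs, sq_abs]
  fin_cases l <;> fin_cases a <;> simp [bracket, crossForm] <;> ring

theorem partialD_norm {x : R3} (hx : x ≠ 0) (j : Fin 3) :
    partialD j (fun y : R3 => ‖y‖) x = x j / ‖x‖ := by
  have hpos : ‖x‖ ≠ 0 := norm_ne_zero_iff.mpr hx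
  have hn := ContDiffAt.smoothDifferentiableAt (contDiffAt_norm' hx)
  have hd : ∀ k, DifferentiableAt ℝ (fun y : R3 => y k) x :=
    fun k => (contDiff_coordinate k).contDiffAt.differentiableAt (by simp)
  have e : (fun y : R3 => ‖y‖ * ‖y‖) = fun y => ∑ k, y k * y k := by
    funext y
    rw [← sq, EuclideanSpace.norm_sq_eq]
    simp [sq]
  have h1 := congrArg (fun F => partialD j F x) e
  simp only [partialD_mul hn hn, partialD_sum _ fun k _ => (hd k).fun_mul (hd k),
    partialD_mul (hd _) (hd _), partialD_coordinate] at h1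
  have h2 : ∑ k, ((x k * if k = j then 1 else 0) + x k * if k = j then 1 else 0) =
      2 * x j := by
    simp only [mul_ite, mul_one, mul_zero, Finset.sum_add_distrib, Finset.sum_ite_eq',
      Finset.mem_univ, if_true]
    ring
  rw [h2] at h1
  rw [eq_div_iff hpos]
  linarith

theorem partialD_radial {k : ℝ → ℝ} {k' : ℝ} {x : R3} (hx : x ≠ 0)
    (hk : HasDerivAt k k' ‖x‖) (j : Fin 3) :
    partialD j (fun y : R3 => k ‖y‖) x = k' / ‖x‖ * x j := by
  rw [partialD_comp (f := fun y : R3 => ‖y‖) hk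
    (ContDiffAt.smoothDifferentiableAt (contDiffAt_norm' hx)), partialD_norm hx]
  ring

/-- The spherically symmetric connection `((k(r) - 1) / r) (n × τ) · dx`. -/
def radialConn (k : ℝ → ℝ) : Conn := fun x i => ((k ‖x‖ - 1) / ‖x‖ ^ 2) • crossForm x i

/-- The spherically symmetric Higgs field `p(r) n · τ`. -/
def radialHiggs (p : ℝ → ℝ) : Higgs := fun x => (p ‖x‖ / ‖x‖) • x

section RadialFields

variable {k p : ℝ → ℝ} {k' p' : ℝ} {x : R3}

theorem differentiableAt_radialCoeff (hx : x ≠ 0) (hk : DifferentiableAt ℝ k ‖x‖) :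
    DifferentiableAt ℝ (fun y : R3 => k ‖y‖) x :=
  hk.comp x (ContDiffAt.smoothDifferentiableAt (contDiffAt_norm' hx))

theorem hasDerivAt_connCoeff {r : ℝ} (hr : r ≠ 0) (hk : HasDerivAt k k' r) :
    HasDerivAt (fun r => (k r - 1) / r ^ 2) (k' / r ^ 2 - 2 * (k r - 1) / r ^ 3) r := by
  refine ((hk.sub_const 1).fun_div (hasDerivAt_pow 2 r) (pow_ne_zero 2 hr)).congr_deriv ?_
  field_simp
  push_cast
  ring

theorem hasDerivAt_higgsCoeff {r : ℝ} (hr : r ≠ 0) (hp : HasDerivAt p p' r) :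
    HasDerivAt (fun r => p r / r) (p' / r - p r / r ^ 2) r := by
  refine (hp.fun_div (hasDerivAt_id' r) hr).congr_deriv ?_
  field_simp

theorem differentiableAt_radialConn (hx : x ≠ 0) (hk : HasDerivAt k k' ‖x‖) (i : Fin 3) :
    DifferentiableAt ℝ (fun y => radialConn k y i) x :=
  (differentiableAt_radialCoeff hx
    (hasDerivAt_connCoeff (norm_ne_zero_iff.mpr hx) hk).differentiableAt).fun_smul
    ((contDiff_crossForm i).contDiffAt.differentiableAt (by simp))

theorem differentiableAt_radialHiggs (hx : x ≠ 0) (hp : HasDerivAt p p' ‖x‖) :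
    DifferentiableAt ℝ (radialHiggs p) x :=
  (differentiableAt_radialCoeff hx
    (hasDerivAt_higgsCoeff (norm_ne_zero_iff.mpr hx) hp).differentiableAt).fun_smul
    differentiableAt_fun_id

theorem curvature_radialConn (hx : x ≠ 0) (hk : HasDerivAt k k' ‖x‖) (l : Fin 3) :
    curvature (radialConn k) x (l + 1) (l + 2) =
      ((k' / ‖x‖ ^ 3 + (1 - k ‖x‖ ^ 2) / ‖x‖ ^ 4) * x l) • x
        - (k' / ‖x‖) • EuclideanSpace.single l 1 := by
  have hr := norm_ne_zero_iff.mpr hx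
  have hc := hasDerivAt_connCoeff hr hk
  have h1 := curvature_smul_crossForm (f := fun y => (k ‖y‖ - 1) / ‖y‖ ^ 2)
    (D := (k' / ‖x‖ ^ 2 - 2 * (k ‖x‖ - 1) / ‖x‖ ^ 3) / ‖x‖)
    (differentiableAt_radialCoeff hx hc.differentiableAt)
    (fun j => partialD_radial hx hc j) l
  refine Eq.trans h1 ?_
  congr 2
  · congr 1
    field_simp
    ring
  · field_simp
    ring

theorem covDeriv_radial (hx : x ≠ 0) (hp : HasDerivAt p p' ‖x‖) (l : Fin 3) :
    covDeriv (radialConn k) (radialHiggs p) x l =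
      ((p' / ‖x‖ ^ 2 - p ‖x‖ * k ‖x‖ / ‖x‖ ^ 3) * x l) • x
        + (p ‖x‖ * k ‖x‖ / ‖x‖) • EuclideanSpace.single l 1 := by
  have hr := norm_ne_zero_iff.mpr hx
  have hc := hasDerivAt_higgsCoeff hr hp
  have h1 := covDeriv_smul_crossForm (f := fun y => (k ‖y‖ - 1) / ‖y‖ ^ 2)
    (h := fun y => p ‖y‖ / ‖y‖)
    (H := (p' / ‖x‖ - p ‖x‖ / ‖x‖ ^ 2) / ‖x‖)
    (differentiableAt_radialCoeff hx hc.differentiableAt)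
    (fun j => partialD_radial hx hc j) l
  refine Eq.trans h1 ?_
  congr 2
  · congr 1
    field_simp
    ring
  · field_simp
    ring

theorem hodgeStar_one (F : Fin 3 → Fin 3 → Su2) (k : Fin 3) :
    hodgeStar 1 F k = F (k + 1) (k + 2) := by
  simp [hodgeStar, Matrix.one_apply]

/-- The Bogomolny equation for spherically symmetric fields on Euclidean space. -/
theorem bogomolny_radial (hx : x ≠ 0) (hk : HasDerivAt k (-(p ‖x‖ * k ‖x‖)) ‖x‖)
    (hp : HasDerivAt p ((1 - k ‖x‖ ^ 2) / ‖x‖ ^ 2) ‖x‖) (l : Fin 3) :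
    hodgeStar 1 (curvature (radialConn k) x) l =
      covDeriv (radialConn k) (radialHiggs p) x l := by
  have hr := norm_ne_zero_iff.mpr hx
  rw [hodgeStar_one, curvature_radialConn hx hk, covDeriv_radial hx hp, sub_eq_add_neg, ← neg_smul]
  -- Comparing the coefficients of x ⊗ x and of Id: this is where the profile equations k' = -pk and
  -- p' = (1 - k²)/r² come from.
  congr 2
  · congr 1
    field_simp
    ring
  · ring

/-- Both k'r and 1 - k² are bounded: the x ⊗ x term contributes 2 + 1 and the Id term 2. -/
theorem norm_curvature_radialConn_le (hx : x ≠ 0) (hk : HasDerivAt k k' ‖x‖)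
    (h0 : 0 ≤ k ‖x‖) (h1 : k ‖x‖ ≤ 1) (h2 : |k' * ‖x‖| ≤ 2) (l : Fin 3) :
    ‖curvature (radialConn k) x (l + 1) (l + 2)‖ ≤ 5 / ‖x‖ ^ 2 := by
  have hr : 0 < ‖x‖ := norm_pos_iff.mpr hx
  rw [curvature_radialConn hx hk]
  refine (norm_sub_le _ _).trans ?_
  rw [norm_smul, norm_smul, PiLp.norm_single, norm_one, mul_one, Real.norm_eq_abs,
    Real.norm_eq_abs, abs_mul]
  have hxl : |x l| ≤ ‖x‖ := PiLp.norm_apply_le x l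
  have e1 : k' / ‖x‖ ^ 3 + (1 - k ‖x‖ ^ 2) / ‖x‖ ^ 4 =
      (k' * ‖x‖ + (1 - k ‖x‖ ^ 2)) / ‖x‖ ^ 4 := by field_simp
  have e2 : k' / ‖x‖ = k' * ‖x‖ / ‖x‖ ^ 2 := by field_simp
  have h3 : |k' * ‖x‖ + (1 - k ‖x‖ ^ 2)| ≤ 3 := by
    refine (abs_add_le _ _).trans ?_
    have : |1 - k ‖x‖ ^ 2| ≤ 1 := abs_le.mpr ⟨by nlinarith, by nlinarith⟩
    linarith
  rw [e1, e2, abs_div, abs_div, abs_of_pos (by positivity : 0 < ‖x‖ ^ 4),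
    abs_of_pos (by positivity : 0 < ‖x‖ ^ 2)]
  calc _ ≤ 3 / ‖x‖ ^ 4 * ‖x‖ * ‖x‖ + 2 / ‖x‖ ^ 2 := by gcongr
    _ = _ := by field_simp; norm_num

end RadialFields

/-! ### The scaled model monopoles -/

/-- The profile of the connection of the BPS-monopole of mass `lam`. -/
def bpsProfile (lam r : ℝ) : ℝ := lam * r / Real.sinh (lam * r)

/-- The profile of the Higgs field of the BPS-monopole of mass `lam`. -/
def bpsHiggsProfile (lam r : ℝ) : ℝ :=
  lam * (Real.cosh (lam * r) / Real.sinh (lam * r)) - 1 / r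

/-- The profile of the connection of the lifted Dirac monopole. -/
def diracProfile (_ : ℝ) : ℝ := 0

/-- The profile of the Higgs field of the lifted Dirac monopole of mass `lam`. -/
def diracHiggsProfile (lam r : ℝ) : ℝ := lam - 1 / r

section Models

variable {lam : ℝ}

theorem unitRadial_smul (hlam : 0 < lam) (x : R3) : unitRadial (lam • x) = unitRadial x := by
  rw [unitRadial, unitRadial, norm_smul, Real.norm_eq_abs, abs_of_pos hlam, smul_smul]
  congr 1
  field_simp

theorem crossForm_zero (i : Fin 3) : crossForm 0 i = 0 := by
  simpa using crossForm_smul 0 0 i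

theorem scaleConn_bpsConn (hlam : 0 < lam) :
    scaleConn lam bpsConn = radialConn (bpsProfile lam) := by
  funext x i
  rw [scaleConn, bpsConn, hedgehogForm_eq, unitRadial_smul hlam, unitRadial, crossForm_smul,
    radialConn, bpsProfile, smul_smul, smul_smul]
  -- At the origin the form vanishes, so the values that division by zero gives to the coefficients
  -- do not matter.
  by_cases hx : x = 0
  · simp [hx, crossForm_zero]
  · have hr : 0 < ‖x‖ := norm_pos_iff.mpr hx
    have hs : Real.sinh (lam * ‖x‖) ≠ 0 := (Real.sinh_pos_iff.mpr (by positivity)).ne'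
    rw [norm_smul, Real.norm_eq_abs, abs_of_pos hlam]
    congr 1
    field_simp

theorem scaleHiggs_bpsHiggs (hlam : 0 < lam) :
    scaleHiggs lam bpsHiggs = radialHiggs (bpsHiggsProfile lam) := by
  funext x
  rw [scaleHiggs, bpsHiggs, unitRadial_smul hlam, unitRadial, radialHiggs, bpsHiggsProfile,
    smul_smul, smul_smul]
  by_cases hx : x = 0
  · simp [hx]
  · have hr : 0 < ‖x‖ := norm_pos_iff.mpr hx
    have hs : Real.sinh (lam * ‖x‖) ≠ 0 := (Real.sinh_pos_iff.mpr (by positivity)).ne'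
    have hc : Real.cosh (lam * ‖x‖) ≠ 0 := (Real.cosh_pos _).ne'
    rw [norm_smul, Real.norm_eq_abs, abs_of_pos hlam, Real.tanh_eq_sinh_div_cosh]
    congr 1
    field_simp

theorem diracConn_eq : diracConn = radialConn diracProfile := by
  funext x i
  rw [diracConn, hedgehogForm_eq, unitRadial, crossForm_smul, radialConn, diracProfile, smul_smul]
  by_cases hx : x = 0
  · simp [hx, crossForm_zero]
  · have hr : 0 < ‖x‖ := norm_pos_iff.mpr hx
    congr 1
    field_simp
    ring

theorem scaleConn_diracConn (hlam : 0 < lam) :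
    scaleConn lam diracConn = radialConn diracProfile := by
  rw [← diracConn_eq]
  funext x i
  rw [scaleConn, diracConn, diracConn, hedgehogForm_eq, unitRadial_smul hlam, ← hedgehogForm_eq,
    smul_smul, norm_smul, Real.norm_eq_abs, abs_of_pos hlam]
  congr 1
  field_simp

theorem scaleHiggs_diracHiggs (hlam : 0 < lam) :
    scaleHiggs lam diracHiggs = radialHiggs (diracHiggsProfile lam) := by
  funext x
  rw [scaleHiggs, diracHiggs, unitRadial_smul hlam, unitRadial, radialHiggs, diracHiggsProfile,
    smul_smul, smul_smul, norm_smul, Real.norm_eq_abs, abs_of_pos hlam]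
  by_cases hx : x = 0
  · simp [hx]
  · have hr : 0 < ‖x‖ := norm_pos_iff.mpr hx
    congr 1
    field_simp

variable {r : ℝ}

theorem sinh_mul_pos (hlam : 0 < lam) (hr : 0 < r) : 0 < Real.sinh (lam * r) :=
  Real.sinh_pos_iff.mpr (by positivity)

theorem hasDerivAt_bpsProfile (hlam : 0 < lam) (hr : 0 < r) :
    HasDerivAt (bpsProfile lam) (-(bpsHiggsProfile lam r * bpsProfile lam r)) r := by
  have hs := (sinh_mul_pos hlam hr).ne'
  have h1 : HasDerivAt (fun r => lam * r) lam r := by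
    simpa using (hasDerivAt_id r).const_mul lam
  refine (h1.fun_div h1.sinh hs).congr_deriv ?_
  rw [bpsHiggsProfile, bpsProfile]
  field_simp
  ring

theorem hasDerivAt_bpsHiggsProfile (hlam : 0 < lam) (hr : 0 < r) :
    HasDerivAt (bpsHiggsProfile lam) ((1 - bpsProfile lam r ^ 2) / r ^ 2) r := by
  have hs := (sinh_mul_pos hlam hr).ne'
  have h1 : HasDerivAt (fun r => lam * r) lam r := by
    simpa using (hasDerivAt_id r).const_mul lam
  refine (((h1.cosh.fun_div h1.sinh hs).const_mul lam).fun_sub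
    ((hasDerivAt_const r (1 : ℝ)).fun_div (hasDerivAt_id' r) hr.ne')).congr_deriv ?_
  rw [bpsProfile]
  have hcs := Real.cosh_sq (lam * r)
  field_simp
  rw [hcs]
  ring

theorem hasDerivAt_diracProfile :
    HasDerivAt diracProfile (-(diracHiggsProfile lam r * diracProfile r)) r := by
  refine (hasDerivAt_const r (0 : ℝ)).congr_deriv ?_
  simp [diracProfile]

theorem hasDerivAt_diracHiggsProfile (hr : 0 < r) :
    HasDerivAt (diracHiggsProfile lam) ((1 - diracProfile r ^ 2) / r ^ 2) r := by
  refine ((hasDerivAt_const r lam).fun_sub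
    ((hasDerivAt_const r (1 : ℝ)).fun_div (hasDerivAt_id' r) hr.ne')).congr_deriv ?_
  simp only [diracProfile]
  ring

/-! ### Estimates for the BPS profiles -/

theorem bpsProfile_nonneg (hlam : 0 < lam) (hr : 0 < r) : 0 ≤ bpsProfile lam r :=
  div_nonneg (by positivity) (sinh_mul_pos hlam hr).le

theorem bpsProfile_le_one (hlam : 0 < lam) (hr : 0 < r) : bpsProfile lam r ≤ 1 := by
  rw [bpsProfile, div_le_one (sinh_mul_pos hlam hr)]
  exact Real.self_le_sinh_iff.mpr (by positivity)

/-- cosh s = 1 + 2 sinh²(s/2), and sinh(s/2) ≥ s/2. -/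
theorem one_add_sq_div_two_le_cosh {s : ℝ} (hs : 0 ≤ s) : 1 + s ^ 2 / 2 ≤ Real.cosh s := by
  have h1 : Real.cosh s = 1 + 2 * Real.sinh (s / 2) ^ 2 := by
    have := Real.cosh_two_mul (s / 2)
    rw [show 2 * (s / 2) = s by ring, Real.cosh_sq] at this
    linarith
  have h2 : s / 2 ≤ Real.sinh (s / 2) := Real.self_le_sinh_iff.mpr (by positivity)
  have h3 : (s / 2) ^ 2 ≤ Real.sinh (s / 2) ^ 2 := by gcongr
  linarith

/-- With s = λr the quantity is s(sinh s - s cosh s)/sinh² s. From sinh s ≥ s one gets s cosh s -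
sinh s ≤ s(cosh s - 1), and s² ≤ 2(cosh s + 1) leaves 2(cosh² s - 1) = 2 sinh² s. -/
theorem abs_bpsProfile_deriv_le (hlam : 0 < lam) (hr : 0 < r) :
    |-(bpsHiggsProfile lam r * bpsProfile lam r) * r| ≤ 2 := by
  have hs := sinh_mul_pos hlam hr
  have e : -(bpsHiggsProfile lam r * bpsProfile lam r) * r =
      lam * r * (Real.sinh (lam * r) - lam * r * Real.cosh (lam * r))
        / Real.sinh (lam * r) ^ 2 := by
    rw [bpsHiggsProfile, bpsProfile]; field_simp; ring
  rw [e]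
  have hpos : 0 < lam * r := by positivity
  generalize lam * r = s at *
  have h1 : s ≤ Real.sinh s := Real.self_le_sinh_iff.mpr hpos.le
  have h2 := one_add_sq_div_two_le_cosh hpos.le
  have h3 := Real.cosh_sq s
  rw [abs_div, abs_of_pos (by positivity : 0 < Real.sinh s ^ 2), div_le_iff₀ (by positivity),
    abs_mul, abs_of_pos hpos]
  rcases le_total 0 (Real.sinh s - s * Real.cosh s) with h | h
  · rw [abs_of_nonneg h]
    have : s * (Real.sinh s - s * Real.cosh s) ≤ Real.sinh s * Real.sinh s :=
      mul_le_mul h1 (by nlinarith [Real.cosh_pos s]) h hs.le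
    nlinarith
  · rw [abs_of_nonpos h]
    have h4 : -(Real.sinh s - s * Real.cosh s) ≤ s * (Real.cosh s - 1) := by linarith
    have h5 : s ^ 2 ≤ 2 * (Real.cosh s + 1) := by linarith
    calc s * -(Real.sinh s - s * Real.cosh s) ≤ s * (s * (Real.cosh s - 1)) := by gcongr
      _ = s ^ 2 * (Real.cosh s - 1) := by ring
      _ ≤ 2 * (Real.cosh s + 1) * (Real.cosh s - 1) := by
          gcongr; nlinarith [sq_nonneg s]
      _ = 2 * Real.sinh s ^ 2 := by linarith

/-- The exponential decay is not needed: sinh s ≥ s²/4 gives λ/sinh(λr) ≤ 4/(λr²), which is at most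
4 from the gluing radius on. -/
theorem div_sinh_le (hlam : 0 < lam) (hr : 0 < r) (h : 1 ≤ lam * r ^ 2) :
    lam / Real.sinh (lam * r) ≤ 4 := by
  rw [div_le_iff₀ (sinh_mul_pos hlam hr)]
  have hpos : 0 < lam * r := by positivity
  have h1 : (lam * r) ^ 2 / 4 ≤ Real.sinh (lam * r) := by
    rw [Real.sinh_eq]
    have h2 := Real.quadratic_le_exp_of_nonneg hpos.le
    have h3 : Real.exp (-(lam * r)) ≤ 1 := Real.exp_le_one_iff.mpr (by linarith)
    linarith
  have h4 : lam * 1 ≤ lam * (lam * r ^ 2) := by gcongr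
  nlinarith

theorem norm_bps_sub_dirac_conn_le {x : R3} (hlam : 0 < lam) (hx : x ≠ 0)
    (h : 1 ≤ lam * ‖x‖ ^ 2) (i : Fin 3) :
    ‖radialConn (bpsProfile lam) x i - radialConn diracProfile x i‖ ≤ 4 := by
  have hr : 0 < ‖x‖ := norm_pos_iff.mpr hx
  have hs := sinh_mul_pos hlam hr
  rw [radialConn, radialConn, ← sub_smul, norm_smul, Real.norm_eq_abs]
  have e : (bpsProfile lam ‖x‖ - 1) / ‖x‖ ^ 2 - (diracProfile ‖x‖ - 1) / ‖x‖ ^ 2 =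
      lam / Real.sinh (lam * ‖x‖) / ‖x‖ := by
    rw [bpsProfile, diracProfile]; field_simp; ring
  rw [e, abs_of_pos (by positivity)]
  calc _ ≤ 4 / ‖x‖ * ‖x‖ := by
        gcongr
        · exact div_sinh_le hlam hr h
        · exact norm_crossForm_le x i
    _ = 4 := by field_simp

/-- The profiles differ by λ(coth(λr) - 1) = λ e^(-λr)/sinh(λr). -/
theorem norm_bps_sub_dirac_higgs_le {x : R3} (hlam : 0 < lam) (hx : x ≠ 0)
    (h : 1 ≤ lam * ‖x‖ ^ 2) :
    ‖radialHiggs (bpsHiggsProfile lam) x - radialHiggs (diracHiggsProfile lam) x‖ ≤ 4 := by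
  have hr : 0 < ‖x‖ := norm_pos_iff.mpr hx
  have hs := sinh_mul_pos hlam hr
  rw [radialHiggs, radialHiggs, ← sub_smul, norm_smul, Real.norm_eq_abs]
  have e : bpsHiggsProfile lam ‖x‖ / ‖x‖ - diracHiggsProfile lam ‖x‖ / ‖x‖ =
      lam / Real.sinh (lam * ‖x‖) * Real.exp (-(lam * ‖x‖)) / ‖x‖ := by
    rw [bpsHiggsProfile, diracHiggsProfile, ← Real.cosh_sub_sinh]; field_simp; ring
  have h3 : Real.exp (-(lam * ‖x‖)) ≤ 1 := Real.exp_le_one_iff.mpr (by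
    have : 0 < lam * ‖x‖ := by positivity
    linarith)
  rw [e, abs_of_pos (by positivity)]
  calc _ ≤ 4 * 1 / ‖x‖ * ‖x‖ := by
        gcongr
        exact div_sinh_le hlam hr h
    _ = 4 := by field_simp

end Models

/-! ### Gluing -/

/-- Interpolation between two connections. -/
def glueConn (χ : R3 → ℝ) (A B : Conn) : Conn := fun x i => χ x • A x i + (1 - χ x) • B x i

/-- Interpolation between two Higgs fields. -/
def glueHiggs (χ : R3 → ℝ) (Φ Ψ : Higgs) : Higgs := fun x => χ x • Φ x + (1 - χ x) • Ψ x

section Glue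

variable {χ : R3 → ℝ} {A B : Conn} {Φ Ψ : Higgs} {x : R3}

theorem partialD_glue {V : Type*} [NormedAddCommGroup V] [NormedSpace ℝ V] {f g : R3 → V}
    (hχ : DifferentiableAt ℝ χ x) (hf : DifferentiableAt ℝ f x) (hg : DifferentiableAt ℝ g x)
    (i : Fin 3) :
    partialD i (fun y => χ y • f y + (1 - χ y) • g y) x =
      χ x • partialD i f x + (1 - χ x) • partialD i g x + partialD i χ x • (f x - g x) := by
  have h1 : DifferentiableAt ℝ (fun y => 1 - χ y) x := hχ.const_sub 1
  rw [partialD_add (hχ.fun_smul hf) (h1.fun_smul hg), partialD_smul hχ hf, partialD_smul h1 hg,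
    partialD_sub (differentiableAt_const _) hχ, partialD_const]
  module

/-- Curvature is quadratic in the connection, so interpolation fails to be affine only by dχ ∧ a and
a multiple χ(1 - χ) of [a, a], both controlled by the difference a = A - B. -/
theorem curvature_glueConn (hχ : DifferentiableAt ℝ χ x)
    (hA : ∀ i, DifferentiableAt ℝ (fun y => A y i) x)
    (hB : ∀ i, DifferentiableAt ℝ (fun y => B y i) x) (i j : Fin 3) :
    curvature (glueConn χ A B) x i j =
      χ x • curvature A x i j + (1 - χ x) • curvature B x i j
        + (partialD i χ x • (A x j - B x j) - partialD j χ x • (A x i - B x i)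
          - (χ x * (1 - χ x)) • bracket (A x i - B x i) (A x j - B x j)) := by
  simp only [curvature, glueConn, partialD_glue hχ (hA _) (hB _)]
  ext a
  fin_cases a <;> simp [bracket] <;> ring

theorem covDeriv_glue (hχ : DifferentiableAt ℝ χ x)
    (hΦ : DifferentiableAt ℝ Φ x) (hΨ : DifferentiableAt ℝ Ψ x) (i : Fin 3) :
    covDeriv (glueConn χ A B) (glueHiggs χ Φ Ψ) x i =
      χ x • covDeriv A Φ x i + (1 - χ x) • covDeriv B Ψ x i
        + (partialD i χ x • (Φ x - Ψ x)
          - (χ x * (1 - χ x)) • bracket (A x i - B x i) (Φ x - Ψ x)) := by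
  have h1 := partialD_glue hχ hΦ hΨ i
  simp only [covDeriv, glueConn]
  unfold glueHiggs
  rw [h1]
  ext a
  fin_cases a <;> simp [bracket] <;> ring

theorem hodgeStar_glue (G : Matrix (Fin 3) (Fin 3) ℝ) (s t : ℝ) (F F' F'' : Fin 3 → Fin 3 → Su2)
    (k : Fin 3) :
    hodgeStar G (fun i j => s • F i j + t • F' i j + F'' i j) k =
      s • hodgeStar G F k + t • hodgeStar G F' k + hodgeStar G F'' k := by
  simp only [hodgeStar, Fin.sum_univ_three]
  module

theorem abs_partialD_le {c : ℝ} (h : ‖fderiv ℝ χ x‖ ≤ c) (i : Fin 3) : |partialD i χ x| ≤ c := by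
  have := (fderiv ℝ χ x).le_opNorm (EuclideanSpace.single i 1)
  rw [PiLp.norm_single, norm_one, mul_one] at this
  exact this.trans h

/-- The Bogomolny error of a glued configuration. -/
theorem norm_bogomolnyError_glue_le {h : R3 → Matrix (Fin 3) (Fin 3) ℝ} {t c a E : ℝ}
    (hh : NearId (h x) t) (ht : t ≤ 1 / 10)
    (hχ : DifferentiableAt ℝ χ x) (h0 : 0 ≤ χ x) (h1 : χ x ≤ 1) (hc : ‖fderiv ℝ χ x‖ ≤ c)
    (hA : ∀ i, DifferentiableAt ℝ (fun y => A y i) x)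
    (hB : ∀ i, DifferentiableAt ℝ (fun y => B y i) x)
    (hΦ : DifferentiableAt ℝ Φ x) (hΨ : DifferentiableAt ℝ Ψ x)
    (hAB : ∀ i, ‖A x i - B x i‖ ≤ a) (hΦΨ : ‖Φ x - Ψ x‖ ≤ a)
    (hEA : ∀ i, ‖bogomolnyError h A Φ x i‖ ≤ E) (hEB : ∀ i, ‖bogomolnyError h B Ψ x i‖ ≤ E)
    (k : Fin 3) :
    ‖bogomolnyError h (glueConn χ A B) (glueHiggs χ Φ Ψ) x k‖ ≤ E + 25 * c * a + 13 * a ^ 2 := by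
  have ha : 0 ≤ a := (norm_nonneg _).trans hΦΨ
  have hc0 : 0 ≤ c := (norm_nonneg _).trans hc
  set F'' : Fin 3 → Fin 3 → Su2 := fun i j =>
    partialD i χ x • (A x j - B x j) - partialD j χ x • (A x i - B x i)
      - (χ x * (1 - χ x)) • bracket (A x i - B x i) (A x j - B x j) with hF''
  have hF : curvature (glueConn χ A B) x =
      fun i j => χ x • curvature A x i j + (1 - χ x) • curvature B x i j + F'' i j := by
    funext i j; exact curvature_glueConn hχ hA hB i j
  have hχχ : |χ x * (1 - χ x)| ≤ 1 := by
    rw [abs_of_nonneg (mul_nonneg h0 (by linarith))]; nlinarith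
  have hbr : ∀ u v : Su2, ‖u‖ ≤ a → ‖v‖ ≤ a →
      ‖(χ x * (1 - χ x)) • bracket u v‖ ≤ a ^ 2 := fun u v hu hv => by
    rw [norm_smul, Real.norm_eq_abs]
    calc _ ≤ 1 * (a * a) := mul_le_mul hχχ ((norm_bracket_le u v).trans
          (mul_le_mul hu hv (norm_nonneg _) ha)) (norm_nonneg _) zero_le_one
      _ = a ^ 2 := by ring
  have hsm : ∀ i (u : Su2), ‖u‖ ≤ a → ‖partialD i χ x • u‖ ≤ c * a := fun i u hu => by
    rw [norm_smul, Real.norm_eq_abs]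
    exact mul_le_mul (abs_partialD_le hc i) hu (norm_nonneg _) hc0
  have hF''le : ∀ l, ‖F'' (l + 1) (l + 2)‖ ≤ 2 * c * a + a ^ 2 := fun l => by
    refine (norm_sub_le _ _).trans (add_le_add ((norm_sub_le _ _).trans ?_)
      (hbr _ _ (hAB _) (hAB _)))
    linarith [hsm (l + 1) _ (hAB (l + 2)), hsm (l + 2) _ (hAB (l + 1))]
  have e : bogomolnyError h (glueConn χ A B) (glueHiggs χ Φ Ψ) x k =
      χ x • bogomolnyError h A Φ x k + (1 - χ x) • bogomolnyError h B Ψ x k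
        + (hodgeStar (h x) F'' k - (partialD k χ x • (Φ x - Ψ x)
          - (χ x * (1 - χ x)) • bracket (A x k - B x k) (Φ x - Ψ x))) := by
    rw [bogomolnyError, hF, hodgeStar_glue, covDeriv_glue hχ hΦ hΨ, bogomolnyError,
      bogomolnyError]
    module
  rw [e]
  have n1 : ‖χ x • bogomolnyError h A Φ x k + (1 - χ x) • bogomolnyError h B Ψ x k‖ ≤ E := by
    refine (norm_add_le _ _).trans ?_
    rw [norm_smul, norm_smul, Real.norm_eq_abs, Real.norm_eq_abs, abs_of_nonneg h0,
      abs_of_nonneg (by linarith : 0 ≤ 1 - χ x)]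
    calc _ ≤ χ x * E + (1 - χ x) * E :=
          add_le_add (mul_le_mul_of_nonneg_left (hEA k) h0)
            (mul_le_mul_of_nonneg_left (hEB k) (by linarith))
      _ = E := by ring
  -- 12(2ca + a²) from the Hodge star and ca + a² from the Higgs field add up to 25ca + 13a².
  have n2 := hh.norm_hodgeStar_le ht hF''le k
  have n3 : ‖partialD k χ x • (Φ x - Ψ x)
      - (χ x * (1 - χ x)) • bracket (A x k - B x k) (Φ x - Ψ x)‖ ≤ c * a + a ^ 2 :=
    (norm_sub_le _ _).trans (add_le_add (hsm k _ hΦΨ) (hbr _ _ (hAB k) hΦΨ))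
  refine (norm_add_le _ _).trans ?_
  have n4 := norm_sub_le (hodgeStar (h x) F'' k) (partialD k χ x • (Φ x - Ψ x)
      - (χ x * (1 - χ x)) • bracket (A x k - B x k) (Φ x - Ψ x))
  linarith

end Glue

/-! ### The error of the approximate monopole -/

theorem NearId.mono {G : Matrix (Fin 3) (Fin 3) ℝ} {s t : ℝ} (h : NearId G s) (hst : s ≤ t) :
    NearId G t := fun i j => (h i j).trans hst

theorem bogomolnyError_congr {h : R3 → Matrix (Fin 3) (Fin 3) ℝ} {A B : Conn} {Φ Ψ : Higgs}
    {x : R3} (hAB : A =ᶠ[𝓝 x] B) (hΦΨ : Φ =ᶠ[𝓝 x] Ψ) (k : Fin 3) :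
    bogomolnyError h A Φ x k = bogomolnyError h B Ψ x k := by
  have hi : ∀ i, (fun y => A y i) =ᶠ[𝓝 x] fun y => B y i := fun i => by
    filter_upwards [hAB] with y hy using congrFun hy i
  have hc : curvature A x = curvature B x := by
    funext i j
    rw [curvature, curvature, partialD_congr (hi j), partialD_congr (hi i), hAB.self_of_nhds]
  rw [bogomolnyError, bogomolnyError, hc, covDeriv, covDeriv, partialD_congr hΦΨ,
    hAB.self_of_nhds, hΦΨ.self_of_nhds]

/-- The error of a Bogomolny solution on Euclidean space with respect to a nearby metric. -/
theorem norm_bogomolnyError_of_euclidean {h : R3 → Matrix (Fin 3) (Fin 3) ℝ} {A : Conn}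
    {Φ : Higgs} {x : R3} {t B : ℝ} (hh : NearId (h x) t) (ht : t ≤ 1 / 10)
    (hA : ∀ k, hodgeStar 1 (curvature A x) k = covDeriv A Φ x k)
    (hF : ∀ l, ‖curvature A x (l + 1) (l + 2)‖ ≤ B) (k : Fin 3) :
    ‖bogomolnyError h A Φ x k‖ ≤ 54 * t * B := by
  rw [bogomolnyError, ← hA]
  exact hh.norm_hodgeStar_sub_le ht hF k

section Bounds

variable {g h : R3 → Matrix (Fin 3) (Fin 3) ℝ} {R m K lam C : ℝ} {A : Conn} {φ ξ ζ w : R3 → ℝ}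
  {x : R3}

/-- Quantitative bounds on the metric and the Dirac monopole at a point. -/
structure LocalBounds (g : R3 → Matrix (Fin 3) (Fin 3) ℝ) (m : ℝ) (A : Conn) (φ : R3 → ℝ)
    (C : ℝ) (x : R3) : Prop where
  nearId : NearId (g x) (C * ‖x‖ ^ 2)
  curvature_le : x ≠ 0 → ∀ l, ‖curvature A x (l + 1) (l + 2)‖ ≤ C / ‖x‖ ^ 2
  conn_sub_le : x ≠ 0 → ∀ i, ‖A x i - diracConn x i‖ ≤ C
  higgs_sub_le : x ≠ 0 → |φ x - (-(1 / (2 * ‖x‖)) + m)| ≤ C * ‖x‖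

/-- Gathers the Taylor bound for g, the curvature growth and the two asymptotic hypotheses into one
constant on one ball, both chosen before λ. -/
theorem exists_localBounds (hR : 0 < R) (hg : IsMetricOn g (Metric.ball 0 R))
    (hnormal : IsNormalCoord g R) (hD : IsDiracMonopole g R m A φ) :
    ∃ C r, 0 < C ∧ 0 < r ∧ r ≤ R ∧ ∀ x : R3, ‖x‖ < r → LocalBounds g m A φ C x := by
  obtain ⟨C1, hC1, h1⟩ := exists_nearId hR hg hnormal
  obtain ⟨C2, hC2, h2⟩ := hD.exists_curvature_bound hR hg hnormal.orthonormal
  choose c3 h3 using fun i => (hD.framing i).bound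
  obtain ⟨c4, h4⟩ := hD.singularity.bound
  have h3' := Filter.eventually_all.mpr h3
  rw [eventually_nhdsWithin_iff] at h2 h3' h4
  obtain ⟨r, hr, hball⟩ := Metric.eventually_nhds_iff_ball.mp
    (h1.and (h2.and (h3'.and h4)))
  have hs : ∀ i, |c3 i| ≤ ∑ i, |c3 i| := fun i =>
    Finset.single_le_sum (f := fun i => |c3 i|) (fun _ _ => abs_nonneg _) (Finset.mem_univ i)
  have hs0 : 0 ≤ ∑ i, |c3 i| := Finset.sum_nonneg fun _ _ => abs_nonneg _
  have ha4 := abs_nonneg c4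
  refine ⟨C1 + C2 + ∑ i, |c3 i| + |c4|, min r R, by linarith, lt_min hr hR, min_le_right _ _,
    fun x hx => ?_⟩
  obtain ⟨b1, b2, b3, b4⟩ := hball x (by simpa using hx.trans_le (min_le_left _ _))
  refine ⟨b1.mono ?_, fun hx0 l => (b2 hx0 l).trans ?_, fun hx0 i => (b3 hx0 i).trans ?_,
    fun hx0 => (b4 hx0).trans ?_⟩
  · gcongr; linarith
  · gcongr; linarith
  · rw [norm_one, mul_one]
    linarith [le_abs_self (c3 i), hs i]
  · rw [norm_norm]
    gcongr
    linarith [le_abs_self c4]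

/-- The 16 is (4ε)²/ε², for points where h = g; |K| accounts for the transition shell. -/
theorem IsExtendedMetric.nearId {ε : ℝ} (hh : IsExtendedMetric g h ε K) (hC : 0 < C)
    (hx : ‖x‖ ≤ 4 * ε) (hg : NearId (g x) (C * ‖x‖ ^ 2)) :
    NearId (h x) ((16 * C + |K|) * ε ^ 2) := by
  have hε : 0 ≤ ε := by linarith [norm_nonneg x]
  rcases le_total ‖x‖ (3 * ε) with h3 | h3
  · rw [hh.inner x h3]
    refine hg.mono ?_
    calc C * ‖x‖ ^ 2 ≤ C * (4 * ε) ^ 2 := by gcongr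
      _ ≤ _ := by nlinarith [mul_nonneg (abs_nonneg K) (sq_nonneg ε)]
  · intro i j
    refine (hh.shell x h3 hx i j).trans ?_
    gcongr
    linarith [le_abs_self K]

theorem bps_bogomolny (hlam : 0 < lam) (hx : x ≠ 0) (k : Fin 3) :
    hodgeStar 1 (curvature (radialConn (bpsProfile lam)) x) k =
      covDeriv (radialConn (bpsProfile lam)) (radialHiggs (bpsHiggsProfile lam)) x k :=
  bogomolny_radial hx (hasDerivAt_bpsProfile hlam (norm_pos_iff.mpr hx))
    (hasDerivAt_bpsHiggsProfile hlam (norm_pos_iff.mpr hx)) k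

theorem dirac_bogomolny (hx : x ≠ 0) (k : Fin 3) :
    hodgeStar 1 (curvature (radialConn diracProfile) x) k =
      covDeriv (radialConn diracProfile) (radialHiggs (diracHiggsProfile lam)) x k :=
  bogomolny_radial hx hasDerivAt_diracProfile
    (hasDerivAt_diracHiggsProfile (norm_pos_iff.mpr hx)) k

theorem norm_curvature_bps_le (hlam : 0 < lam) (hx : x ≠ 0) (l : Fin 3) :
    ‖curvature (radialConn (bpsProfile lam)) x (l + 1) (l + 2)‖ ≤ 5 / ‖x‖ ^ 2 :=
  have hr := norm_pos_iff.mpr hx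
  norm_curvature_radialConn_le hx (hasDerivAt_bpsProfile hlam hr) (bpsProfile_nonneg hlam hr)
    (bpsProfile_le_one hlam hr) (abs_bpsProfile_deriv_le hlam hr) l

theorem norm_curvature_dirac_le (hx : x ≠ 0) (l : Fin 3) :
    ‖curvature (radialConn diracProfile) x (l + 1) (l + 2)‖ ≤ 5 / ‖x‖ ^ 2 :=
  norm_curvature_radialConn_le hx (hasDerivAt_diracProfile (lam := 0)) le_rfl zero_le_one
    (by simp [diracProfile]) l

theorem LocalBounds.norm_higgs_sub_le (hb : LocalBounds g m A φ C x) (hx : x ≠ 0) :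
    ‖liftHiggs (fun y => φ y + (lam / 2 - m)) x - radialHiggs (diracHiggsProfile lam) x‖ ≤
      2 * (C * ‖x‖) := by
  have hr : 0 < ‖x‖ := norm_pos_iff.mpr hx
  have e : liftHiggs (fun y => φ y + (lam / 2 - m)) x - radialHiggs (diracHiggsProfile lam) x =
      (2 * (φ x - (-(1 / (2 * ‖x‖)) + m))) • unitRadial x := by
    rw [liftHiggs, radialHiggs, diracHiggsProfile, unitRadial, smul_smul, smul_smul, ← sub_smul]
    congr 1
    field_simp
    ring
  rw [e, norm_smul, norm_unitRadial hx, mul_one, Real.norm_eq_abs, abs_mul, abs_two]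
  linarith [hb.higgs_sub_le hx]

/-- The error of the Dirac monopole of `g` with respect to a metric close to `g`. -/
theorem LocalBounds.norm_bogomolnyError_le (hb : LocalBounds g m A φ C x) (hC : 0 < C) {T ε : ℝ}
    (hD : IsDiracMonopole g R m A φ) (hx : x ∈ Metric.ball (0 : R3) R \ {0})
    (hh : NearId (h x) (T * ε ^ 2)) (hT : 0 ≤ T) (hCT : 16 * C ≤ T) (hε : 0 < ε)
    (ht : T * ε ^ 2 ≤ 1 / 10) (hr1 : ε ≤ ‖x‖) (hr4 : ‖x‖ ≤ 4 * ε) (k : Fin 3) (c : ℝ) :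
    ‖bogomolnyError h A (liftHiggs fun y => φ y + c) x k‖ ≤ 108 * T * C * 16 := by
  have hr : 0 < ‖x‖ := hε.trans_le hr1
  have hg : NearId (g x) (T * ε ^ 2) := hb.nearId.mono (by
    calc C * ‖x‖ ^ 2 ≤ C * (4 * ε) ^ 2 := by gcongr
      _ ≤ _ := by nlinarith [sq_nonneg ε])
  -- The field solves the equation of g, so its h-error is (∗_h - ∗_g)F, here compared through the
  -- Euclidean star.
  have e : bogomolnyError h A (liftHiggs fun y => φ y + c) x k =
      (hodgeStar (h x) (curvature A x) k - hodgeStar 1 (curvature A x) k)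
        - (hodgeStar (g x) (curvature A x) k - hodgeStar 1 (curvature A x) k) := by
    rw [bogomolnyError, hD.covDeriv_shift hx, hD.hodgeStar_curvature hx]
    abel
  have hF : ∀ l, ‖curvature A x (l + 1) (l + 2)‖ ≤ C / ε ^ 2 := fun l =>
    (hb.curvature_le hx.2 l).trans (by gcongr)
  rw [e]
  refine (norm_sub_le _ _).trans ((add_le_add (hh.norm_hodgeStar_sub_le ht hF k)
    (hg.norm_hodgeStar_sub_le ht hF k)).trans ?_)
  have : 54 * (T * ε ^ 2) * (C / ε ^ 2) = 54 * T * C := by field_simp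
  rw [this]
  -- The sum is 108TC; the factor 16 is slack.
  nlinarith [mul_nonneg hT hC.le]

theorem glueScale_pos (hlam : 0 < lam) : 0 < glueScale lam :=
  inv_pos.mpr (Real.sqrt_pos.mpr hlam)

theorem glueScale_sq (hlam : 0 < lam) : glueScale lam ^ 2 = lam⁻¹ := by
  rw [glueScale, inv_pow, Real.sq_sqrt hlam.le]

theorem eventually_norm_lt {a : ℝ} (h : ‖x‖ < a) : ∀ᶠ y in 𝓝 x, ‖y‖ < a :=
  continuous_norm.continuousAt.eventually (gt_mem_nhds h)

theorem eventually_lt_norm {a : ℝ} (h : a < ‖x‖) : ∀ᶠ y in 𝓝 x, a < ‖y‖ :=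
  continuous_norm.continuousAt.eventually (lt_mem_nhds h)

variable {ε c₁ c₂ : ℝ}

/-! ### Germs of the approximate monopole on overlapping open regions -/

theorem approxConn_eventuallyEq_bps (hlam : 0 < lam) (hε : 0 < ε)
    (hξ : IsCutoff ξ ε (2 * ε) c₁) (hζ : IsCutoff ζ (3 * ε) (4 * ε) c₂) (hx : ‖x‖ < ε) :
    approxConn lam ξ ζ A =ᶠ[𝓝 x] radialConn (bpsProfile lam) := by
  filter_upwards [eventually_norm_lt hx] with y hy
  funext i
  rw [approxConn, hξ.eq_one y hy.le, hζ.eq_one y (by linarith), scaleConn_bpsConn hlam]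
  simp

theorem approxHiggs_eventuallyEq_bps (hlam : 0 < lam) (hε : 0 < ε)
    (hξ : IsCutoff ξ ε (2 * ε) c₁) (hζ : IsCutoff ζ (3 * ε) (4 * ε) c₂) (hx : ‖x‖ < ε) :
    approxHiggs lam m ξ ζ φ =ᶠ[𝓝 x] radialHiggs (bpsHiggsProfile lam) := by
  filter_upwards [eventually_norm_lt hx] with y hy
  rw [approxHiggs, hξ.eq_one y hy.le, hζ.eq_one y (by linarith), scaleHiggs_bpsHiggs hlam]
  simp

theorem approxConn_eventuallyEq_inner (hlam : 0 < lam)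
    (hζ : IsCutoff ζ (3 * ε) (4 * ε) c₂) (hx : ‖x‖ < 3 * ε) :
    approxConn lam ξ ζ A =ᶠ[𝓝 x] glueConn ξ (radialConn (bpsProfile lam)) A := by
  filter_upwards [eventually_norm_lt hx] with y hy
  funext i
  rw [approxConn, hζ.eq_one y hy.le, scaleConn_bpsConn hlam, glueConn]
  simp

theorem approxHiggs_eventuallyEq_inner (hlam : 0 < lam)
    (hζ : IsCutoff ζ (3 * ε) (4 * ε) c₂) (hx : ‖x‖ < 3 * ε) :
    approxHiggs lam m ξ ζ φ =ᶠ[𝓝 x] glueHiggs ξ (radialHiggs (bpsHiggsProfile lam))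
      (liftHiggs fun y => φ y + (lam / 2 - m)) := by
  filter_upwards [eventually_norm_lt hx] with y hy
  rw [approxHiggs, hζ.eq_one y hy.le, scaleHiggs_bpsHiggs hlam, glueHiggs]
  simp

theorem approxConn_eventuallyEq_outer (hlam : 0 < lam)
    (hξ : IsCutoff ξ ε (2 * ε) c₁) (hx : 2 * ε < ‖x‖) :
    approxConn lam ξ ζ A =ᶠ[𝓝 x] glueConn ζ A (radialConn diracProfile) := by
  filter_upwards [eventually_lt_norm hx] with y hy
  funext i
  rw [approxConn, hξ.eq_zero y hy.le, scaleConn_diracConn hlam, glueConn]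
  simp

theorem approxHiggs_eventuallyEq_outer (hlam : 0 < lam)
    (hξ : IsCutoff ξ ε (2 * ε) c₁) (hx : 2 * ε < ‖x‖) :
    approxHiggs lam m ξ ζ φ =ᶠ[𝓝 x] glueHiggs ζ (liftHiggs fun y => φ y + (lam / 2 - m))
      (radialHiggs (diracHiggsProfile lam)) := by
  filter_upwards [eventually_lt_norm hx] with y hy
  rw [approxHiggs, hξ.eq_zero y hy.le, scaleHiggs_diracHiggs hlam, glueHiggs]
  simp

theorem approxConn_eventuallyEq_dirac (hlam : 0 < lam)
    (hζ : IsCutoff ζ (3 * ε) (4 * ε) c₂) (hx : 4 * ε < ‖x‖) :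
    approxConn lam ξ ζ A =ᶠ[𝓝 x] radialConn diracProfile := by
  filter_upwards [eventually_lt_norm hx] with y hy
  funext i
  rw [approxConn, hζ.eq_zero y hy.le, scaleConn_diracConn hlam]
  simp

theorem approxHiggs_eventuallyEq_dirac (hlam : 0 < lam)
    (hζ : IsCutoff ζ (3 * ε) (4 * ε) c₂) (hx : 4 * ε < ‖x‖) :
    approxHiggs lam m ξ ζ φ =ᶠ[𝓝 x] radialHiggs (diracHiggsProfile lam) := by
  filter_upwards [eventually_lt_norm hx] with y hy
  rw [approxHiggs, hζ.eq_zero y hy.le, scaleHiggs_diracHiggs hlam]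
  simp

theorem IsCutoff.differentiableAt {a b c : ℝ} (hξ : IsCutoff ξ a b c) (x : R3) :
    DifferentiableAt ℝ ξ x := ContDiffAt.smoothDifferentiableAt hξ.smooth.contDiffAt

theorem IsDiracMonopole.differentiableAt_lift (hD : IsDiracMonopole g R m A φ)
    (hx : x ∈ Metric.ball (0 : R3) R \ {0}) (c : ℝ) :
    DifferentiableAt ℝ (liftHiggs fun y => φ y + c) x :=
  (((ContDiffAt.smoothDifferentiableAt (hD.contDiffAt_higgs hx)).fun_add
    (differentiableAt_const c)).const_mul 2).fun_smul
    (ContDiffAt.smoothDifferentiableAt (contDiffAt_unitRadial hx.2))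

/-- The error vanishes where the approximate monopole is the Euclidean Dirac monopole. -/
theorem bogomolnyError_approx_eq_zero (hlam : 0 < lam) (hε : 0 < ε)
    (hh : IsExtendedMetric g h ε K) (hζ : IsCutoff ζ (3 * ε) (4 * ε) c₂) (hx : 4 * ε < ‖x‖)
    (k : Fin 3) :
    bogomolnyError h (approxConn lam ξ ζ A) (approxHiggs lam m ξ ζ φ) x k = 0 := by
  have hx0 : x ≠ 0 := norm_pos_iff.mp (by linarith)
  rw [bogomolnyError_congr (approxConn_eventuallyEq_dirac hlam hζ hx)
    (approxHiggs_eventuallyEq_dirac hlam hζ hx), bogomolnyError, hh.outer x hx.le,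
    dirac_bogomolny hx0, sub_self]

/-- A bound, up to the factor `1 / ε`, on the error of the approximate monopole. -/
def errorConst (K C : ℝ) : ℝ :=
  270 * (16 * C + |K|) + 108 * (16 * C + |K|) * C * 16 + 25 * |K| * (4 + 3 * C)
    + 13 * (4 + 3 * C) ^ 2

theorem norm_bogomolnyError_approx_le (hlam : 0 < lam) (hε : ε = glueScale lam)
    (hε1 : 4 * ε ≤ 1) (hεR : 4 * ε < R) (hC : 0 < C)
    (hsmall : (16 * C + |K|) * ε ^ 2 ≤ 1 / 10)
    (hD : IsDiracMonopole g R m A φ) (hb : LocalBounds g m A φ C x)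
    (hh : IsExtendedMetric g h ε K) (hξ : IsCutoff ξ ε (2 * ε) (K / ε))
    (hζ : IsCutoff ζ (3 * ε) (4 * ε) (K / ε)) (hx : x ≠ 0) (hx4 : ‖x‖ ≤ 4 * ε) (k : Fin 3) :
    ‖bogomolnyError h (approxConn lam ξ ζ A) (approxHiggs lam m ξ ζ φ) x k‖ ≤
      errorConst K C / ε := by
  have hε0 : 0 < ε := hε ▸ glueScale_pos hlam
  have hr : 0 < ‖x‖ := norm_pos_iff.mpr hx
  have hxU : x ∈ Metric.ball (0 : R3) R \ {0} := ⟨by simpa using hx4.trans_lt hεR, hx⟩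
  -- The choice ε² = λ⁻¹ enters here: from radius ε on, BPS and Dirac fields differ by at most 4.
  have hlamr : ε ≤ ‖x‖ → 1 ≤ lam * ‖x‖ ^ 2 := fun h => by
    have h1 : ε ^ 2 ≤ ‖x‖ ^ 2 := by gcongr
    rw [hε, glueScale_sq hlam] at h1
    calc 1 = lam * lam⁻¹ := (mul_inv_cancel₀ hlam.ne').symm
      _ ≤ _ := by gcongr
  set T := 16 * C + |K| with hT
  have hK0 := abs_nonneg K
  have hT0 : 0 ≤ T := by positivity
  have hhx : NearId (h x) (T * ε ^ 2) := hh.nearId hC hx4 hb.nearId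
  have hcle : ∀ {χ : R3 → ℝ}, ‖fderiv ℝ χ x‖ ≤ K / ε → ‖fderiv ℝ χ x‖ ≤ |K| / ε :=
    fun h => h.trans (by gcongr; exact le_abs_self K)
  have hE : 0 ≤ 108 * T * C * 16 := by positivity
  have hend : 270 * T + 108 * T * C * 16 + 25 * (|K| / ε) * (4 + 3 * C)
      + 13 * (4 + 3 * C) ^ 2 ≤ errorConst K C / ε := by
    rw [errorConst, ← hT, le_div_iff₀ hε0]
    have h1 : 0 ≤ 270 * T + 108 * T * C * 16 + 13 * (4 + 3 * C) ^ 2 := by positivity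
    have h2 : (270 * T + 108 * T * C * 16 + 13 * (4 + 3 * C) ^ 2) * ε ≤
        (270 * T + 108 * T * C * 16 + 13 * (4 + 3 * C) ^ 2) * 1 := by
      gcongr; linarith
    have h3 : 25 * (|K| / ε) * (4 + 3 * C) * ε = 25 * |K| * (4 + 3 * C) := by field_simp
    linarith
  have hbps : ‖x‖ ≤ 3 * ε → ∀ k, ‖bogomolnyError h (radialConn (bpsProfile lam))
      (radialHiggs (bpsHiggsProfile lam)) x k‖ ≤ 270 * T := fun h3 k => by
    -- The sharp bound Cr² is needed rather than Tε²: r may be far smaller than ε, and only r²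
    -- cancels the curvature bound 5/r².
    have hn : NearId (h x) (C * ‖x‖ ^ 2) := by rw [hh.inner x h3]; exact hb.nearId
    have hn' : C * ‖x‖ ^ 2 ≤ T * ε ^ 2 := by
      calc C * ‖x‖ ^ 2 ≤ C * (4 * ε) ^ 2 := by gcongr
        _ ≤ _ := by rw [hT]; nlinarith [mul_nonneg hK0 (sq_nonneg ε)]
    refine (norm_bogomolnyError_of_euclidean hn (hn'.trans hsmall) (bps_bogomolny hlam hx)
      (norm_curvature_bps_le hlam hx) k).trans ?_
    have : 54 * (C * ‖x‖ ^ 2) * (5 / ‖x‖ ^ 2) = 270 * C := by field_simp; norm_num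
    rw [this]
    linarith
  have hdir : ε ≤ ‖x‖ → ∀ k, ‖bogomolnyError h (radialConn diracProfile)
      (radialHiggs (diracHiggsProfile lam)) x k‖ ≤ 270 * T := fun h1 k => by
    refine (norm_bogomolnyError_of_euclidean hhx hsmall (dirac_bogomolny hx)
      (norm_curvature_dirac_le hx) k).trans ?_
    calc 54 * (T * ε ^ 2) * (5 / ‖x‖ ^ 2) ≤ 54 * (T * ε ^ 2) * (5 / ε ^ 2) := by gcongr
      _ = 270 * T := by field_simp; ring
  have hDirac : ε ≤ ‖x‖ → ∀ k, ‖bogomolnyError h A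
      (liftHiggs fun y => φ y + (lam / 2 - m)) x k‖ ≤ 108 * T * C * 16 := fun h1 k =>
    hb.norm_bogomolnyError_le hC hD hxU hhx hT0 (by linarith) hε0 hsmall h1 hx4 k _
  have hAS : ∀ i, ‖A x i - radialConn diracProfile x i‖ ≤ C := by
    rw [← diracConn_eq]; exact hb.conn_sub_le hx
  have hΦS : ‖liftHiggs (fun y => φ y + (lam / 2 - m)) x
      - radialHiggs (diracHiggsProfile lam) x‖ ≤ 2 * C := by
    refine (hb.norm_higgs_sub_le hx).trans ?_
    have : C * ‖x‖ ≤ C * 1 := by gcongr; linarith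
    linarith
  have dA : ∀ i, DifferentiableAt ℝ (fun y => A y i) x :=
    fun i => ContDiffAt.smoothDifferentiableAt (hD.contDiffAt_conn hxU i)
  have dΦ := hD.differentiableAt_lift hxU (lam / 2 - m)
  rcases lt_or_ge ‖x‖ ε with h1 | h1
  · rw [bogomolnyError_congr (approxConn_eventuallyEq_bps hlam hε0 hξ hζ h1)
      (approxHiggs_eventuallyEq_bps hlam hε0 hξ hζ h1)]
    refine (hbps (by linarith) k).trans (le_trans ?_ hend)
    have : 0 ≤ 25 * (|K| / ε) * (4 + 3 * C) + 13 * (4 + 3 * C) ^ 2 := by positivity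
    linarith
  rcases lt_or_ge ‖x‖ (3 * ε) with h3 | h3
  · rw [bogomolnyError_congr (approxConn_eventuallyEq_inner hlam hζ h3)
      (approxHiggs_eventuallyEq_inner hlam hζ h3)]
    -- In a = 4 + 3C, 4 bounds BPS minus Euclidean Dirac, and 3C covers Dirac minus Dirac: C for the
    -- connections, 2C for the Higgs fields.
    refine (norm_bogomolnyError_glue_le hhx hsmall (hξ.differentiableAt x) (hξ.nonneg x)
      (hξ.le_one x) (hcle (hξ.grad x))
      (differentiableAt_radialConn hx (hasDerivAt_bpsProfile hlam hr)) dA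
      (differentiableAt_radialHiggs hx (hasDerivAt_bpsHiggsProfile hlam hr)) dΦ
      (a := 4 + 3 * C) (E := 270 * T + 108 * T * C * 16) (fun i => ?_) ?_
      (fun k => (hbps h3.le k).trans (by linarith))
      (fun k => (hDirac h1 k).trans (by linarith)) k).trans hend
    · have := norm_sub_le_norm_sub_add_norm_sub (radialConn (bpsProfile lam) x i)
        (radialConn diracProfile x i) (A x i)
      rw [norm_sub_rev (radialConn diracProfile x i)] at this
      linarith [norm_bps_sub_dirac_conn_le hlam hx (hlamr h1) i, hAS i]
    · have := norm_sub_le_norm_sub_add_norm_sub (radialHiggs (bpsHiggsProfile lam) x)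
        (radialHiggs (diracHiggsProfile lam) x) (liftHiggs (fun y => φ y + (lam / 2 - m)) x)
      rw [norm_sub_rev (radialHiggs (diracHiggsProfile lam) x)] at this
      linarith [norm_bps_sub_dirac_higgs_le hlam hx (hlamr h1)]
  · have h2 : 2 * ε < ‖x‖ := by linarith
    rw [bogomolnyError_congr (approxConn_eventuallyEq_outer hlam hξ h2)
      (approxHiggs_eventuallyEq_outer hlam hξ h2)]
    exact (norm_bogomolnyError_glue_le hhx hsmall (hζ.differentiableAt x) (hζ.nonneg x)
      (hζ.le_one x) (hcle (hζ.grad x)) dA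
      (differentiableAt_radialConn hx (hasDerivAt_diracProfile (lam := lam))) dΦ
      (differentiableAt_radialHiggs hx (hasDerivAt_diracHiggsProfile hr))
      (a := 4 + 3 * C) (E := 270 * T + 108 * T * C * 16)
      (fun i => (hAS i).trans (by linarith)) (hΦS.trans (by linarith))
      (fun k => (hDirac h1 k).trans (by linarith))
      (fun k => (hdir h1 k).trans (by linarith)) k).trans hend

end Bounds

/-! ### The weight -/

section Weight

variable {g h : R3 → Matrix (Fin 3) (Fin 3) ℝ} {lam ε : ℝ} {w : R3 → ℝ} {x : R3}

theorem geodesicDist_nonneg (h : R3 → Matrix (Fin 3) (Fin 3) ℝ) (x : R3) :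
    0 ≤ geodesicDist h x := by
  refine Real.sInf_nonneg ?_
  rintro L ⟨γ, -, -, -, rfl⟩
  exact intervalIntegral.integral_nonneg zero_le_one fun t _ => Real.sqrt_nonneg _

/-- The geodesic distance is at most the length of the straight segment. -/
theorem geodesicDist_le (hn : ∀ y : R3, ‖y‖ ≤ ‖x‖ → NearId (h y) (1 / 10)) :
    geodesicDist h x ≤ 2 * ‖x‖ := by
  have hd : deriv (fun t : ℝ => t • x) = fun _ => x := by
    funext t; simpa using ((hasDerivAt_id t).smul_const x).deriv
  have hlen : curveLength h (fun t => t • x) ≤ 2 * ‖x‖ := by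
    refine (le_abs_self _).trans ?_
    have := intervalIntegral.norm_integral_le_of_norm_le_const (a := (0 : ℝ)) (b := 1)
      (C := 2 * ‖x‖) (f := fun t => √(∑ i, ∑ j, h (t • x) i j * deriv (fun s : ℝ => s • x) t i *
        deriv (fun s : ℝ => s • x) t j)) (fun t ht => by
        rw [Set.uIoc_of_le zero_le_one] at ht
        rw [Real.norm_eq_abs, abs_of_nonneg (Real.sqrt_nonneg _),
          Real.sqrt_le_left (by positivity)]
        have hnorm : ‖t • x‖ ≤ ‖x‖ := by
          rw [norm_smul, Real.norm_eq_abs, abs_of_pos ht.1]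
          exact mul_le_of_le_one_left (norm_nonneg x) ht.2
        have h1 := (abs_le.mp ((hn _ hnorm).quadratic_bounds x)).2
        have h2 : ‖x‖ ^ 2 = ∑ i, x i ^ 2 := by simp [EuclideanSpace.norm_sq_eq]
        simp only [hd]
        rw [← h2] at h1
        nlinarith [sq_nonneg ‖x‖])
    simpa [curveLength] using this
  have hmem : curveLength h (fun t => t • x) ∈
      {L | ∃ γ : ℝ → R3, ContDiff ℝ 1 γ ∧ γ 0 = 0 ∧ γ 1 = x ∧ curveLength h γ = L} :=
    ⟨fun t => t • x, contDiff_id.smul contDiff_const, by simp, by simp, rfl⟩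
  refine (csInf_le ⟨0, ?_⟩ hmem).trans hlen
  rintro L ⟨γ, -, -, -, rfl⟩
  exact intervalIntegral.integral_nonneg zero_le_one fun t _ => Real.sqrt_nonneg _

/-- The geodesic distance is at most 2r ≤ 8ε ≤ 1/2, so the explicit formula for w applies, and λ⁻² +
(8ε)² = ε⁴ + 64ε² ≤ (9ε)². -/
theorem IsWeight.abs_le (hw : IsWeight h lam w) (hlam : 0 < lam) (hε : ε = glueScale lam)
    (hε1 : 16 * ε ≤ 1) (hn : ∀ y : R3, ‖y‖ ≤ 4 * ε → NearId (h y) (1 / 10))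
    (hx : ‖x‖ ≤ 4 * ε) : |w x| ≤ 9 * ε := by
  have hε0 : 0 < ε := hε ▸ glueScale_pos hlam
  have h1 := geodesicDist_le (h := h) (x := x) fun y hy => hn y (hy.trans hx)
  have h0 := geodesicDist_nonneg h x
  have h2 : (lam ^ 2)⁻¹ = (ε ^ 2) ^ 2 := by rw [hε, glueScale_sq hlam, inv_pow]
  rw [hw.near x (by linarith), abs_of_nonneg (Real.sqrt_nonneg _),
    Real.sqrt_le_left (by positivity), h2]
  have h3 : geodesicDist h x ^ 2 ≤ (8 * ε) ^ 2 := by gcongr; linarith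
  have h4 : (ε ^ 2) ^ 2 ≤ ε ^ 2 := by
    have : ε ^ 2 ≤ 1 := by nlinarith
    nlinarith [sq_nonneg ε]
  nlinarith [sq_nonneg ε]

end Weight

/-! ### Measurability -/

section Measurability

open MeasureTheory

variable {g h : R3 → Matrix (Fin 3) (Fin 3) ℝ} {R m K lam ε c₁ c₂ : ℝ} {A : Conn}
  {Φ : Higgs} {φ ξ ζ w : R3 → ℝ}

theorem measurable_partialD {V : Type*} [NormedAddCommGroup V] [NormedSpace ℝ V]
    [CompleteSpace V] [MeasurableSpace V] [BorelSpace V] (i : Fin 3) (f : R3 → V) :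
    Measurable (partialD i f) :=
  measurable_fderiv_apply_const ℝ f _

theorem continuous_bracket : Continuous fun p : Su2 × Su2 => bracket p.1 p.2 :=
  (isBoundedBilinearMap_bracket.contDiff (n := 0)).continuous

theorem aemeasurable_bracket {u v : R3 → Su2} (hu : AEMeasurable u) (hv : AEMeasurable v) :
    AEMeasurable fun x => bracket (u x) (v x) :=
  continuous_bracket.measurable.comp_aemeasurable (hu.prodMk hv)

theorem IsMetricOn.measurable (hh : IsMetricOn h Set.univ) (i j : Fin 3) :
    Measurable fun x => h x i j :=
  (contDiffOn_univ.mp (hh.smooth i j)).continuous.measurable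

theorem IsMetricOn.measurable_det (hh : IsMetricOn h Set.univ) :
    Measurable fun x => (h x).det := by
  have := hh.measurable
  simp only [Matrix.det_fin_three]
  fun_prop

theorem IsMetricOn.measurable_inv (hh : IsMetricOn h Set.univ) (i j : Fin 3) :
    Measurable fun x => (h x)⁻¹ i j := by
  have hm := hh.measurable
  have ha : Measurable fun x => (h x).adjugate i j := by
    simp only [Matrix.adjugate_fin_three]
    fin_cases i <;> fin_cases j <;> simp <;> fun_prop
  simp only [Matrix.inv_def, Ring.inverse_eq_inv', Matrix.smul_apply, smul_eq_mul]
  exact hh.measurable_det.inv.mul ha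

/-- Partial derivatives are measurable for arbitrary functions, so only the fields themselves need
checking. -/
theorem aemeasurable_bogomolnyError (hh : IsMetricOn h Set.univ)
    (hA : ∀ i, AEMeasurable fun x => A x i) (hΦ : AEMeasurable Φ) (k : Fin 3) :
    AEMeasurable fun x => bogomolnyError h A Φ x k := by
  have hc : ∀ i j, AEMeasurable fun x => curvature A x i j := fun i j =>
    ((measurable_partialD _ _).aemeasurable.sub (measurable_partialD _ _).aemeasurable).add
      (aemeasurable_bracket (hA i) (hA j))
  have hs : AEMeasurable fun x => hodgeStar (h x) (curvature A x) k :=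
    (hh.measurable_det.sqrt.inv.aemeasurable).smul
      (Finset.aemeasurable_fun_sum _ fun l _ =>
        (hh.measurable k l).aemeasurable.smul (hc (l + 1) (l + 2)))
  exact hs.sub ((measurable_partialD _ _).aemeasurable.add (aemeasurable_bracket (hA k) hΦ))

theorem aemeasurable_formNorm (hh : IsMetricOn h Set.univ) {e : R3 → Fin 3 → Su2}
    (he : ∀ i, AEMeasurable fun x => e x i) : AEMeasurable (formNorm h e) := by
  refine AEMeasurable.sqrt (Finset.aemeasurable_fun_sum _ fun i _ =>
    Finset.aemeasurable_fun_sum _ fun j _ => ?_)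
  exact (hh.measurable_inv i j).aemeasurable.mul ((he i).inner (he j))

theorem aemeasurable_of_continuousAt {f : R3 → Su2} (hf : ∀ x ≠ 0, ContinuousAt f x) :
    AEMeasurable f := by
  have h1 : ContinuousOn f {0}ᶜ := fun x hx => (hf x hx).continuousWithinAt
  have h2 := h1.aemeasurable (μ := volume) (measurableSet_singleton (0 : R3)).compl
  rwa [Measure.restrict_eq_self_of_ae_mem] at h2
  exact compl_mem_ae_iff.mpr (measure_singleton 0)

theorem aemeasurable_approxConn (hlam : 0 < lam) (hεR : 4 * ε < R)
    (hD : IsDiracMonopole g R m A φ) (hξ : IsCutoff ξ ε (2 * ε) c₁)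
    (hζ : IsCutoff ζ (3 * ε) (4 * ε) c₂) (i : Fin 3) :
    AEMeasurable fun x => approxConn lam ξ ζ A x i := by
  refine aemeasurable_of_continuousAt fun x hx => ?_
  have hr : 0 < ‖x‖ := norm_pos_iff.mpr hx
  have dS := differentiableAt_radialConn hx (hasDerivAt_diracProfile (lam := lam)) i
  -- Beyond 4ε the connection A need not be regular, as the point may lie outside its domain; there
  -- ζ removes it.
  rcases lt_or_ge (4 * ε) ‖x‖ with h4 | h4
  · have : (fun y => approxConn lam ξ ζ A y i) =ᶠ[𝓝 x] fun y => radialConn diracProfile y i := by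
      filter_upwards [approxConn_eventuallyEq_dirac hlam hζ h4] with y hy using congrFun hy i
    exact dS.continuousAt.congr this.symm
  · have hxU : x ∈ Metric.ball (0 : R3) R \ {0} := ⟨by simpa using h4.trans_lt hεR, hx⟩
    simp only [approxConn, scaleConn_bpsConn hlam, scaleConn_diracConn hlam]
    have dB := differentiableAt_radialConn hx (hasDerivAt_bpsProfile hlam hr) i
    have dA := ContDiffAt.smoothDifferentiableAt (hD.contDiffAt_conn hxU i)
    have dξ := hξ.differentiableAt x
    have dζ := hζ.differentiableAt x
    exact ((dζ.fun_smul ((dξ.fun_smul dB).fun_add ((dξ.const_sub 1).fun_smul dA))).fun_add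
      ((dζ.const_sub 1).fun_smul dS)).continuousAt

theorem aemeasurable_approxHiggs (hlam : 0 < lam) (hεR : 4 * ε < R)
    (hD : IsDiracMonopole g R m A φ) (hξ : IsCutoff ξ ε (2 * ε) c₁)
    (hζ : IsCutoff ζ (3 * ε) (4 * ε) c₂) :
    AEMeasurable (approxHiggs lam m ξ ζ φ) := by
  refine aemeasurable_of_continuousAt fun x hx => ?_
  have hr : 0 < ‖x‖ := norm_pos_iff.mpr hx
  have dS := differentiableAt_radialHiggs hx (hasDerivAt_diracHiggsProfile (lam := lam) hr)
  rcases lt_or_ge (4 * ε) ‖x‖ with h4 | h4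
  · exact dS.continuousAt.congr (approxHiggs_eventuallyEq_dirac hlam hζ h4).symm
  · have hxU : x ∈ Metric.ball (0 : R3) R \ {0} := ⟨by simpa using h4.trans_lt hεR, hx⟩
    unfold approxHiggs
    rw [scaleHiggs_bpsHiggs hlam, scaleHiggs_diracHiggs hlam]
    have dB := differentiableAt_radialHiggs hx (hasDerivAt_bpsHiggsProfile hlam hr)
    have dΦ := hD.differentiableAt_lift hxU (lam / 2 - m)
    have dξ := hξ.differentiableAt x
    have dζ := hζ.differentiableAt x
    exact ((dζ.fun_smul ((dξ.fun_smul dB).fun_add ((dξ.const_sub 1).fun_smul dΦ))).fun_add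
      ((dζ.const_sub 1).fun_smul dS)).continuousAt

end Measurability

/-! ### The estimate in `L³` -/

section LpEstimate

open MeasureTheory

variable {h : R3 → Matrix (Fin 3) (Fin 3) ℝ} {f : R3 → ℝ} {B r : ℝ}

theorem volumeMeasure_closedBall_le (hr : 0 ≤ r)
    (hh : ∀ x : R3, ‖x‖ ≤ r → √(h x).det ≤ 2) :
    volumeMeasure h (Metric.closedBall 0 r) ≤
      ENNReal.ofReal (2 * r ^ 3 * (volume (Metric.ball (0 : R3) 1)).toReal) := by
  rw [volumeMeasure, withDensity_apply _ Metric.isClosed_closedBall.measurableSet]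
  calc _ ≤ ∫⁻ _ in Metric.closedBall (0 : R3) r, ENNReal.ofReal 2 :=
        setLIntegral_mono measurable_const fun x hx =>
          ENNReal.ofReal_le_ofReal (hh x (by simpa using hx))
    _ = ENNReal.ofReal 2 * volume (Metric.closedBall (0 : R3) r) := by
        rw [setLIntegral_const]
    _ = _ := by
        have hV : volume (Metric.ball (0 : R3) 1) ≠ ⊤ := measure_ball_lt_top.ne
        rw [Measure.addHaar_closedBall _ _ hr, finrank_euclideanSpace_fin,
          ENNReal.ofReal_mul (by positivity), ENNReal.ofReal_mul (by norm_num),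
          ENNReal.ofReal_toReal hV, mul_assoc]

/-- Comparison with B times the indicator of the ball. The origin is negligible because the volume
measure of h is absolutely continuous. -/
theorem eLpNorm_le_of_bounded_on_ball (hr : 0 ≤ r) (hB : 0 ≤ B)
    (hh : ∀ x : R3, ‖x‖ ≤ r → √(h x).det ≤ 2)
    (h1 : ∀ x : R3, x ≠ 0 → ‖x‖ ≤ r → |f x| ≤ B) (h2 : ∀ x : R3, r < ‖x‖ → f x = 0) :
    eLpNorm f 3 (volumeMeasure h) ≤ ENNReal.ofReal
      (B * (2 * r ^ 3 * (volume (Metric.ball (0 : R3) 1)).toReal) ^ (1 / 3 : ℝ)) := by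
  have hae : ∀ᵐ x ∂volumeMeasure h, ‖f x‖ ≤
      ‖(Metric.closedBall (0 : R3) r).indicator (fun _ => B) x‖ := by
    have h0 : ∀ᵐ x ∂(volume : Measure R3), x ≠ 0 := compl_mem_ae_iff.mpr (measure_singleton 0)
    filter_upwards [(withDensity_absolutelyContinuous _ _).ae_le h0] with x hx
    rcases le_or_gt ‖x‖ r with hr | hr
    · rw [Set.indicator_of_mem (by simpa using hr), Real.norm_eq_abs, Real.norm_eq_abs,
        abs_of_nonneg hB]
      exact h1 x hx hr
    · rw [h2 x hr, norm_zero]; exact norm_nonneg _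
  refine (eLpNorm_mono_ae hae).trans ((eLpNorm_indicator_const_le B 3).trans ?_)
  rw [ENNReal.ofReal_mul hB, ← ENNReal.ofReal_rpow_of_nonneg (by positivity) (by norm_num),
    Real.enorm_eq_ofReal hB]
  have h3 : (1 : ℝ) / (3 : ENNReal).toReal = 1 / 3 := by norm_num
  rw [h3]
  gcongr
  exact volumeMeasure_closedBall_le hr hh

end LpEstimate

end ApproxMonopole

end

/-! ### Assembling the L³ estimate -/

open ApproxMonopole MeasureTheory in
theorem mainTheorem7 (R : ℝ) (hR : 0 < R)
    (g : ApproxMonopole.R3 → Matrix (Fin 3) (Fin 3) ℝ)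
    (hg : ApproxMonopole.IsMetricOn g (Metric.ball 0 R))
    (hnormal : ApproxMonopole.IsNormalCoord g R)
    (m : ℝ) (A : ApproxMonopole.Conn) (φ : ApproxMonopole.R3 → ℝ)
    (hD : ApproxMonopole.IsDiracMonopole g R m A φ)
    (K : ℝ) (δ : ℝ) (hδ : 0 < δ) :
    ∃ lam₀ : ℝ, 0 < lam₀ ∧ ∀ lam : ℝ, lam₀ ≤ lam →
      ∀ (h : ApproxMonopole.R3 → Matrix (Fin 3) (Fin 3) ℝ) (ξ ζ w : ApproxMonopole.R3 → ℝ),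
        ApproxMonopole.IsExtendedMetric g h (ApproxMonopole.glueScale lam) K →
        ApproxMonopole.IsCutoff ξ (ApproxMonopole.glueScale lam)
          (2 * ApproxMonopole.glueScale lam) (K / ApproxMonopole.glueScale lam) →
        ApproxMonopole.IsCutoff ζ (3 * ApproxMonopole.glueScale lam)
          (4 * ApproxMonopole.glueScale lam) (K / ApproxMonopole.glueScale lam) →
        ApproxMonopole.IsWeight h lam w →
        MeasureTheory.MemLp (fun x => w x * ApproxMonopole.formNorm h
            (ApproxMonopole.bogomolnyError h (ApproxMonopole.approxConn lam ξ ζ A)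
              (ApproxMonopole.approxHiggs lam m ξ ζ φ)) x)
          3 (ApproxMonopole.volumeMeasure h) ∧
        MeasureTheory.eLpNorm (fun x => w x * ApproxMonopole.formNorm h
            (ApproxMonopole.bogomolnyError h (ApproxMonopole.approxConn lam ξ ζ A)
              (ApproxMonopole.approxHiggs lam m ξ ζ φ)) x)
          3 (ApproxMonopole.volumeMeasure h) < ENNReal.ofReal δ := by
  obtain ⟨C, r, hC, hr, hrR, hloc⟩ := exists_localBounds hR hg hnormal hD
  set V := (volume (Metric.ball (0 : R3) 1)).toReal with hV
  have hE : 0 ≤ errorConst K C := by rw [errorConst]; positivity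
  -- 108 = 12 · 9: the factor of `NearId.formNorm_le` times that of the weight. The rest is the cube
  -- root of the volume bound for the ball of radius 4ε.
  have hlim : Filter.Tendsto
      (fun ε : ℝ => 108 * errorConst K C * (2 * (4 * ε) ^ 3 * V) ^ (1 / 3 : ℝ)) (𝓝 0) (𝓝 0) := by
    have hc : Continuous
        (fun ε : ℝ => 108 * errorConst K C * (2 * (4 * ε) ^ 3 * V) ^ (1 / 3 : ℝ)) :=
      continuous_const.mul ((by fun_prop : Continuous fun ε : ℝ => 2 * (4 * ε) ^ 3 * V).rpow_const
        fun _ => Or.inr (by norm_num))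
    simpa using hc.tendsto 0
  -- Used with c = 1, to keep the geodesic distance at most 1/2 where r ≤ 4ε, and with c = r, to
  -- place that ball where the local bounds hold.
  have hlin : ∀ c : ℝ, 0 < c → ∀ᶠ ε : ℝ in 𝓝 0, 16 * ε < c := fun c hc =>
    (by fun_prop : Continuous fun ε : ℝ => 16 * ε).continuousAt.eventually
      (gt_mem_nhds (by simpa using hc))
  have hsq : ∀ᶠ ε : ℝ in 𝓝 0, (16 * C + |K|) * ε ^ 2 < 1 / 10 :=
    (by fun_prop : Continuous fun ε : ℝ => (16 * C + |K|) * ε ^ 2).continuousAt.eventually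
      (gt_mem_nhds (by simp))
  obtain ⟨ε₀, hε₀, hball⟩ := Metric.eventually_nhds_iff_ball.mp
    ((hlim.eventually (gt_mem_nhds hδ)).and
      ((hlin 1 one_pos).and ((hlin r hr).and hsq)))
  -- Since ε² = λ⁻¹, this forces ε < ε₀; the summand 1 makes the inequality strict.
  refine ⟨(ε₀ ^ 2)⁻¹ + 1, by positivity, fun lam hlam₀ h ξ ζ w hh hξ hζ hw => ?_⟩
  have hlam : 0 < lam := lt_of_lt_of_le (by positivity) hlam₀
  obtain ⟨ε, hε⟩ : ∃ ε, ε = glueScale lam := ⟨_, rfl⟩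
  rw [← hε] at hh hξ hζ
  have hεpos : 0 < ε := hε ▸ glueScale_pos hlam
  have hεlt : ε < ε₀ := by
    refine lt_of_pow_lt_pow_left₀ 2 hε₀.le ?_
    rw [hε, glueScale_sq hlam, inv_lt_comm₀ hlam (by positivity)]
    linarith
  obtain ⟨hsmall, h16, hεr, hT⟩ := hball ε (by
    rw [Metric.mem_ball, Real.dist_eq, sub_zero, abs_of_pos hεpos]; exact hεlt)
  have hεR : 4 * ε < R := by linarith
  have hnear : ∀ y : R3, ‖y‖ ≤ 4 * ε → NearId (h y) (1 / 10) := fun y hy =>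
    (hh.nearId hC hy (hloc y (by linarith)).nearId).mono hT.le
  have hmeas : AEStronglyMeasurable (fun x => w x * formNorm h
      (bogomolnyError h (approxConn lam ξ ζ A) (approxHiggs lam m ξ ζ φ)) x)
      (volumeMeasure h) := by
    have h1 := hw.measurable.aemeasurable.mul (aemeasurable_formNorm hh.metric
      fun i => aemeasurable_bogomolnyError hh.metric
        (fun i => aemeasurable_approxConn hlam hεR hD hξ hζ i)
        (aemeasurable_approxHiggs (m := m) (φ := φ) hlam hεR hD hξ hζ) i)
    exact (h1.mono_ac (withDensity_absolutelyContinuous _ _)).aestronglyMeasurable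
  have hbound := eLpNorm_le_of_bounded_on_ball (h := h) (r := 4 * ε)
    (B := 108 * errorConst K C) (f := fun x => w x * formNorm h
      (bogomolnyError h (approxConn lam ξ ζ A) (approxHiggs lam m ξ ζ φ)) x)
    (by positivity) (by positivity)
    (fun x hx => ((hnear x hx).sqrt_det_bounds le_rfl).2)
    (fun x hx hx4 => by
      have h1 := NearId.formNorm_le (hnear x hx4) le_rfl (norm_bogomolnyError_approx_le hlam hε
        (by linarith) hεR hC hT.le hD (hloc x (by linarith)) hh hξ hζ hx hx4)
      have h2 := hw.abs_le hlam hε h16.le hnear hx4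
      have h3 : |formNorm h (bogomolnyError h (approxConn lam ξ ζ A)
          (approxHiggs lam m ξ ζ φ)) x| ≤ 12 * (errorConst K C / ε) := by
        rwa [formNorm, abs_of_nonneg (Real.sqrt_nonneg _)]
      -- The weight 9ε cancels the 1/ε of the error.
      refine (abs_mul_le_mul h2 h3).trans (le_of_eq ?_)
      field_simp
      ring)
    (fun x hx => by
      have : ∀ k, bogomolnyError h (approxConn lam ξ ζ A) (approxHiggs lam m ξ ζ φ) x k = 0 :=
        bogomolnyError_approx_eq_zero hlam hεpos hh hζ hx
      simp [formNorm, this])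
  have hlt := hbound.trans_lt ((ENNReal.ofReal_lt_ofReal_iff hδ).mpr hsmall)
  exact ⟨⟨hmeas, hlt.trans ENNReal.ofReal_lt_top⟩, hlt⟩
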